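/- **Conventions.** For $\gamma\in\mathbb R$ let $\mathbb E^{(\gamma)}=\{y\in\mathbb R:1+\gamma y>0\}$ and let $\overline{\mathbb E}{}^{(\gamma)}$ be its closure on the right in $[-\infty,\infty]$, i.e. $(-1/\gamma,\infty]$, $(-\infty,\infty]$, $(-\infty,1/|\gamma|]$ for $\gamma>0$, $\gamma=0$, $\gamma<0$. Read $(1+\gamma y)^{-1/\gamma}$ as $e^{-y}$ if $\gamma=0$; sets $A\times(y,\infty]$ are understood as subsets of $[-\infty,\infty]\times\overline{\mathbb E}{}^{(\gamma)}$. For functions $\alpha>0$, $\beta\in\mathbb R$ on $(0,\infty)$ write $\alpha,\beta\in\mathrm{ERV}_{\rho,k}$ if, as $t\to\infty$, $\alpha(tx)/\alpha(t)\to x^\rho$ and $(\beta(tx)-\beta(t))/\alpha(t)\to\psi(x)$ for all $x>0$, where $\psi(x)=k\rho^{-1}(x^\rho-1)$ if $\rho\ne0$ and $\psi(x)=k\log x$ if $\rho=0$. A finite measure on $[-\infty,\infty]$ is called *non-degenerate* if its restriction to $\mathbb R$ is not concentrated on a single point (in particular is not zero); if it has no mass at $\pm\infty$, this just says that it is not a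 multiple of a point mass. For a probability measure $G$ on $[-\infty,\infty)$ write $G(x)=G([-\infty,x])$. **Theorem 5.3.** Let $(X,Y)$ be a random vector in $\mathbb R^2$ such that, for some $\gamma\in\mathbb R$, $a(t)>0$ and $b(t)\in\mathbb R$, as $t\to\infty$, $$t\,\mathbb P[Y>a(t)y+b(t)]\to(1+\gamma y)^{-1/\gamma},\qquad y\in\mathbb E^{(\gamma)}.$$ Let $K(y,\cdot)$, a transition kernel from $\mathbb R$ to $[-\infty,\infty]$, be a version of $\mathbb P[X\in\cdot\mid Y=y]$, let $y^*=\sup\{y:F_Y(y)<1\}\le\infty$, and suppose that for some functions $\tilde\alpha>0$, $\tilde\beta\in\mathbb R$ and some non-degenerate probability measure $G$ on $[-\infty,\infty)$, as $t\uparrow y^*$, $$K\bigl(t,[-\infty,\tilde\alpha(t)x+\tilde\beta(t)]\bigr)\Rightarrow G(x)\quad\text{on }[-\infty,\infty],$$ i.e. there is convergence at every continuity point $x\in\mathbb R$ of $G$. Let $b^*$ be any continuous, strictly monotone function on $(0,\infty)$ with $(b^*(t)-b(t))/a(t)\to0$ as $t\to\infty$, and put $\alpha=\tilde\alpha\circ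 b^*$, $\beta=\tilde\beta\circ b^*$. (i) There is a non-null Radon measure $\mu$ on $[-\infty,\infty]\times\overline{\mathbb E}{}^{(\gamma)}$ such that, as $t\to\infty$, $$t\,\mathbb P\Bigl[\Bigl(\frac{X-\beta(t)}{\alpha(t)},\frac{Y-b(t)}{a(t)}\Bigr)\in\cdot\,\Bigr]\to\mu\quad\text{vaguely on }[-\infty,\infty]\times\overline{\mathbb E}{}^{(\gamma)},$$ and such that for every $y\in\mathbb E^{(\gamma)}$ the measure $\mu(\cdot\times(y,\infty])$ is non-degenerate and $\mu(\{\infty\}\times(y,\infty])=0$, if and only if $\alpha,\beta\in\mathrm{ERV}_{\rho,k}$ for some $\rho,k\in\mathbb R$. (ii) In this case $\mu$ is given by $$\mu([-\infty,x]\times(y,\infty])=\int_0^{(1+\gamma y)^{-1/\gamma}}G(u^\rho x+\psi(u))\,du,\qquad x\in\mathbb R,\ y\in\mathbb E^{(\gamma)}.$$ (iii) If moreover $(\rho,k)\ne(0,0)$, this expression is continuous in $(x,y)$ at every point of $\mathbb R\times\mathbb E^{(\gamma)}$, except possibly at the points with $x=-k/\rho$ in the case that $\rho\ne0$ and $G(\{-k/\rho\})>0$.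 -/

import Mathlib

open MeasureTheory ProbabilityTheory Filter Topology Set

/-- The interval `E_γ = {y ∈ ℝ : 1 + γ y > 0}`. -/
def EInterval (γ : ℝ) : Set ℝ := {y | 0 < 1 + γ * y}

/-- The closure on the right of `E_γ` inside `[-∞, ∞]`: `(-1/γ, ∞]` for `γ > 0`,
`(-∞, ∞]` for `γ = 0` and `(-∞, 1/|γ|]` for `γ < 0`. -/
noncomputable def EIntervalRightClosed (γ : ℝ) : Set EReal :=
  Ioc (if 0 < γ then ((-γ⁻¹ : ℝ) : EReal) else ⊥) (if γ < 0 then ((-γ⁻¹ : ℝ) : EReal) else ⊤)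

/-- `(1 + γ y)^(-1/γ)`, read as `exp (-y)` when `γ = 0`. -/
noncomputable def gevTail (γ y : ℝ) : ℝ :=
  if γ = 0 then Real.exp (-y) else (1 + γ * y) ^ (-1 / γ)

/-- The law `F` of a real random variable is attracted to `G_γ` with normalizations `a, b`:
`t F((a(t) y + b(t), ∞)) → (1 + γ y)^(-1/γ)` as `t → ∞`, for all `y ∈ E_γ`. -/
def InDomainOfAttraction (F : Measure ℝ) (γ : ℝ) (a b : ℝ → ℝ) : Prop :=
  ∀ y ∈ EInterval γ,
    Tendsto (fun t : ℝ => t * F.real (Ioi (a t * y + b t))) atTop (𝓝 (gevTail γ y))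

/-- The upper endpoint `y* = sup {y : F((-∞, y]) < 1}`, in `[-∞, ∞]`. -/
noncomputable def upperEndpoint (F : Measure ℝ) : EReal :=
  sSup ((fun y : ℝ => (y : EReal)) '' {y | F (Iic y) < 1})

/-- The filter on `ℝ` of neighbourhoods of the upper endpoint `y*` to its left: `t ↑ y*`
if `y*` is finite, `t → ∞` if `y* = ∞`. -/
noncomputable def toUpperEndpoint (F : Measure ℝ) : Filter ℝ :=
  comap (fun y : ℝ => (y : EReal)) (𝓝[<] upperEndpoint F)

/-- The limit function of extended regular variation. -/
noncomputable def ervPsi (ρ k x : ℝ) : ℝ :=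
  if ρ = 0 then k * Real.log x else k * ρ⁻¹ * (x ^ ρ - 1)

/-- `α, β ∈ ERV_{ρ,k}`, for functions on `(0, ∞)` with `α > 0`. -/
structure IsERV (α β : ℝ → ℝ) (ρ k : ℝ) : Prop where
  scale : ∀ x : ℝ, 0 < x → Tendsto (fun t : ℝ => α (t * x) / α t) atTop (𝓝 (x ^ ρ))
  loc : ∀ x : ℝ, 0 < x →
    Tendsto (fun t : ℝ => (β (t * x) - β t) / α t) atTop (𝓝 (ervPsi ρ k x))

/-- A finite measure `ν` on `[-∞, ∞]` is non-degenerate if its restriction to `ℝ` is not carried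
by a single point (nor zero); that is, `x ↦ ν [-∞, x]`, `x ∈ ℝ`, is not of the form
`p + q 1{x ≥ c}`. If `ν` has no mass at `±∞` this says that `ν` is not a multiple of a point
mass. -/
def NondegenerateOnReals (ν : Measure EReal) : Prop :=
  ¬ ∃ c : ℝ, ν {x | x ≠ ⊥ ∧ x ≠ ⊤ ∧ x ≠ (c : EReal)} = 0

/-- Kernel convergence: `K(s, [-∞, α(s) x + β(s)]) ⇒ G([-∞, x])` along the filter `l`, as
weak convergence of distribution functions on `[-∞, ∞]`, i.e. convergence at every
continuity point `x ∈ ℝ` of the limit. -/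
def KernelConverges (K : Kernel ℝ EReal) (α β : ℝ → ℝ) (G : Measure EReal)
    (l : Filter ℝ) : Prop :=
  ∀ x : ℝ, G {(x : EReal)} = 0 →
    Tendsto (fun s : ℝ => K s (Iic ((α s * x + β s : ℝ) : EReal))) l (𝓝 (G (Iic (x : EReal))))

/-- The state space `[-∞, ∞] × \bar E_γ` of the conditional extreme value model. -/
abbrev CEVSpace (γ : ℝ) : Type := EReal × EIntervalRightClosed γ

/-- The rectangle `A × (y, ∞]` in `[-∞, ∞] × \bar E_γ`. -/
def upperRect (γ : ℝ) (A : Set EReal) (y : ℝ) : Set (CEVSpace γ) :=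
  {p | p.1 ∈ A ∧ (y : EReal) < (p.2 : EReal)}

/-- Vague convergence: convergence of the integrals of all continuous functions with compact
support. -/
def VagueTendsto {E : Type*} [TopologicalSpace E] [MeasurableSpace E]
    (ν : ℝ → Measure E) (l : Filter ℝ) (μ : Measure E) : Prop :=
  ∀ f : CompactlySupportedContinuousMap E ℝ,
    Tendsto (fun t => ∫ z, f z ∂(ν t)) l (𝓝 (∫ z, f z ∂μ))

/-- The measure `t P[((X - β(t))/α(t), (Y - b(t))/a(t)) ∈ ·]` on `[-∞, ∞] × \bar E_γ`. -/
noncomputable def scaledLaw {Ω : Type*} [MeasurableSpace Ω] (P : Measure Ω) (X Y : Ω → ℝ)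
    (γ : ℝ) (α β a b : ℝ → ℝ) (t : ℝ) : Measure (CEVSpace γ) :=
  ENNReal.ofReal t •
    (P.map (fun ω => ((((X ω - β t) / α t : ℝ) : EReal), (((Y ω - b t) / a t : ℝ) : EReal)))).comap
      (fun p : CEVSpace γ => (p.1, (p.2 : EReal)))

/-- `(X, Y)` follows a conditional extreme value model with normalizations `α, β, a, b`
and limit `μ`: `μ` is a Radon measure on `[-∞, ∞] × \bar E_γ`, it is the vague limit of
`t P[((X - β(t))/α(t), (Y - b(t))/a(t)) ∈ ·]`, and it is conditionally non-degenerate. -/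
structure IsCEVMLimit {Ω : Type*} [MeasurableSpace Ω] (P : Measure Ω) (X Y : Ω → ℝ)
    (γ : ℝ) (α β a b : ℝ → ℝ) (μ : Measure (CEVSpace γ)) : Prop where
  radon : IsFiniteMeasureOnCompacts μ
  ne_zero : μ ≠ 0
  vague : VagueTendsto (scaledLaw P X Y γ α β a b) atTop μ
  nondegenerate : ∀ y ∈ EInterval γ,
    NondegenerateOnReals ((μ.restrict (upperRect γ univ y)).map Prod.fst)
  no_mass_top : ∀ y ∈ EInterval γ, μ (upperRect γ {⊤} y) = 0

/-- `∫_0^{(1 + γ y)^(-1/γ)} G([-∞, u^ρ x + ψ(u)]) du`. -/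
noncomputable def limitMass (G : Measure EReal) (γ ρ k x y : ℝ) : ENNReal :=
  ∫⁻ u in Ioo 0 (gevTail γ y), G (Iic ((u ^ ρ * x + ervPsi ρ k u : ℝ) : EReal))

/-! Everything is read off at upper quantile levels. If `Q` is the upper quantile function of `Y`,
then `t` times the law of `Y` is the image of Lebesgue measure on `(0, t)` under `u ↦ Q (u / t)`.
The scaled law of `(X, Y)` is therefore a Lebesgue mixture over `u` of the kernels `K (Q (u / t))`,
normalized affinely at `t` and placed at height `(Q (u / t) - b t) / a t`. This height tends to
`gevQuantile γ u`, and it exceeds `y` in the limit exactly when `u < gevTail γ y`.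

Suppose `α, β` are extended regularly varying. Since `bs` is continuous and injective, `Q (u / t) =
bs (t * w)` with `w → 1 / u`. Normalized at `t * w`, the kernel there tends to `G`; going from `t *
w` to `t` costs an affine map tending to the one attached to `1 / u`, whose inverse is `x ↦ u ^ ρ *
x + ψ u`. Dominated convergence in `u` gives the limit measure, and uniqueness of vague limits the
formula for every limit `μ`. Since `w` moves with `t`, regular variation is needed locally
uniformly, although no regularity of `α, β` is assumed.

The uniformity, and also the converse, rest on a scaling identity: by substitution the mixture over
`(0, U / w)` at `t` is `w⁻¹` times the mixture over `(0, U)` at `t * w` (`integral_scale_eq`). As `w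
→ 1` the ranges `(0, U)` and `(0, U / w)` differ by a short interval, so the same mixtures converge
to one nondegenerate limit under the normalizations at `t` and at `t * w`; convergence of types
makes the two equivalent (`asympInvariant_of_tendsto_integral`).

For the converse, vague convergence supplies limits `m U` of the mixtures. For fixed `c` near `1`
the changes of type from `t` to `t * c` are precompact by asymptotic invariance, and every cluster
point carries `m (1 / c)` to `c⁻¹ * m 1`, which determines it. Taking powers reaches all `c > 0`,
and the limits form an affine cocycle continuous at `1`, hence a power together with `ervPsi`. -/

/-! ### Convergence of types -/

/-- A function on the line which is not constant on either side of some point. -/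
def NondegenerateFun (F : ℝ → ℝ) : Prop :=
  ¬ ∃ c : ℝ, (∀ x y, x < c → y < c → F x = F y) ∧ (∀ x y, c < x → c < y → F x = F y)

theorem exists_mem_Ioo_of_ae {p : ℝ → Prop} (h : ∀ᵐ x : ℝ, p x) {a b : ℝ} (hab : a < b) :
    ∃ x, a < x ∧ x < b ∧ p x := by
  by_contra! hcon
  have h0 : (volume : Measure ℝ) (Ioo a b) = 0 :=
    measure_mono_null (fun x hx => hcon x hx.1 hx.2) h
  simp [Real.volume_Ioo] at h0
  linarith

theorem StieltjesFunction.eq_of_ae_eq {F H : StieltjesFunction ℝ} (h : ∀ᵐ x : ℝ, F x = H x)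
    (x : ℝ) : F x = H x := by
  have hF := (F.right_continuous x).mono Ioi_subset_Ici_self
  have hH := (H.right_continuous x).mono Ioi_subset_Ici_self
  refine tendsto_nhds_unique_of_frequently_eq hF hH ?_
  rw [frequently_iff]
  intro s hs
  obtain ⟨z, hz, hzs⟩ := (mem_nhdsGT_iff_exists_Ioo_subset).1 hs
  obtain ⟨y, h1, h2, h3⟩ := exists_mem_Ioo_of_ae h hz
  exact ⟨y, hzs ⟨h1, h2⟩, h3⟩

theorem Monotone.ae_continuousAt_affine {F : ℝ → ℝ} (hF : Monotone F) {a : ℝ} (ha : a ≠ 0)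
    (b : ℝ) : ∀ᵐ x : ℝ, ContinuousAt F (a * x + b) := by
  have hc : {x | ¬ ContinuousAt F x}.Countable := hF.countable_not_continuousAt
  have : ((fun x => a * x + b) ⁻¹' {x | ¬ ContinuousAt F x}).Countable :=
    hc.preimage fun x y hxy => by simpa [ha] using hxy
  exact this.measure_zero volume

section types

variable {ι : Type*} {l : Filter ι} {f : ι → ℝ → ℝ}

/-- Monotonicity traps `f i (z i)` between the values at two fixed points of convergence, one on
each side of `x`; continuity of `F` at `x` closes the gap. -/
theorem tendsto_apply_of_ae {F : ℝ → ℝ} (hf : ∀ i, Monotone (f i))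
    (hfF : ∀ᵐ x : ℝ, Tendsto (fun i => f i x) l (𝓝 (F x))) {z : ι → ℝ} {x : ℝ}
    (hz : Tendsto z l (𝓝 x)) (hx : ContinuousAt F x) :
    Tendsto (fun i => f i (z i)) l (𝓝 (F x)) := by
  refine tendsto_order.2 ⟨fun r hr => ?_, fun r hr => ?_⟩
  · obtain ⟨a, b, ⟨h1, h2⟩, h3⟩ := mem_nhds_iff_exists_Ioo_subset.1 (hx.eventually (lt_mem_nhds hr))
    obtain ⟨y, h4, h5, h6⟩ := exists_mem_Ioo_of_ae hfF h1
    filter_upwards [h6.eventually (lt_mem_nhds (h3 ⟨h4, h5.trans h2⟩ : r < F y)),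
      hz.eventually (lt_mem_nhds h5)] with i hi hi'
    exact hi.trans_le (hf i hi'.le)
  · obtain ⟨a, b, ⟨h1, h2⟩, h3⟩ := mem_nhds_iff_exists_Ioo_subset.1 (hx.eventually (gt_mem_nhds hr))
    obtain ⟨y, h4, h5, h6⟩ := exists_mem_Ioo_of_ae hfF h2
    filter_upwards [h6.eventually (gt_mem_nhds (h3 ⟨h1.trans h4, h5⟩ : F y < r)),
      hz.eventually (gt_mem_nhds h4)] with i hi hi'
    exact (hf i hi'.le).trans_lt hi

/-- If monotone functions converge before and after convergent affine changes of variable, then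
the limits are related by the limiting change of variable. -/
theorem apply_affine_eq_of_tendsto [NeBot l] {F H : StieltjesFunction ℝ}
    (hf : ∀ i, Monotone (f i)) {A B : ι → ℝ} {a b : ℝ} (ha : 0 < a)
    (hA : Tendsto A l (𝓝 a)) (hB : Tendsto B l (𝓝 b))
    (h1 : ∀ᵐ x : ℝ, Tendsto (fun i => f i x) l (𝓝 (F x)))
    (h2 : ∀ᵐ x : ℝ, Tendsto (fun i => f i (A i * x + B i)) l (𝓝 (H x))) (x : ℝ) :
    F (a * x + b) = H x := by
  -- As `a > 0`, the composite is again right-continuous, so it suffices to compare it with `H`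
  -- almost everywhere.
  let F' : StieltjesFunction ℝ :=
    { toFun := fun x => F (a * x + b)
      mono' := fun x y hxy => F.mono (by gcongr)
      right_continuous' := fun x => by
        refine ContinuousWithinAt.comp (f := fun x => a * x + b) (t := Ici (a * x + b))
          (F.right_continuous (a * x + b)) (by fun_prop) fun y hy => ?_
        simp only [mem_Ici] at hy ⊢
        gcongr }
  refine StieltjesFunction.eq_of_ae_eq (F := F') (H := H) ?_ x
  filter_upwards [h2, F.mono.ae_continuousAt_affine ha.ne' b] with y hy hy'
  exact tendsto_nhds_unique
    (tendsto_apply_of_ae hf h1 ((hA.mul_const y).add hB) hy') hy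

/-- If `a ≠ 1` the affine map has a fixed point, and iterating the map or its inverse pushes every
other point to infinity on its own side; a monotone invariant function is then constant on each
side. If `a = 1`, iterating a nontrivial translation makes it constant everywhere. -/
theorem NondegenerateFun.eq_one_and_eq_zero {F : ℝ → ℝ} (hF : Monotone F)
    (hnd : NondegenerateFun F) {a b : ℝ} (ha : 0 < a) (h : ∀ x, F (a * x + b) = F x) :
    a = 1 ∧ b = 0 := by
  have gt_one : ∀ a b : ℝ, 1 < a → (∀ x, F (a * x + b) = F x) → False := by
    intro a b ha h
    have hx0 : a * (b / (1 - a)) + b = b / (1 - a) := by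
      have : 1 - a ≠ 0 := by linarith
      field_simp; ring
    set x0 := b / (1 - a)
    have hn : ∀ (n : ℕ) (d : ℝ), F (x0 + a ^ n * d) = F (x0 + d) := by
      intro n
      induction n with
      | zero => simp
      | succ n ih =>
        intro d
        rw [← ih d, ← h (x0 + a ^ n * d)]
        congr 1
        rw [pow_succ]; linear_combination -hx0
    have hup : ∀ x y, x0 < x → F y ≤ F x := by
      intro x y hx
      obtain ⟨n, hn'⟩ := pow_unbounded_of_one_lt ((y - x0) / (x - x0)) ha
      have := hn n (x - x0)
      rw [add_sub_cancel] at this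
      rw [← this]
      apply hF
      rw [div_lt_iff₀ (by linarith)] at hn'
      linarith
    have hdown : ∀ x y, x < x0 → F x ≤ F y := by
      intro x y hx
      obtain ⟨n, hn'⟩ := pow_unbounded_of_one_lt ((x0 - y) / (x0 - x)) ha
      have := hn n (x - x0)
      rw [add_sub_cancel] at this
      rw [← this]
      apply hF
      rw [div_lt_iff₀ (by linarith)] at hn'
      linarith
    exact hnd ⟨x0, fun x y hx hy => le_antisymm (hdown x y hx) (hdown y x hy),
      fun x y hx hy => le_antisymm (hup y x hy) (hup x y hx)⟩
  have inv : ∀ x, F (a⁻¹ * x + -(a⁻¹ * b)) = F x := by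
    intro x
    rw [← h (a⁻¹ * x + -(a⁻¹ * b))]
    congr 1
    field_simp; ring
  have ha1 : a = 1 := by
    rcases lt_trichotomy a 1 with h1 | h1 | h1
    · exact (gt_one _ _ ((one_lt_inv₀ ha).2 h1) inv).elim
    · exact h1
    · exact (gt_one _ _ h1 h).elim
  subst ha1
  refine ⟨rfl, ?_⟩
  have pos : ∀ b : ℝ, 0 < b → (∀ x, F (x + b) = F x) → False := by
    intro b hb h
    have hn : ∀ (n : ℕ) (x : ℝ), F (x + n * b) = F x := by
      intro n
      induction n with
      | zero => simp
      | succ n ih =>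
        intro x
        rw [← ih x, ← h (x + n * b)]
        push_cast; ring_nf
    have hle : ∀ x y, F y ≤ F x := by
      intro x y
      obtain ⟨n, hn'⟩ := exists_nat_gt ((y - x) / b)
      rw [← hn n x]
      apply hF
      rw [div_lt_iff₀ hb] at hn'
      linarith
    exact hnd ⟨0, fun x y _ _ => le_antisymm (hle y x) (hle x y),
      fun x y _ _ => le_antisymm (hle y x) (hle x y)⟩
  rcases lt_trichotomy b 0 with h1 | h1 | h1
  · exact (pos (-b) (by linarith) fun x => by simpa using inv x).elim
  · exact h1
  · exact (pos b h1 fun x => by simpa using h x).elim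

/-- The map `x ↦ A i * x + B i` vanishes at `-(B i / A i)`. If `A → ∞`, it sends points to the right
of the limit `κ` of these zeros to `+∞` and points to the left to `-∞`, so `F` equals its supremum
on one side of `κ` and its infimum on the other. -/
theorem not_tendsto_scale_atTop (U : Ultrafilter ι) {F : ℝ → ℝ} (hF : Monotone F)
    (hnd : NondegenerateFun F) (hf : ∀ i, Monotone (f i)) {A B : ι → ℝ}
    (h1 : ∀ᵐ x : ℝ, Tendsto (fun i => f i x) U (𝓝 (F x)))
    (h2 : ∀ᵐ x : ℝ, Tendsto (fun i => f i (A i * x + B i)) U (𝓝 (F x))) :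
    ¬ Tendsto A U atTop := by
  intro hA
  obtain ⟨κ, -, hκ⟩ := (isCompact_univ (X := EReal)).ultrafilter_le_nhds
    (U.map fun i => ((-(B i / A i) : ℝ) : EReal)) (by simp)
  have hκ' : Tendsto (fun i => ((-(B i / A i) : ℝ) : EReal)) U (𝓝 κ) := hκ
  have hup : ∀ x y : ℝ, κ < x → F y ≤ F x := by
    intro x y hx
    obtain ⟨x', h3, h4⟩ := EReal.lt_iff_exists_real_btwn.1 hx
    rw [EReal.coe_lt_coe_iff] at h4
    obtain ⟨y', h5, -, h6⟩ := exists_mem_Ioo_of_ae h1 (lt_add_one y)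
    obtain ⟨x'', h7, h8, h9⟩ := exists_mem_Ioo_of_ae h2 h4
    refine (hF h5.le).trans (le_trans ?_ (hF h8.le))
    refine le_of_tendsto_of_tendsto h6 h9 ?_
    filter_upwards [hκ'.eventually (gt_mem_nhds h3), hA.eventually_gt_atTop 0,
      hA.eventually_ge_atTop (y' / (x'' - x'))] with i hi hi1 hi2
    apply hf
    rw [EReal.coe_lt_coe_iff, ← neg_div, div_lt_iff₀ hi1] at hi
    rw [div_le_iff₀ (by linarith)] at hi2
    linarith
  have hdown : ∀ x y : ℝ, (x : EReal) < κ → F x ≤ F y := by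
    intro x y hx
    obtain ⟨x', h4, h3⟩ := EReal.lt_iff_exists_real_btwn.1 hx
    rw [EReal.coe_lt_coe_iff] at h4
    obtain ⟨y', -, h5, h6⟩ := exists_mem_Ioo_of_ae h1 (sub_one_lt y)
    obtain ⟨x'', h7, h8, h9⟩ := exists_mem_Ioo_of_ae h2 h4
    refine (hF h7.le).trans (le_trans ?_ (hF h5.le))
    refine le_of_tendsto_of_tendsto h9 h6 ?_
    filter_upwards [hκ'.eventually (lt_mem_nhds h3), hA.eventually_gt_atTop 0,
      hA.eventually_ge_atTop ((-y') / (x' - x''))] with i hi hi1 hi2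
    apply hf
    rw [EReal.coe_lt_coe_iff, ← neg_div, lt_div_iff₀ hi1] at hi
    rw [div_le_iff₀ (by linarith)] at hi2
    linarith
  -- For `κ = ±∞` the point is the default `0`; `F` is then constant on the whole line, so any point
  -- would do.
  refine hnd ⟨κ.toReal, ?_⟩
  induction κ with
  | bot => exact ⟨fun x y _ _ => le_antisymm (hup _ _ (EReal.bot_lt_coe _)) (hup _ _ (EReal.bot_lt_coe _)),
      fun x y _ _ => le_antisymm (hup _ _ (EReal.bot_lt_coe _)) (hup _ _ (EReal.bot_lt_coe _))⟩
  | top => exact ⟨fun x y _ _ => le_antisymm (hdown _ _ (EReal.coe_lt_top _)) (hdown _ _ (EReal.coe_lt_top _)),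
      fun x y _ _ => le_antisymm (hdown _ _ (EReal.coe_lt_top _)) (hdown _ _ (EReal.coe_lt_top _))⟩
  | coe c =>
    simp only [EReal.toReal_coe]
    exact ⟨fun x y hx hy => le_antisymm (hdown _ _ (by exact_mod_cast hx))
      (hdown _ _ (by exact_mod_cast hy)),
      fun x y hx hy => le_antisymm (hup _ _ (by exact_mod_cast hy)) (hup _ _ (by exact_mod_cast hx))⟩

/-- Convergence of types for a common limit. Mass may escape to `±∞`. -/
theorem tendsto_one_and_tendsto_zero_of_types {F : StieltjesFunction ℝ}
    (hnd : NondegenerateFun F) (hf : ∀ i, Monotone (f i)) {A B : ι → ℝ}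
    (hA : ∀ᶠ i in l, 0 < A i)
    (h1 : ∀ᵐ x : ℝ, Tendsto (fun i => f i x) l (𝓝 (F x)))
    (h2 : ∀ᵐ x : ℝ, Tendsto (fun i => f i (A i * x + B i)) l (𝓝 (F x))) :
    Tendsto A l (𝓝 1) ∧ Tendsto B l (𝓝 0) := by
  suffices H : ∀ U : Ultrafilter ι, ↑U ≤ l → Tendsto A U (𝓝 1) ∧ Tendsto B U (𝓝 0) from
    ⟨tendsto_iff_ultrafilter _ _ _ |>.2 fun U hU => (H U hU).1,
      tendsto_iff_ultrafilter _ _ _ |>.2 fun U hU => (H U hU).2⟩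
  intro U hU
  replace hA : ∀ᶠ i in U, 0 < A i := hU hA
  replace h1 : ∀ᵐ x : ℝ, Tendsto (fun i => f i x) U (𝓝 (F x)) := h1.mono fun x hx => hx.mono_left hU
  replace h2 : ∀ᵐ x : ℝ, Tendsto (fun i => f i (A i * x + B i)) U (𝓝 (F x)) :=
    h2.mono fun x hx => hx.mono_left hU
  have not_top := not_tendsto_scale_atTop U F.mono hnd hf h1 h2
  -- Exchanging the two normalizations replaces `A` by its inverse. The absolute value keeps the new
  -- functions monotone for every index, since `A` is positive only eventually.
  have not_zero : ¬ Tendsto A U (𝓝 0) := by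
    intro h0
    have h0' : Tendsto (fun i => |A i|⁻¹) U atTop := by
      refine Tendsto.inv_tendsto_nhdsGT_zero (tendsto_nhdsWithin_iff.2 ⟨by simpa using h0.abs, ?_⟩)
      filter_upwards [hA] with i hi using abs_pos.2 hi.ne'
    refine not_tendsto_scale_atTop U (f := fun i x => f i (|A i| * x + B i))
      (B := fun i => -(|A i|⁻¹ * B i)) F.mono hnd ?_ ?_ ?_ h0'
    · intro i x y hxy
      apply hf i
      gcongr
    · filter_upwards [h2] with x hx
      refine hx.congr' ?_
      filter_upwards [hA] with i hi using by rw [abs_of_pos hi]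
    · filter_upwards [h1] with x hx
      refine hx.congr' ?_
      filter_upwards [hA] with i hi
      congr 1
      rw [abs_of_pos hi]
      field_simp; ring
  obtain ⟨a', -, ha'⟩ := (isCompact_univ (X := EReal)).ultrafilter_le_nhds
    (U.map fun i => ((A i : ℝ) : EReal)) (by simp)
  replace ha' : Tendsto (fun i => ((A i : ℝ) : EReal)) U (𝓝 a') := ha'
  obtain ⟨b', -, hb'⟩ := (isCompact_univ (X := EReal)).ultrafilter_le_nhds
    (U.map fun i => ((B i : ℝ) : EReal)) (by simp)
  replace hb' : Tendsto (fun i => ((B i : ℝ) : EReal)) U (𝓝 b') := hb'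
  have ha0 : (0 : EReal) ≤ a' := by
    refine ge_of_tendsto ha' ?_
    filter_upwards [hA] with i hi using by exact_mod_cast hi.le
  induction a' with
  | bot => simp at ha0
  | top => exact (not_top (EReal.tendsto_coe_nhds_top_iff.1 ha')).elim
  | coe a =>
    rw [EReal.tendsto_coe] at ha'
    have ha0 : 0 ≤ a := by exact_mod_cast ha0
    have hapos : 0 < a := lt_of_le_of_ne ha0 fun h => not_zero (h ▸ ha')
    -- With `A` convergent, a shift tending to `±∞` would move every point to the same end and make
    -- `F` constant.
    induction b' with
    | bot =>
      rw [EReal.tendsto_coe_nhds_bot_iff] at hb'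
      have hle : ∀ x y, F x ≤ F y := by
        intro x y
        obtain ⟨y', -, h5, h6⟩ := exists_mem_Ioo_of_ae h1 (sub_one_lt y)
        obtain ⟨x'', h7, -, h9⟩ := exists_mem_Ioo_of_ae h2 (lt_add_one x)
        refine (F.mono h7.le).trans (le_trans ?_ (F.mono h5.le))
        refine le_of_tendsto_of_tendsto h9 h6 ?_
        filter_upwards [((ha'.mul_const x'').add_atBot hb').eventually_le_atBot y'] with i hi
        exact hf i hi
      exact (hnd ⟨0, fun x y _ _ => le_antisymm (hle _ _) (hle _ _),
        fun x y _ _ => le_antisymm (hle _ _) (hle _ _)⟩).elim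
    | top =>
      rw [EReal.tendsto_coe_nhds_top_iff] at hb'
      have hle : ∀ x y, F y ≤ F x := by
        intro x y
        obtain ⟨y', h5, -, h6⟩ := exists_mem_Ioo_of_ae h1 (lt_add_one y)
        obtain ⟨x'', -, h7, h9⟩ := exists_mem_Ioo_of_ae h2 (sub_one_lt x)
        refine (F.mono h5.le).trans (le_trans ?_ (F.mono h7.le))
        refine le_of_tendsto_of_tendsto h6 h9 ?_
        filter_upwards [((ha'.mul_const x'').add_atTop hb').eventually_ge_atTop y'] with i hi
        exact hf i hi
      exact (hnd ⟨0, fun x y _ _ => le_antisymm (hle _ _) (hle _ _),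
        fun x y _ _ => le_antisymm (hle _ _) (hle _ _)⟩).elim
    | coe b =>
      rw [EReal.tendsto_coe] at hb'
      obtain ⟨rfl, rfl⟩ := hnd.eq_one_and_eq_zero F.mono hapos
        (apply_affine_eq_of_tendsto hf hapos ha' hb' h1 h2)
      exact ⟨ha', hb'⟩

end types

/-! ### Cocycles of affine normalizations -/

theorem exists_eq_mul_of_additive {g : ℝ → ℝ} (hadd : ∀ x y, g (x + y) = g x + g y)
    (hcont : ContinuousAt g 0) : ∃ r : ℝ, ∀ x, g x = r * x := by
  let φ : ℝ →+ ℝ := AddMonoidHom.mk' g hadd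
  have hφ : Continuous φ := continuous_of_continuousAt_zero φ hcont
  refine ⟨g 1, fun x => ?_⟩
  have := (φ.toRealLinearMap hφ).map_smul x 1
  simp only [smul_eq_mul, mul_one] at this
  rw [mul_comm]
  exact this

/-- Positive multiplicative functions on `(0, ∞)` that are continuous at `1` are powers, and the
additive cocycles over them have the form `ervPsi`. -/
theorem exists_rpow_and_ervPsi_of_cocycle {A B : ℝ → ℝ} (hApos : ∀ c, 0 < c → 0 < A c)
    (hA : ∀ c d, 0 < c → 0 < d → A (c * d) = A c * A d)
    (hB : ∀ c d, 0 < c → 0 < d → B (c * d) = B c + A c * B d)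
    (hA1 : Tendsto A (𝓝 1) (𝓝 1)) (hB1 : Tendsto B (𝓝 1) (𝓝 0)) :
    ∃ ρ k : ℝ, ∀ c, 0 < c → A c = c ^ ρ ∧ B c = ervPsi ρ k c := by
  have hexp : Tendsto Real.exp (𝓝 0) (𝓝 1) := by
    simpa using Real.continuous_exp.tendsto 0
  have hA11 : A 1 = 1 := by
    have h1 := hA 1 1 one_pos one_pos
    have h2 := hApos 1 one_pos
    rw [mul_one] at h1
    nlinarith
  have hB11 : B 1 = 0 := by
    have h1 := hB 1 1 one_pos one_pos
    rw [mul_one, hA11] at h1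
    linarith
  obtain ⟨ρ, hρ⟩ := exists_eq_mul_of_additive (g := fun x => Real.log (A (Real.exp x)))
    (fun x y => by
      rw [Real.exp_add, hA _ _ (Real.exp_pos x) (Real.exp_pos y),
        Real.log_mul (hApos _ (Real.exp_pos x)).ne' (hApos _ (Real.exp_pos y)).ne'])
    (by
      have h := (Real.continuousAt_log one_ne_zero).tendsto.comp (hA1.comp hexp)
      simpa [ContinuousAt, hA11, Function.comp_def] using h)
  have hAρ : ∀ c, 0 < c → A c = c ^ ρ := by
    intro c hc
    have := hρ (Real.log c)
    simp only [Real.exp_log hc] at this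
    rw [Real.rpow_def_of_pos hc, mul_comm, ← this, Real.exp_log (hApos c hc)]
  by_cases h0 : ρ = 0
  · subst h0
    obtain ⟨k, hk⟩ := exists_eq_mul_of_additive (g := fun x => B (Real.exp x))
      (fun x y => by
        rw [Real.exp_add, hB _ _ (Real.exp_pos x) (Real.exp_pos y), hAρ _ (Real.exp_pos x),
          Real.rpow_zero, one_mul])
      (by simpa [ContinuousAt, hB11, Function.comp_def] using hB1.comp hexp)
    refine ⟨0, k, fun c hc => ⟨hAρ c hc, ?_⟩⟩
    have := hk (Real.log c)
    simp only [Real.exp_log hc] at this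
    simp [ervPsi, this]
  · have h2 : (2 : ℝ) ^ ρ - 1 ≠ 0 := by
      intro h
      have h3 : (2 : ℝ) ^ ρ = 2 ^ (0 : ℝ) := by simpa using sub_eq_zero.1 h
      exact h0 ((Real.rpow_right_inj (by norm_num) (by norm_num)).1 h3)
    -- Expanding `B (c * 2) = B (2 * c)` in both orders gives `B c * (2 ^ ρ - 1) = B 2 * (c ^ ρ -
    -- 1)`, which forces this `k`.
    refine ⟨ρ, B 2 / (2 ^ ρ - 1) * ρ, fun c hc => ⟨hAρ c hc, ?_⟩⟩
    have h3 := hB c 2 hc two_pos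
    have h4 := hB 2 c two_pos hc
    rw [mul_comm 2 c, h3, hAρ c hc, hAρ 2 two_pos] at h4
    simp only [ervPsi, h0, if_false]
    field_simp
    linear_combination -h4

/-- A pair of normalizing functions such that the normalizations at `t` and `t w` become
equivalent as `t → ∞`, `w → 1`. -/
structure AsympInvariant (α β : ℝ → ℝ) : Prop where
  scale : Tendsto (fun p : ℝ × ℝ => α (p.1 * p.2) / α p.1) (atTop ×ˢ 𝓝 1) (𝓝 1)
  loc : Tendsto (fun p : ℝ × ℝ => (β (p.1 * p.2) - β p.1) / α p.1) (atTop ×ˢ 𝓝 1) (𝓝 0)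

section cocycle

variable {α β : ℝ → ℝ}

/-- The change of normalization from `t` to `r` is the composite of those from `t` to `s` and from
`s` to `r`, and affine maps compose continuously. -/
theorem tendsto_cocycle_mul (hα : ∀ s, 0 < α s) {ι : Type*} {l : Filter ι} {s t r : ι → ℝ}
    {a b a' b' : ℝ}
    (h1 : Tendsto (fun i => α (s i) / α (t i)) l (𝓝 a))
    (h2 : Tendsto (fun i => (β (s i) - β (t i)) / α (t i)) l (𝓝 b))
    (h1' : Tendsto (fun i => α (r i) / α (s i)) l (𝓝 a'))
    (h2' : Tendsto (fun i => (β (r i) - β (s i)) / α (s i)) l (𝓝 b')) :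
    Tendsto (fun i => α (r i) / α (t i)) l (𝓝 (a * a')) ∧
      Tendsto (fun i => (β (r i) - β (t i)) / α (t i)) l (𝓝 (b + a * b')) := by
  refine ⟨(h1.mul h1').congr fun i => ?_, (h2.add (h1.mul h2')).congr fun i => ?_⟩
  · have := (hα (s i)).ne'
    have := (hα (t i)).ne'
    field_simp
  · have := (hα (s i)).ne'
    have := (hα (t i)).ne'
    field_simp
    ring

/-- The normalizations at `t` and `t c` are related by an affine map that converges
as `t → ∞`. -/
def HasTypeLimit (α β : ℝ → ℝ) (c a b : ℝ) : Prop :=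
  Tendsto (fun t => α (t * c) / α t) atTop (𝓝 a) ∧
    Tendsto (fun t => (β (t * c) - β t) / α t) atTop (𝓝 b)

theorem HasTypeLimit.mul (hα : ∀ s, 0 < α s) {c d a b a' b' : ℝ} (hc : 0 < c)
    (h : HasTypeLimit α β c a b) (h' : HasTypeLimit α β d a' b') :
    HasTypeLimit α β (c * d) (a * a') (b + a * b') := by
  have ht : Tendsto (fun t : ℝ => t * c) atTop atTop := tendsto_id.atTop_mul_const hc
  simpa only [HasTypeLimit, mul_assoc, Function.comp_def] using
    tendsto_cocycle_mul hα h.1 h.2 (h'.1.comp ht) (h'.2.comp ht)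

theorem HasTypeLimit.unique {c a b a' b' : ℝ} (h : HasTypeLimit α β c a b)
    (h' : HasTypeLimit α β c a' b') : a = a' ∧ b = b' :=
  ⟨tendsto_nhds_unique h.1 h'.1, tendsto_nhds_unique h.2 h'.2⟩

/-- For large `n` the root `c ^ (1 / n)` lies in the given neighbourhood of `1`, and type limits
multiply. -/
theorem HasTypeLimit.exists_of_eventually (hα : ∀ s, 0 < α s)
    (h : ∀ᶠ c in 𝓝 (1 : ℝ), ∃ a b, 0 < a ∧ HasTypeLimit α β c a b) {c : ℝ} (hc : 0 < c) :
    ∃ a b, 0 < a ∧ HasTypeLimit α β c a b := by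
  have hlim : Tendsto (fun n : ℕ => c ^ ((n : ℝ)⁻¹)) atTop (𝓝 1) := by
    have h1 : ContinuousAt (fun x : ℝ => c ^ x) 0 :=
      Real.continuousAt_const_rpow hc.ne'
    have h2 := h1.tendsto.comp (tendsto_inv_atTop_nhds_zero_nat (𝕜 := ℝ))
    simpa [Function.comp_def] using h2
  obtain ⟨n, hn, hn0⟩ := ((hlim.eventually h).and (eventually_gt_atTop 0)).exists
  have hpow : ∀ (m : ℕ) (d : ℝ), 0 < d → (∃ a b, 0 < a ∧ HasTypeLimit α β d a b) →
      ∃ a b, 0 < a ∧ HasTypeLimit α β (d ^ m) a b := by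
    intro m d hd ⟨a, b, ha, hab⟩
    induction m with
    | zero =>
      refine ⟨1, 0, one_pos, ?_, ?_⟩
      · simp [(hα _).ne']
      · simp
    | succ m ih =>
      obtain ⟨a', b', ha', hab'⟩ := ih
      exact ⟨_, _, mul_pos ha' ha, pow_succ d m ▸ hab'.mul hα (pow_pos hd m) hab⟩
  have := hpow n _ (Real.rpow_pos_of_pos hc _) hn
  rwa [Real.rpow_inv_natCast_pow hc.le hn0.ne'] at this

/-- The type limits form a cocycle in `c`, and asymptotic invariance is what makes it continuous at
`1`; this excludes the pathological solutions of the functional equations. -/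
theorem AsympInvariant.exists_isERV (hα : ∀ s, 0 < α s) (h : AsympInvariant α β)
    (hlim : ∀ᶠ c in 𝓝 (1 : ℝ), ∃ a b, 0 < a ∧ HasTypeLimit α β c a b) :
    ∃ ρ k : ℝ, IsERV α β ρ k := by
  have hall : ∀ c : ℝ, ∃ a b, 0 < c → 0 < a ∧ HasTypeLimit α β c a b := by
    intro c
    by_cases hc : 0 < c
    · obtain ⟨a, b, hab⟩ := HasTypeLimit.exists_of_eventually hα hlim hc
      exact ⟨a, b, fun _ => hab⟩
    · exact ⟨0, 0, fun h => (hc h).elim⟩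
  choose A B hAB using hall
  have hpos : ∀ᶠ c : ℝ in 𝓝 1, 0 < c := lt_mem_nhds one_pos
  have hA1 : Tendsto A (𝓝 1) (𝓝 1) := by
    -- Closed balls, so that a bound valid for large `t` and `c` near `1` survives the limit in `t`.
    refine Metric.nhds_basis_closedBall.tendsto_right_iff.2 fun ε hε => ?_
    have := (h.scale.eventually (Metric.closedBall_mem_nhds (1 : ℝ) hε))
    obtain ⟨p, hp, q, hq, hpq⟩ := eventually_prod_iff.1 this
    filter_upwards [hq, hpos] with c hc hc0
    refine Metric.isClosed_closedBall.mem_of_tendsto (hAB c hc0).2.1 ?_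
    filter_upwards [hp] with t ht using hpq ht hc
  have hB1 : Tendsto B (𝓝 1) (𝓝 0) := by
    refine Metric.nhds_basis_closedBall.tendsto_right_iff.2 fun ε hε => ?_
    have := (h.loc.eventually (Metric.closedBall_mem_nhds (0 : ℝ) hε))
    obtain ⟨p, hp, q, hq, hpq⟩ := eventually_prod_iff.1 this
    filter_upwards [hq, hpos] with c hc hc0
    refine Metric.isClosed_closedBall.mem_of_tendsto (hAB c hc0).2.2 ?_
    filter_upwards [hp] with t ht using hpq ht hc
  have hmul : ∀ c d, 0 < c → 0 < d → A (c * d) = A c * A d ∧ B (c * d) = B c + A c * B d :=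
    fun c d hc hd => (hAB _ (mul_pos hc hd)).2.unique ((hAB c hc).2.mul hα hc (hAB d hd).2)
  obtain ⟨ρ, k, hρ⟩ := exists_rpow_and_ervPsi_of_cocycle (fun c hc => (hAB c hc).1)
    (fun c d hc hd => (hmul c d hc hd).1) (fun c d hc hd => (hmul c d hc hd).2) hA1 hB1
  exact ⟨ρ, k, fun c hc => (hρ c hc).1 ▸ (hAB c hc).2.1, fun c hc => (hρ c hc).2 ▸ (hAB c hc).2.2⟩

/-- Extended regular variation holds locally uniformly as soon as the normalizations are
asymptotically invariant. -/
theorem IsERV.tendsto_prod (hα : ∀ s, 0 < α s) {ρ k : ℝ} (h : IsERV α β ρ k)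
    (hinv : AsympInvariant α β) {c : ℝ} (hc : 0 < c) :
    Tendsto (fun p : ℝ × ℝ => α (p.1 * p.2) / α p.1) (atTop ×ˢ 𝓝 c) (𝓝 (c ^ ρ)) ∧
      Tendsto (fun p : ℝ × ℝ => (β (p.1 * p.2) - β p.1) / α p.1) (atTop ×ˢ 𝓝 c)
        (𝓝 (ervPsi ρ k c)) := by
  have ht : Tendsto (fun t : ℝ => t * c) atTop atTop := tendsto_id.atTop_mul_const hc
  -- Writing `t * w = (t * c) * (w / c)` splits the change into a fixed factor `c` and a factor
  -- tending to `1`.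
  have hw : Tendsto (fun p : ℝ × ℝ => (p.1 * c, p.2 / c)) (atTop ×ˢ 𝓝 c) (atTop ×ˢ 𝓝 1) := by
    have : Tendsto (fun x : ℝ => x / c) (𝓝 c) (𝓝 (c / c)) := tendsto_id.div_const c
    rw [div_self hc.ne'] at this
    exact (ht.comp tendsto_fst).prodMk (this.comp tendsto_snd)
  have key := tendsto_cocycle_mul (β := β) hα (l := atTop ×ˢ 𝓝 c) (t := fun p : ℝ × ℝ => p.1)
    (s := fun p => p.1 * c) (r := fun p => p.1 * p.2)
    ((h.scale c hc).comp tendsto_fst) ((h.loc c hc).comp tendsto_fst)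
    ((hinv.scale.comp hw).congr fun p => by simp [mul_assoc, mul_div_cancel₀ _ hc.ne'])
    ((hinv.loc.comp hw).congr fun p => by simp [mul_assoc, mul_div_cancel₀ _ hc.ne'])
  simpa using key

end cocycle

/-! ### Normalizations of mixtures: scaling and convergence of types -/

section mixtures

variable {H : ℝ → ℝ → ℝ} {α β : ℝ → ℝ}

theorem intervalIntegrable_of_unit {g : ℝ → ℝ} (hg : Measurable g) (h0 : ∀ p, 0 ≤ g p)
    (h1 : ∀ p, g p ≤ 1) (a b : ℝ) : IntervalIntegrable g volume a b := by
  refine (intervalIntegrable_const (c := (1 : ℝ))).mono_fun hg.aestronglyMeasurable ?_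
  filter_upwards with x
  rw [Real.norm_of_nonneg (h0 x)]
  simpa using h1 x

theorem monotone_integral_apply (hmono : ∀ p, Monotone (H p)) (h0 : ∀ p x, 0 ≤ H p x)
    (h1 : ∀ p x, H p x ≤ 1) (hmeas : ∀ x, Measurable fun p => H p x) {U : ℝ} (hU : 0 ≤ U)
    (t a b : ℝ) (ha : 0 ≤ a) :
    Monotone fun x => ∫ u in (0 : ℝ)..U, H (u / t) (a * x + b) := by
  intro x y hxy
  have hint : ∀ x, IntervalIntegrable (fun u => H (u / t) (a * x + b)) volume 0 U := fun x =>
    intervalIntegrable_of_unit ((hmeas _).comp (measurable_id.div_const t)) (fun _ => h0 _ _)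
      (fun _ => h1 _ _) _ _
  exact intervalIntegral.integral_mono hU (hint x) (hint y) fun u => hmono _ (by gcongr)

/-- Replacing `t` by `t * w` only rescales the mixing range. This is the link between normalizations
at different times. -/
theorem integral_scale_eq (H : ℝ → ℝ → ℝ) {w : ℝ} (hw : 0 < w) (t U z : ℝ) :
    ∫ u in (0 : ℝ)..U / w, H (u / t) z = w⁻¹ * ∫ u in (0 : ℝ)..U, H (u / (t * w)) z := by
  have h := intervalIntegral.integral_comp_div (a := 0) (b := U) (fun u => H (u / t) z) hw.ne'
  simp only [div_div, zero_div, smul_eq_mul, mul_comm w t] at h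
  rw [h, inv_mul_cancel_left₀ hw.ne']

theorem affine_comp_cocycle (hα : ∀ s, 0 < α s) (s t x : ℝ) :
    α t * (α s / α t * x + (β s - β t) / α t) + β t = α s * x + β s := by
  have := (hα t).ne'
  field_simp
  ring

/-- If mixtures of a family of distribution functions over a vanishing parameter range, normalized
by `α, β`, converge to a nondegenerate limit, then the normalizations at `t` and `t w` become
equivalent as `t → ∞` and `w → 1`. -/
theorem asympInvariant_of_tendsto_integral (hmono : ∀ p, Monotone (H p))
    (h0 : ∀ p x, 0 ≤ H p x) (h1 : ∀ p x, H p x ≤ 1) (hmeas : ∀ x, Measurable fun p => H p x)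
    (hα : ∀ s, 0 < α s) {U : ℝ} (hU : 0 < U) {m : StieltjesFunction ℝ} (hnd : NondegenerateFun m)
    (hlim : ∀ᵐ x : ℝ, Tendsto (fun t => ∫ u in (0 : ℝ)..U, H (u / t) (α t * x + β t)) atTop
      (𝓝 (m x))) :
    AsympInvariant α β := by
  have hprod : Tendsto (fun p : ℝ × ℝ => p.1 * p.2) (atTop ×ˢ 𝓝 1) atTop :=
    tendsto_fst.atTop_mul_pos one_pos tendsto_snd
  have hpos : ∀ᶠ p : ℝ × ℝ in atTop ×ˢ 𝓝 1, 0 < p.2 :=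
    tendsto_snd.eventually (lt_mem_nhds one_pos)
  have hsnd : Tendsto (fun p : ℝ × ℝ => p.2⁻¹) (atTop ×ˢ 𝓝 1) (𝓝 1) := by
    have : Tendsto (fun p : ℝ × ℝ => p.2⁻¹) (atTop ×ˢ 𝓝 1) (𝓝 1⁻¹) :=
      tendsto_snd.inv₀ one_ne_zero
    rwa [inv_one] at this
  have key := tendsto_one_and_tendsto_zero_of_types (l := (atTop : Filter ℝ) ×ˢ 𝓝 (1 : ℝ))
    (f := fun p x => ∫ u in (0 : ℝ)..U, H (u / p.1) (α p.1 * x + β p.1)) hnd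
    (A := fun p => α (p.1 * p.2) / α p.1) (B := fun p => (β (p.1 * p.2) - β p.1) / α p.1)
    (fun p => monotone_integral_apply hmono h0 h1 hmeas hU.le _ _ _ (hα _).le)
    (Eventually.of_forall fun p => div_pos (hα _) (hα _))
    (hlim.mono fun x hx => hx.comp tendsto_fst) ?_
  · exact ⟨key.1, key.2⟩
  -- In the normalization of `t * w`, the mixture over `(0, U)` at `t` is `w⁻¹` times the mixture at
  -- `t * w`, plus an integral over the range between `U / w` and `U`, whose length tends to `0`.
  filter_upwards [hlim] with x hx
  simp only [affine_comp_cocycle hα]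
  have hmain : Tendsto (fun p : ℝ × ℝ => p.2⁻¹ * ∫ u in (0 : ℝ)..U, H (u / (p.1 * p.2))
      (α (p.1 * p.2) * x + β (p.1 * p.2))) (atTop ×ˢ 𝓝 1) (𝓝 (m x)) := by
    simpa using hsnd.mul (hx.comp hprod)
  have hrest : Tendsto (fun p : ℝ × ℝ => ∫ u in (U / p.2)..U, H (u / p.1)
      (α (p.1 * p.2) * x + β (p.1 * p.2))) (atTop ×ˢ 𝓝 1) (𝓝 0) := by
    have hb : Tendsto (fun p : ℝ × ℝ => 1 * |U - U / p.2|) (atTop ×ˢ 𝓝 1) (𝓝 0) := by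
      have : Tendsto (fun p : ℝ × ℝ => 1 * |U - U * p.2⁻¹|) (atTop ×ˢ 𝓝 1)
          (𝓝 (1 * |U - U * 1|)) := ((tendsto_const_nhds.sub (hsnd.const_mul U)).abs).const_mul 1
      simpa [div_eq_mul_inv] using this
    refine squeeze_zero_norm (fun p => ?_) hb
    refine intervalIntegral.norm_integral_le_of_norm_le_const fun u _ => ?_
    rw [Real.norm_of_nonneg (h0 _ _)]
    exact h1 _ _
  have hsum := hmain.add hrest
  rw [add_zero] at hsum
  refine hsum.congr' ?_
  filter_upwards [hpos] with p hp
  have hint : ∀ a b, IntervalIntegrable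
      (fun u => H (u / p.1) (α (p.1 * p.2) * x + β (p.1 * p.2))) volume a b := fun a b =>
    intervalIntegrable_of_unit ((hmeas _).comp (measurable_id.div_const _)) (fun _ => h0 _ _)
      (fun _ => h1 _ _) _ _
  rw [← integral_scale_eq H hp, intervalIntegral.integral_add_adjacent_intervals (hint _ _)
    (hint _ _)]

/-- If the normalized mixtures over all parameter ranges converge to nondegenerate limits, then the
normalizations are extended regularly varying. -/
theorem exists_isERV_of_tendsto_integral (hmono : ∀ p, Monotone (H p))
    (h0 : ∀ p x, 0 ≤ H p x) (h1 : ∀ p x, H p x ≤ 1) (hmeas : ∀ x, Measurable fun p => H p x)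
    (hα : ∀ s, 0 < α s) {m : ℝ → StieltjesFunction ℝ}
    (hnd : ∀ U, 0 < U → NondegenerateFun (m U))
    (hlim : ∀ U, 0 < U → ∀ᵐ x : ℝ,
      Tendsto (fun t => ∫ u in (0 : ℝ)..U, H (u / t) (α t * x + β t)) atTop (𝓝 (m U x))) :
    ∃ ρ k : ℝ, IsERV α β ρ k := by
  have hinv := asympInvariant_of_tendsto_integral hmono h0 h1 hmeas hα one_pos (hnd 1 one_pos)
    (hlim 1 one_pos)
  refine hinv.exists_isERV hα ?_
  -- For `c` near `1` the changes of type stay in a compact set whose scales are bounded away from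
  -- `0`.
  have hbd : ∀ᶠ c : ℝ in 𝓝 1, ∀ᶠ t in atTop,
      (α (t * c) / α t, (β (t * c) - β t) / α t) ∈ Icc (1 / 2 : ℝ) 2 ×ˢ Icc (-1 : ℝ) 1 := by
    have e1 := hinv.scale.eventually (Icc_mem_nhds (show (1 / 2 : ℝ) < 1 by norm_num) one_lt_two)
    have e2 := hinv.loc.eventually (Icc_mem_nhds (show (-1 : ℝ) < 0 by norm_num) one_pos)
    obtain ⟨p, hp, q, hq, hpq⟩ := eventually_prod_iff.1 (e1.and e2)
    filter_upwards [hq] with c hc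
    filter_upwards [hp] with t ht using hpq ht hc
  filter_upwards [hbd, lt_mem_nhds one_pos] with c hc hc0
  have hK : IsCompact (Icc (1 / 2 : ℝ) 2 ×ˢ Icc (-1 : ℝ) 1) := isCompact_Icc.prod isCompact_Icc
  set Φ : ℝ → ℝ × ℝ := fun t => (α (t * c) / α t, (β (t * c) - β t) / α t) with hΦ
  have htc : Tendsto (fun t : ℝ => t * c) atTop atTop := tendsto_id.atTop_mul_const hc0
  have hrel : ∀ z : ℝ × ℝ, 0 < z.1 → MapClusterPt z atTop Φ →
      ∀ x, m (1 / c) (z.1 * x + z.2) = c⁻¹ * m 1 x := by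
    intro z hz hcl
    obtain ⟨V, hV, hVz⟩ := mapClusterPt_iff_ultrafilter.1 hcl
    have hval : ∀ x, (Real.toNNReal c⁻¹ • m 1) x = c⁻¹ * m 1 x := fun x => by
      change ((Real.toNNReal c⁻¹ : NNReal) : ℝ) * m 1 x = _
      rw [Real.coe_toNNReal _ (by positivity)]
    have := apply_affine_eq_of_tendsto (l := (V : Filter ℝ))
      (f := fun t x => ∫ u in (0 : ℝ)..1 / c, H (u / t) (α t * x + β t))
      (F := m (1 / c)) (H := Real.toNNReal c⁻¹ • m 1)
      (A := fun t => α (t * c) / α t) (B := fun t => (β (t * c) - β t) / α t)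
      (fun t => monotone_integral_apply hmono h0 h1 hmeas (by positivity) _ _ _ (hα _).le) hz
      ((continuous_fst.tendsto z).comp hVz) ((continuous_snd.tendsto z).comp hVz)
      ((hlim (1 / c) (by positivity)).mono fun x hx => hx.mono_left hV) ?_
    · intro x
      rw [this x, hval]
    filter_upwards [hlim 1 one_pos] with x hx
    rw [hval]
    simp only [affine_comp_cocycle hα, integral_scale_eq H hc0]
    exact ((hx.comp htc).const_mul c⁻¹).mono_left hV
  obtain ⟨z, hzK, hz⟩ := hK.exists_mapClusterPt (f := (atTop : Filter ℝ)) (u := Φ)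
    (tendsto_principal.2 hc)
  have hz0 : 0 < z.1 := lt_of_lt_of_le (by norm_num) hzK.1.1
  have hlimz : Tendsto Φ atTop (𝓝 z) := by
    -- Two cluster points give the same transform of `m (1 / c)`, so `m (1 / c)` is invariant under
    -- the first affine map composed with the inverse of the second; nondegeneracy makes that
    -- composite the identity.
    refine hK.tendsto_nhds_of_unique_mapClusterPt hc fun z' hzK' hz' => ?_
    have hz0' : 0 < z'.1 := lt_of_lt_of_le (by norm_num) hzK'.1.1
    have h := (hnd (1 / c) (by positivity)).eq_one_and_eq_zero (m (1 / c)).mono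
      (a := z.1 / z'.1) (b := z.2 - z.1 / z'.1 * z'.2) (by positivity) fun x => by
        have e1 := hrel z hz0 hz ((x - z'.2) / z'.1)
        have e2 := hrel z' hz0' hz' ((x - z'.2) / z'.1)
        rw [← e2] at e1
        convert e1 using 2
        · field_simp; ring
        · field_simp; ring
    have e1 : z.1 = z'.1 := by
      have := h.1
      field_simp at this
      exact this
    have e2 : z.2 = z'.2 := by
      have := h.2
      rw [h.1] at this
      linarith
    exact Prod.ext e1.symm e2.symm
  exact ⟨z.1, z.2, hz0, (continuous_fst.tendsto z).comp hlimz,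
    (continuous_snd.tendsto z).comp hlimz⟩

end mixtures

/-! ### Generalized extreme value tails -/

theorem mem_EInterval_iff {γ y : ℝ} : y ∈ EInterval γ ↔
    (if 0 < γ then ((-γ⁻¹ : ℝ) : EReal) else ⊥) < y ∧
      (y : EReal) < (if γ < 0 then ((-γ⁻¹ : ℝ) : EReal) else ⊤) := by
  have key : γ ≠ 0 → 1 + γ * y = γ * (y - -γ⁻¹) := fun h => by field_simp; ring
  rcases lt_trichotomy γ 0 with h | rfl | h
  · simp [EInterval, h, h.not_gt, key h.ne, mul_pos_iff, -sub_neg_eq_add, -EReal.coe_neg]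
  · simp [EInterval]
  · simp [EInterval, h, h.not_gt, key h.ne', -sub_neg_eq_add, -EReal.coe_neg]

theorem isOpen_EInterval (γ : ℝ) : IsOpen (EInterval γ) :=
  isOpen_lt continuous_const (by fun_prop)

theorem zero_mem_EInterval (γ : ℝ) : (0 : ℝ) ∈ EInterval γ := by simp [EInterval]

theorem coe_mem_EIntervalRightClosed {γ y : ℝ} (hy : y ∈ EInterval γ) :
    (y : EReal) ∈ EIntervalRightClosed γ :=
  ⟨(mem_EInterval_iff.1 hy).1, (mem_EInterval_iff.1 hy).2.le⟩

theorem exists_mem_EInterval_lt {γ : ℝ} {z : EReal} (hz : z ∈ EIntervalRightClosed γ) :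
    ∃ y ∈ EInterval γ, (y : EReal) < z := by
  obtain ⟨y, h1, h2⟩ := EReal.lt_iff_exists_real_btwn.1 hz.1
  exact ⟨y, mem_EInterval_iff.2 ⟨h1, h2.trans_le hz.2⟩, h2⟩

/-- The inverse function of `gevTail γ`. -/
noncomputable def gevQuantile (γ u : ℝ) : ℝ :=
  if γ = 0 then -Real.log u else (u ^ (-γ) - 1) / γ

theorem gevQuantile_mem {γ u : ℝ} (hu : 0 < u) : gevQuantile γ u ∈ EInterval γ := by
  by_cases h : γ = 0
  · simp [EInterval, h]
  · have : 1 + γ * ((u ^ (-γ) - 1) / γ) = u ^ (-γ) := by field_simp; ring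
    simp only [gevQuantile, h, if_false, EInterval, mem_ofPred_eq, this]
    positivity

theorem gevTail_gevQuantile {γ u : ℝ} (hu : 0 < u) : gevTail γ (gevQuantile γ u) = u := by
  by_cases h : γ = 0
  · simp [gevTail, gevQuantile, h, Real.exp_log hu]
  · have : 1 + γ * ((u ^ (-γ) - 1) / γ) = u ^ (-γ) := by field_simp; ring
    simp only [gevQuantile, gevTail, h, if_false, this]
    rw [← Real.rpow_mul hu.le]
    have : -γ * (-1 / γ) = 1 := by field_simp
    rw [this, Real.rpow_one]

theorem gevTail_pos {γ y : ℝ} (hy : y ∈ EInterval γ) : 0 < gevTail γ y := by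
  unfold gevTail
  split_ifs
  · positivity
  · exact Real.rpow_pos_of_pos hy _

theorem gevTail_zero (γ : ℝ) : gevTail γ 0 = 1 := by
  simp [gevTail]

theorem strictAntiOn_gevTail (γ : ℝ) : StrictAntiOn (gevTail γ) (EInterval γ) := by
  intro y hy y' hy' hlt
  rcases lt_trichotomy γ 0 with h | h | h
  · simp only [gevTail, h.ne, if_false]
    refine Real.rpow_lt_rpow (le_of_lt hy') ?_ (div_pos_of_neg_of_neg (by norm_num) h)
    have := mul_lt_mul_of_neg_left hlt h
    linarith
  · simp only [gevTail, h, if_true]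
    simpa using hlt
  · simp only [gevTail, h.ne', if_false]
    refine Real.rpow_lt_rpow_of_neg hy ?_ (div_neg_of_neg_of_pos (by norm_num) h)
    have := mul_lt_mul_of_pos_left hlt h
    linarith

theorem continuousAt_gevTail {γ y : ℝ} (hy : y ∈ EInterval γ) : ContinuousAt (gevTail γ) y := by
  by_cases h : γ = 0
  · have : gevTail γ = fun y => Real.exp (-y) := by ext y; simp [gevTail, h]
    rw [this]
    fun_prop
  · have : gevTail γ = fun y => (1 + γ * y) ^ (-1 / γ) := by ext y; simp [gevTail, h]
    rw [this]
    exact ContinuousAt.rpow_const (by fun_prop) (Or.inl (ne_of_gt hy))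

theorem lt_gevQuantile_iff {γ u y : ℝ} (hu : 0 < u) (hy : y ∈ EInterval γ) :
    y < gevQuantile γ u ↔ u < gevTail γ y := by
  rw [← (strictAntiOn_gevTail γ).lt_iff_gt (gevQuantile_mem hu) hy, gevTail_gevQuantile hu]

theorem gevQuantile_lt_iff {γ u y : ℝ} (hu : 0 < u) (hy : y ∈ EInterval γ) :
    gevQuantile γ u < y ↔ gevTail γ y < u := by
  rw [← (strictAntiOn_gevTail γ).lt_iff_gt hy (gevQuantile_mem hu), gevTail_gevQuantile hu]

theorem measurable_gevQuantile (γ : ℝ) : Measurable (gevQuantile γ) := by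
  by_cases h : γ = 0
  · have : gevQuantile γ = fun u => -Real.log u := by ext y; simp [gevQuantile, h]
    rw [this]; fun_prop
  · have : gevQuantile γ = fun u => (u ^ (-γ) - 1) / γ := by ext y; simp [gevQuantile, h]
    rw [this]; fun_prop

/-! ### Upper quantiles -/

/-- The generalized inverse of the survival function, on `(0, 1)`. -/
noncomputable def upperQuantile (F : Measure ℝ) (p : ℝ) : ℝ :=
  if p ∈ Ioo (0 : ℝ) 1 then sInf {y | F.real (Ioi y) ≤ p} else 0

section quantile

variable (F : Measure ℝ) [IsProbabilityMeasure F]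

theorem real_Ioi_eq (y : ℝ) : F.real (Ioi y) = 1 - cdf F y := by
  rw [cdf_eq_real, ← compl_Iic, probReal_compl_eq_one_sub measurableSet_Iic]

variable {F}

/-- Right-continuity of the survival function shows that the infimum defining the quantile is
attained, so quantile and tail are exactly adjoint, with atoms and flat pieces allowed. -/
theorem lt_upperQuantile_iff {p y : ℝ} (hp : p ∈ Ioo (0 : ℝ) 1) :
    y < upperQuantile F p ↔ p < F.real (Ioi y) := by
  have hanti : Antitone fun y => F.real (Ioi y) := fun x y h => measureReal_mono (Ioi_subset_Ioi h)
  have hne : {y | F.real (Ioi y) ≤ p}.Nonempty := by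
    obtain ⟨y, hy⟩ := ((tendsto_cdf_atTop F).eventually
      (lt_mem_nhds (by linarith [hp.1] : 1 - p < 1))).exists
    exact ⟨y, by rw [mem_ofPred_eq, real_Ioi_eq]; linarith⟩
  have hbdd : BddBelow {y | F.real (Ioi y) ≤ p} := by
    obtain ⟨y, hy⟩ := ((tendsto_cdf_atBot F).eventually
      (gt_mem_nhds (by linarith [hp.2] : 0 < 1 - p))).exists
    refine ⟨y, fun z hz => le_of_not_gt fun h => ?_⟩
    have h1 := hanti h.le
    simp only [mem_ofPred_eq, real_Ioi_eq] at hz h1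
    linarith
  have hmem : F.real (Ioi (sInf {y | F.real (Ioi y) ≤ p})) ≤ p := by
    have hrc := ((cdf F).right_continuous (sInf {y | F.real (Ioi y) ≤ p})).mono
      Ioi_subset_Ici_self
    have hlim : Tendsto (fun y => F.real (Ioi y)) (𝓝[>] sInf {y | F.real (Ioi y) ≤ p})
        (𝓝 (F.real (Ioi (sInf {y | F.real (Ioi y) ≤ p})))) := by
      simp only [real_Ioi_eq] at hrc ⊢
      exact tendsto_const_nhds.sub hrc
    refine le_of_tendsto hlim ?_
    filter_upwards [self_mem_nhdsWithin] with y hy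
    obtain ⟨z, hz, hzy⟩ := exists_lt_of_csInf_lt hne hy
    exact (hanti hzy.le).trans hz
  simp only [upperQuantile, hp, if_true]
  rw [← not_le, ← not_le, not_iff_not]
  exact ⟨fun h => (hanti h).trans hmem, fun h => csInf_le hbdd h⟩

variable (F)

theorem measurable_upperQuantile : Measurable (upperQuantile F) := by
  have hanti : AntitoneOn (upperQuantile F) (Ioo 0 1) := by
    intro p hp p' hp' h
    by_contra! hlt
    have h1 := (lt_upperQuantile_iff hp').1 hlt
    exact lt_irrefl _ ((lt_upperQuantile_iff hp).2 (h.trans_lt h1))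
  refine measurable_of_restrict_of_restrict_compl (measurableSet_Ioo (a := (0 : ℝ)) (b := 1)) ?_ ?_
  · exact Antitone.measurable fun p p' h => hanti p.2 p'.2 h
  · refine measurable_const' (fun p p' => ?_)
    have hp := p.2
    have hp' := p'.2
    rw [mem_compl_iff] at hp hp'
    simp [upperQuantile, hp, hp']

/-- Inverse transform sampling: by the adjunction, the levels whose quantile exceeds `y` form the
interval from `0` to the tail at `y`. -/
theorem map_upperQuantile :
    (volume.restrict (Ioo (0 : ℝ) 1)).map (upperQuantile F) = F := by
  have hm := measurable_upperQuantile F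
  have : IsProbabilityMeasure (volume.restrict (Ioo (0 : ℝ) 1)) := ⟨by simp⟩
  have := Measure.isProbabilityMeasure_map (μ := volume.restrict (Ioo (0 : ℝ) 1)) hm.aemeasurable
  refine Measure.ext_of_Iic _ _ fun y => ?_
  have h1 : ∀ ν : Measure ℝ, IsProbabilityMeasure ν → ν (Iic y) = 1 - ν (Ioi y) := by
    intro ν hν
    rw [← compl_Ioi, prob_compl_eq_one_sub measurableSet_Ioi]
  rw [h1 _ inferInstance, h1 F inferInstance, Measure.map_apply hm measurableSet_Ioi,
    Measure.restrict_apply (hm measurableSet_Ioi)]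
  have : upperQuantile F ⁻¹' Ioi y ∩ Ioo 0 1 = Ioo 0 (F.real (Ioi y)) := by
    ext p
    simp only [mem_inter_iff, mem_preimage, mem_Ioi]
    constructor
    · rintro ⟨h, hp⟩
      exact ⟨hp.1, (lt_upperQuantile_iff hp).1 h⟩
    · rintro ⟨h, h'⟩
      have hp : p ∈ Ioo (0 : ℝ) 1 := ⟨h, h'.trans_le measureReal_le_one⟩
      exact ⟨(lt_upperQuantile_iff hp).2 h', hp⟩
  rw [this, Real.volume_Ioo, sub_zero, ofReal_measureReal]

end quantile

/-! ### Domains of attraction -/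

section attraction

variable {F : Measure ℝ} [IsProbabilityMeasure F] {γ : ℝ} {a b : ℝ → ℝ}

theorem lt_upperQuantile_div_iff {t u y : ℝ} (ht : 0 < t) (hu : u ∈ Ioo 0 t) :
    y < upperQuantile F (u / t) ↔ u < t * F.real (Ioi y) := by
  rw [lt_upperQuantile_iff ⟨div_pos hu.1 ht, (div_lt_one ht).2 hu.2⟩, div_lt_iff₀' ht]

/-- Convergence of monotone functions passes to generalized inverses: compare `u` with the tail at
points `y` just below and just above `gevQuantile γ u`, where the limiting comparison is strict. -/
theorem InDomainOfAttraction.tendsto_upperQuantile (ha : ∀ t, 0 < t → 0 < a t)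
    (h : InDomainOfAttraction F γ a b) {u : ℝ} (hu : 0 < u) :
    Tendsto (fun t => (upperQuantile F (u / t) - b t) / a t) atTop (𝓝 (gevQuantile γ u)) := by
  have hmem := gevQuantile_mem (γ := γ) hu
  obtain ⟨l, r, ⟨hl, hr⟩, hE⟩ := mem_nhds_iff_exists_Ioo_subset.1
    ((isOpen_EInterval γ).mem_nhds hmem)
  refine tendsto_order.2 ⟨fun s hs => ?_, fun s hs => ?_⟩
  · obtain ⟨y, hy, hy'⟩ := exists_between (max_lt hs hl)
    have hyE : y ∈ EInterval γ := hE ⟨(le_max_right _ _).trans_lt hy, hy'.trans hr⟩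
    filter_upwards [(h y hyE).eventually (lt_mem_nhds ((lt_gevQuantile_iff hu hyE).1 hy')),
      eventually_gt_atTop 0, eventually_gt_atTop u] with t h1 h2 h3
    have h4 := (lt_upperQuantile_div_iff h2 ⟨hu, h3⟩).2 h1
    refine ((le_max_left _ _).trans_lt hy).trans ?_
    rw [lt_div_iff₀ (ha t h2)]
    linarith
  · obtain ⟨y, hy, hy'⟩ := exists_between (lt_min hs hr)
    have hyE : y ∈ EInterval γ := hE ⟨hl.trans hy, hy'.trans_le (min_le_right _ _)⟩
    filter_upwards [(h y hyE).eventually (gt_mem_nhds ((gevQuantile_lt_iff hu hyE).1 hy)),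
      eventually_gt_atTop 0, eventually_gt_atTop u] with t h1 h2 h3
    have h4 := (not_congr (lt_upperQuantile_div_iff (F := F) (y := a t * y + b t) h2 ⟨hu, h3⟩)).2
      h1.not_gt
    refine lt_of_le_of_lt ?_ (hy'.trans_le (min_le_left _ _))
    rw [div_le_iff₀ (ha t h2)]
    linarith [not_lt.1 h4]

variable {bs : ℝ → ℝ}

theorem InDomainOfAttraction.tendsto_of_asymp (ha : ∀ t, 0 < t → 0 < a t)
    (h : InDomainOfAttraction F γ a b)
    (hbs : Tendsto (fun t : ℝ => (bs t - b t) / a t) atTop (𝓝 0)) :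
    Tendsto (fun t => t * F.real (Ioi (bs t))) atTop (𝓝 1) := by
  have hanti : Antitone fun y => F.real (Ioi y) := fun x y h => measureReal_mono (Ioi_subset_Ioi h)
  have hE := (isOpen_EInterval γ).mem_nhds (zero_mem_EInterval γ)
  have hc := continuousAt_gevTail (zero_mem_EInterval γ)
  rw [ContinuousAt, gevTail_zero] at hc
  refine tendsto_order.2 ⟨fun s hs => ?_, fun s hs => ?_⟩
  · obtain ⟨y, ⟨h1, h2⟩, h3⟩ := (((hc.mono_left nhdsWithin_le_nhds).eventually
      (lt_mem_nhds hs)).and (nhdsWithin_le_nhds hE) |>.and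
        (self_mem_nhdsWithin (s := Ioi (0 : ℝ)))).exists
    filter_upwards [(h y h2).eventually (lt_mem_nhds h1), eventually_gt_atTop 0,
      hbs.eventually (gt_mem_nhds h3)] with t h4 h5 h6
    refine h4.trans_le (mul_le_mul_of_nonneg_left (hanti ?_) h5.le)
    rw [div_lt_iff₀ (ha t h5)] at h6
    linarith
  · obtain ⟨y, ⟨h1, h2⟩, h3⟩ := (((hc.mono_left nhdsWithin_le_nhds).eventually
      (gt_mem_nhds hs)).and (nhdsWithin_le_nhds hE) |>.and
        (self_mem_nhdsWithin (s := Iio (0 : ℝ)))).exists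
    filter_upwards [(h y h2).eventually (gt_mem_nhds h1), eventually_gt_atTop 0,
      hbs.eventually (lt_mem_nhds h3)] with t h4 h5 h6
    refine lt_of_le_of_lt (mul_le_mul_of_nonneg_left (hanti ?_) h5.le) h4
    rw [lt_div_iff₀ (ha t h5)] at h6
    linarith

/-- The tail at `bs t` tends to `0`, which carries `bs t` past every point below the endpoint; it is
also eventually positive, which keeps `bs t` below the endpoint. -/
theorem tendsto_toUpperEndpoint_of_tail
    (h : Tendsto (fun t => t * F.real (Ioi (bs t))) atTop (𝓝 1)) :
    Tendsto bs atTop (toUpperEndpoint F) := by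
  have hlt : ∀ y, F (Iic y) < 1 ↔ 0 < F.real (Ioi y) := by
    intro y
    rw [← not_iff_not, not_lt, not_lt, ← compl_Iic, probReal_compl_eq_one_sub measurableSet_Iic,
      sub_nonpos, measureReal_def, ← ENNReal.toReal_one, ENNReal.toReal_le_toReal (by simp)
        (by simp)]
  have hzero : Tendsto (fun t => F.real (Ioi (bs t))) atTop (𝓝 0) := by
    have := h.mul tendsto_inv_atTop_zero
    rw [one_mul] at this
    refine this.congr' ?_
    filter_upwards [eventually_gt_atTop 0] with t ht
    field_simp
  refine tendsto_comap_iff.2 (tendsto_nhdsWithin_iff.2 ⟨?_, ?_⟩)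
  · refine tendsto_order.2 ⟨fun c hc => ?_, fun c hc => ?_⟩
    · obtain ⟨z, ⟨c', hc', rfl⟩, hcc⟩ := lt_sSup_iff.1 hc
      filter_upwards [hzero.eventually (gt_mem_nhds ((hlt c').1 hc'))] with t ht
      refine hcc.trans (EReal.coe_lt_coe_iff.2 (lt_of_not_ge fun hle => ?_))
      exact absurd ht (not_lt.2 (measureReal_mono (Ioi_subset_Ioi hle)))
    · filter_upwards [h.eventually (lt_mem_nhds one_pos), eventually_gt_atTop 0] with t ht ht'
      have hle : (bs t : EReal) ≤ upperEndpoint F :=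
        le_sSup ⟨bs t, (hlt _).2 (pos_of_mul_pos_right ht ht'.le), rfl⟩
      exact hle.trans_lt hc
  · filter_upwards [h.eventually (lt_mem_nhds one_pos), eventually_gt_atTop 0] with t ht ht'
    have hpos : 0 < F.real (Ioi (bs t)) := pos_of_mul_pos_right ht ht'.le
    -- Right-continuity gives a point beyond `bs t` that still has positive tail, so `bs t` lies
    -- strictly below the endpoint.
    have hrc : Tendsto (fun y => F.real (Ioi y)) (𝓝[>] bs t) (𝓝 (F.real (Ioi (bs t)))) := by
      simp only [real_Ioi_eq]
      exact tendsto_const_nhds.sub (((cdf F).right_continuous _).mono Ioi_subset_Ici_self)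
    obtain ⟨y, hy, hy'⟩ := ((hrc.eventually (lt_mem_nhds hpos)).and self_mem_nhdsWithin).exists
    have : (y : EReal) ≤ upperEndpoint F := le_sSup ⟨y, (hlt y).2 hy, rfl⟩
    exact lt_of_lt_of_le (EReal.coe_lt_coe_iff.2 hy') this

/-- The upper quantile at level `u / t` is `bs (t w)` with `w → 1 / u`. -/
theorem exists_upperQuantile_eq (hcont : ContinuousOn bs (Ioi 0)) (hinj : InjOn bs (Ioi 0))
    (h : Tendsto (fun t => t * F.real (Ioi (bs t))) atTop (𝓝 1)) {u : ℝ} (hu : 0 < u) :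
    ∃ w : ℝ → ℝ, Tendsto w atTop (𝓝 u⁻¹) ∧
      ∀ᶠ t in atTop, bs (t * w t) = upperQuantile F (u / t) := by
  have hw : ∀ w : ℝ, 0 < w →
      Tendsto (fun t => t * F.real (Ioi (bs (t * w)))) atTop (𝓝 w⁻¹) := by
    intro w hw
    have := (h.comp (tendsto_id.atTop_mul_const hw)).const_mul w⁻¹
    rw [mul_one] at this
    refine this.congr fun t => ?_
    simp only [Function.comp_def, id]
    field_simp
  have hpos : 0 < u⁻¹ := inv_pos.2 hu
  -- The tails at `bs (t * w₁)` and `bs (t * w₂)` eventually lie on opposite sides of `u / t`, so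
  -- the intermediate value theorem applies to `bs`.
  have hex : ∀ w₁ w₂ : ℝ, 0 < w₁ → w₁ < u⁻¹ → u⁻¹ < w₂ → ∀ᶠ t : ℝ in atTop,
      ∃ w, w₁ ≤ w ∧ w ≤ w₂ ∧ bs (t * w) = upperQuantile F (u / t) := by
    intro w₁ w₂ h0 h1 h2
    have h1' : u < w₁⁻¹ := (lt_inv_comm₀ h0 hu).1 h1
    have h2' : w₂⁻¹ < u := (inv_lt_comm₀ hu (hpos.trans h2)).1 h2
    filter_upwards [(hw w₁ h0).eventually (lt_mem_nhds h1'),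
      (hw w₂ (hpos.trans h2)).eventually (gt_mem_nhds h2'), eventually_gt_atTop 0,
      eventually_gt_atTop u] with t h3 h4 h5 h6
    have h7 := (lt_upperQuantile_div_iff (F := F) h5 ⟨hu, h6⟩).2 h3
    have h8 := not_lt.1 ((not_congr (lt_upperQuantile_div_iff (F := F) h5 ⟨hu, h6⟩)).2 h4.not_gt)
    have hc : ContinuousOn (fun w => bs (t * w)) (Icc w₁ w₂) :=
      hcont.comp (by fun_prop) fun w hw => mul_pos h5 (h0.trans_le hw.1)
    obtain ⟨w, hw, hw'⟩ := intermediate_value_Icc (h1.trans h2).le hc ⟨h7.le, h8⟩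
    exact ⟨w, hw.1, hw.2, hw'⟩
  -- One choice of `w` must serve all brackets `[w₁, w₂]` at once. Injectivity of `bs` identifies it
  -- with the solution found in each bracket.
  let w : ℝ → ℝ := fun t => Classical.epsilon fun w => 0 < w ∧ bs (t * w) = upperQuantile F (u / t)
  have hspec : ∀ t, (∃ w, 0 < w ∧ bs (t * w) = upperQuantile F (u / t)) →
      0 < w t ∧ bs (t * w t) = upperQuantile F (u / t) := fun t ht => Classical.epsilon_spec ht
  have huniq : ∀ t w', 0 < t → 0 < w' → bs (t * w') = upperQuantile F (u / t) → w t = w' := by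
    intro t w' ht hw' h'
    obtain ⟨h1, h2⟩ := hspec t ⟨w', hw', h'⟩
    have := hinj (mul_pos ht h1) (mul_pos ht hw') (h2.trans h'.symm)
    exact mul_left_cancel₀ ht.ne' this
  refine ⟨w, tendsto_order.2 ⟨fun s hs => ?_, fun s hs => ?_⟩, ?_⟩
  · obtain ⟨w₁, h1, h1'⟩ := exists_between (max_lt hs hpos)
    filter_upwards [hex w₁ (u⁻¹ + 1) ((le_max_right _ _).trans_lt h1) h1' (lt_add_one _),
      eventually_gt_atTop 0] with t ⟨w', h2, h3, h4⟩ h5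
    rw [huniq t w' h5 (((le_max_right _ _).trans_lt h1).trans_le h2) h4]
    exact ((le_max_left _ _).trans_lt h1).trans_le h2
  · obtain ⟨w₂, h1, h1'⟩ := exists_between hs
    filter_upwards [hex (u⁻¹ / 2) w₂ (by positivity) (by linarith) h1,
      eventually_gt_atTop 0] with t ⟨w', h2, h3, h4⟩ h5
    rw [huniq t w' h5 ((by positivity : 0 < u⁻¹ / 2).trans_le h2) h4]
    exact h3.trans_lt h1'
  · filter_upwards [hex (u⁻¹ / 2) (u⁻¹ + 1) (by positivity) (by linarith) (lt_add_one _)]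
      with t ⟨w', h2, h3, h4⟩
    exact (hspec t ⟨w', (by positivity : 0 < u⁻¹ / 2).trans_le h2, h4⟩).2

end attraction

/-! ### Affine maps of `[-∞, ∞]` -/

/-- The extension of `x ↦ a x + b` to `[-∞, ∞]`. -/
noncomputable def affineEReal (a b : ℝ) (z : EReal) : EReal := (a : EReal) * z + (b : EReal)

@[simp] theorem affineEReal_coe (a b x : ℝ) : affineEReal a b (x : EReal) = ((a * x + b : ℝ) : EReal) := by
  simp [affineEReal]

theorem affineEReal_top {a : ℝ} (ha : 0 < a) (b : ℝ) : affineEReal a b ⊤ = ⊤ := by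
  simp [affineEReal, EReal.coe_mul_top_of_pos ha]

theorem affineEReal_bot {a : ℝ} (ha : 0 < a) (b : ℝ) : affineEReal a b ⊥ = ⊥ := by
  simp [affineEReal, EReal.coe_mul_bot_of_pos ha]

theorem affineEReal_comp {a b a' b' : ℝ} (ha : 0 < a) (ha' : 0 < a') (z : EReal) :
    affineEReal a b (affineEReal a' b' z) = affineEReal (a * a') (a * b' + b) z := by
  induction z with
  | bot => simp only [affineEReal_bot ha', affineEReal_bot ha, affineEReal_bot (mul_pos ha ha')]
  | top => simp only [affineEReal_top ha', affineEReal_top ha, affineEReal_top (mul_pos ha ha')]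
  | coe x => simp only [affineEReal_coe]; congr 1; ring

theorem affineEReal_le_coe_iff {a : ℝ} (ha : 0 < a) {b x : ℝ} {z : EReal} :
    affineEReal a b z ≤ x ↔ z ≤ (((x - b) / a : ℝ) : EReal) := by
  induction z with
  | bot => simp [affineEReal_bot ha]
  | top => simp [affineEReal_top ha]
  | coe z => rw [affineEReal_coe, EReal.coe_le_coe_iff, EReal.coe_le_coe_iff, le_div_iff₀' ha,
      le_sub_iff_add_le]

theorem affineEReal_eq_top_iff {a : ℝ} (ha : 0 < a) {b : ℝ} {z : EReal} :
    affineEReal a b z = ⊤ ↔ z = ⊤ := by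
  induction z with
  | bot => simp [affineEReal_bot ha]
  | top => simp [affineEReal_top ha]
  | coe z => simp only [affineEReal_coe, EReal.coe_ne_top]

theorem affineEReal_eq_bot_iff {a : ℝ} (ha : 0 < a) {b : ℝ} {z : EReal} :
    affineEReal a b z = ⊥ ↔ z = ⊥ := by
  induction z with
  | bot => simp [affineEReal_bot ha]
  | top => simp [affineEReal_top ha]
  | coe z => simp only [affineEReal_coe, EReal.coe_ne_bot]

theorem affineEReal_eq_coe_iff {a : ℝ} (ha : 0 < a) {b x : ℝ} {z : EReal} :
    affineEReal a b z = x ↔ z = (((x - b) / a : ℝ) : EReal) := by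
  induction z with
  | bot => simp [affineEReal_bot ha, -EReal.coe_sub]
  | top => simp [affineEReal_top ha, -EReal.coe_sub]
  | coe z => rw [affineEReal_coe, EReal.coe_eq_coe_iff, EReal.coe_eq_coe_iff, eq_div_iff ha.ne',
      eq_sub_iff_add_eq, mul_comm]

/-- Joint continuity in coefficients and argument persists at `±∞` because a positive limiting scale
avoids the product of `0` and `∞`, and the shift is finite. -/
theorem continuousAt_affineEReal {a : ℝ} (ha : 0 < a) (b : ℝ) (z : EReal) :
    ContinuousAt (fun p : (ℝ × ℝ) × EReal => affineEReal p.1.1 p.1.2 p.2) ((a, b), z) := by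
  have ha' : (a : EReal) ≠ 0 := by exact_mod_cast ha.ne'
  have h1 : ContinuousAt (fun p : (ℝ × ℝ) × EReal => ((p.1.1 : EReal), p.2)) ((a, b), z) := by
    have := continuous_coe_real_ereal
    fun_prop
  have h2 : ContinuousAt (fun p : (ℝ × ℝ) × EReal => (p.1.1 : EReal) * p.2) ((a, b), z) :=
    ContinuousAt.comp (g := fun q : EReal × EReal => q.1 * q.2)
      (EReal.continuousAt_mul (Or.inl ha') (Or.inl ha') (Or.inl (EReal.coe_ne_bot a))
        (Or.inl (EReal.coe_ne_top a))) h1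
  have h3 : ContinuousAt (fun p : (ℝ × ℝ) × EReal => (p.1.2 : EReal)) ((a, b), z) := by
    have := continuous_coe_real_ereal
    fun_prop
  exact ContinuousAt.comp (g := fun q : EReal × EReal => q.1 + q.2)
    (f := fun p : (ℝ × ℝ) × EReal => ((p.1.1 : EReal) * p.2, (p.1.2 : EReal)))
    (EReal.continuousAt_add (Or.inr (EReal.coe_ne_bot b)) (Or.inr (EReal.coe_ne_top b)))
    (h2.prodMk h3)

theorem Measurable.affineEReal {δ : Type*} [MeasurableSpace δ] {a b : δ → ℝ} {z : δ → EReal}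
    (ha : Measurable a) (hb : Measurable b) (hz : Measurable z) :
    Measurable fun d => affineEReal (a d) (b d) (z d) :=
  (ha.coe_real_ereal.mul hz).add hb.coe_real_ereal

/-! ### Distribution functions of finite measures on `[-∞, ∞]` -/

section distribution

variable (ν : Measure EReal) [IsFiniteMeasure ν]

theorem tendsto_measure_Iic_nhdsGT (c : EReal) (hc : c < ⊤) :
    Tendsto (fun z => ν (Iic z)) (𝓝[>] c) (𝓝 (ν (Iic c))) := by
  have h := tendsto_measure_biInter_gt (μ := ν) (s := fun r : EReal => Iic r) (a := c)
    (fun r _ => measurableSet_Iic.nullMeasurableSet) (fun i j _ hij => Iic_subset_Iic.2 hij)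
    ⟨⊤, hc, measure_ne_top _ _⟩
  have : (⋂ r > c, Iic r) = Iic c := by
    ext z
    simp only [mem_iInter, mem_Iic]
    exact ⟨fun h => le_of_forall_gt_imp_ge_of_dense h, fun h r hr => h.trans hr.le⟩
  rwa [this] at h

/-- The distribution function `x ↦ ν [-∞, x]` on the real line. -/
noncomputable def distFun : StieltjesFunction ℝ where
  toFun x := ν.real (Iic (x : EReal))
  mono' x y h := measureReal_mono (Iic_subset_Iic.2 (EReal.coe_le_coe_iff.2 h))
  right_continuous' x := by
    rw [← continuousWithinAt_Ioi_iff_Ici]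
    have h1 : Tendsto (fun y : ℝ => (y : EReal)) (𝓝[>] x) (𝓝[>] (x : EReal)) :=
      tendsto_nhdsWithin_iff.2 ⟨(continuous_coe_real_ereal.tendsto x).mono_left nhdsWithin_le_nhds,
        by filter_upwards [self_mem_nhdsWithin] with y hy using EReal.coe_lt_coe_iff.2 hy⟩
    exact (ENNReal.tendsto_toReal (measure_ne_top _ _)).comp
      ((tendsto_measure_Iic_nhdsGT ν x (EReal.coe_lt_top x)).comp h1)

@[simp] theorem distFun_apply (x : ℝ) : distFun ν x = ν.real (Iic (x : EReal)) := rfl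

theorem measureReal_Ioc (x y : ℝ) (h : x ≤ y) :
    ν.real (Ioc (x : EReal) y) = distFun ν y - distFun ν x := by
  rw [distFun_apply, distFun_apply, ← measureReal_sdiff
    (Iic_subset_Iic.2 (EReal.coe_le_coe_iff.2 h)) measurableSet_Iic]
  congr 1
  ext z
  simp

theorem continuousAt_distFun {x : ℝ} (hx : ν {(x : EReal)} = 0) : ContinuousAt (distFun ν) x := by
  obtain ⟨u, hu, hux, hlim⟩ := exists_seq_strictMono_tendsto x
  have h1 : Tendsto (fun n => ν (Ioc (u n : EReal) x)) atTop (𝓝 (ν (⋂ n, Ioc (u n : EReal) x))) := by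
    refine tendsto_measure_iInter_atTop (fun n => measurableSet_Ioc.nullMeasurableSet) ?_
      ⟨0, measure_ne_top _ _⟩
    exact fun n m h => Ioc_subset_Ioc_left (EReal.coe_le_coe_iff.2 (hu.monotone h))
  have h2 : (⋂ n, Ioc (u n : EReal) x) = {(x : EReal)} := by
    ext z
    simp only [mem_iInter, mem_Ioc, mem_singleton_iff]
    constructor
    · intro h
      refine le_antisymm (h 0).2 ?_
      exact le_of_tendsto ((continuous_coe_real_ereal.tendsto x).comp hlim)
        (Eventually.of_forall fun n => (h n).1.le)
    · rintro rfl
      exact fun n => ⟨EReal.coe_lt_coe_iff.2 (hux n), le_rfl⟩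
  rw [h2, hx] at h1
  have h3 : Tendsto (fun n => distFun ν x - distFun ν (u n)) atTop (𝓝 0) := by
    refine ((ENNReal.tendsto_toReal ENNReal.zero_ne_top).comp h1).congr fun n => ?_
    exact measureReal_Ioc ν _ _ (hux n).le
  have hright := (distFun ν).right_continuous x
  refine continuousAt_iff_continuous_left_right.2 ⟨?_, hright⟩
  refine tendsto_order.2 ⟨fun r hr => ?_, fun r hr => ?_⟩
  · obtain ⟨n, hn⟩ := (h3.eventually (gt_mem_nhds (sub_pos.2 hr))).exists
    filter_upwards [mem_nhdsWithin_of_mem_nhds (lt_mem_nhds (hux n))] with y hy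
    have := (distFun ν).mono hy.le
    linarith
  · filter_upwards [self_mem_nhdsWithin] with y hy
    exact ((distFun ν).mono hy).trans_lt hr

theorem countable_atoms : {x : ℝ | ν {(x : EReal)} ≠ 0}.Countable := by
  have h := Measure.countable_meas_pos_of_disjoint_iUnion (μ := ν)
    (As := fun x : ℝ => {(x : EReal)}) (fun x => measurableSet_singleton _)
    (fun x y hxy => by simpa using hxy)
  simpa only [pos_iff_ne_zero] using h

theorem ae_measure_singleton_eq_zero : ∀ᵐ x : ℝ, ν {(x : EReal)} = 0 :=
  (countable_atoms ν).measure_zero volume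

/-- The real line without `c` is a countable union of rational intervals on one side of `c`;
constancy of the distribution function on each side makes them all null. -/
theorem NondegenerateOnReals.nondegenerateFun {ν : Measure EReal} [IsFiniteMeasure ν]
    (h : NondegenerateOnReals ν) : NondegenerateFun (distFun ν) := by
  rintro ⟨c, h1, h2⟩
  refine h ⟨c, ?_⟩
  have hsub : {z : EReal | z ≠ ⊥ ∧ z ≠ ⊤ ∧ z ≠ (c : EReal)} ⊆
      ⋃ p : ℚ × ℚ, ⋃ _ : ((p.1 : ℝ) < p.2 ∧ ((p.2 : ℝ) < c ∨ c < (p.1 : ℝ))),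
        Ioc ((p.1 : ℝ) : EReal) ((p.2 : ℝ) : EReal) := by
    rintro z ⟨hb, ht, hc⟩
    lift z to ℝ using ⟨ht, hb⟩
    have hc : z ≠ c := fun h => hc (by rw [h])
    simp only [mem_iUnion, mem_Ioc, EReal.coe_lt_coe_iff, EReal.coe_le_coe_iff]
    rcases lt_or_gt_of_ne hc with h | h
    · obtain ⟨q, hq⟩ := exists_rat_lt z
      obtain ⟨r, hr, hr'⟩ := exists_rat_btwn h
      exact ⟨(q, r), ⟨hq.trans hr, Or.inl hr'⟩, hq, hr.le⟩
    · obtain ⟨r, hr⟩ := exists_rat_gt z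
      obtain ⟨q, hq, hq'⟩ := exists_rat_btwn h
      exact ⟨(q, r), ⟨hq'.trans hr, Or.inr hq⟩, hq', hr.le⟩
  refine measure_mono_null hsub (measure_iUnion_null fun p => measure_iUnion_null fun hp => ?_)
  rw [← measureReal_eq_zero_iff, measureReal_Ioc _ _ _ hp.1.le, sub_eq_zero]
  rcases hp.2 with h | h
  · exact h1 _ _ h (hp.1.trans h)
  · exact h2 _ _ (h.trans hp.1) h

variable {ν}

/-- No mass can hide at infinity: the mass at `-∞` is the limit of `ν (Iic z)` as `z` decreases to
`-∞`, and the total mass `1` settles `+∞`. -/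
theorem ProbabilityMeasure.ext_of_distFun {ν ν' : Measure EReal} [IsProbabilityMeasure ν]
    [IsProbabilityMeasure ν'] (h : ∀ᵐ x : ℝ, distFun ν x = distFun ν' x) : ν = ν' := by
  have hreal : ∀ z : EReal, ⊥ < z → ν (Iic z) = ν' (Iic z) := by
    intro z hz
    induction z with
    | bot => simp at hz
    | top => simp
    | coe x =>
      have := StieltjesFunction.eq_of_ae_eq h x
      simpa [measureReal_eq_measureReal_iff] using this
  refine Measure.ext_of_Iic _ _ fun z => ?_
  rcases eq_bot_or_bot_lt z with rfl | hz
  · have : (𝓝[>] (⊥ : EReal)).NeBot := nhdsGT_neBot_of_exists_gt ⟨⊤, bot_lt_top⟩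
    refine tendsto_nhds_unique (tendsto_measure_Iic_nhdsGT ν ⊥ bot_lt_top)
      ((tendsto_measure_Iic_nhdsGT ν' ⊥ bot_lt_top).congr' ?_)
    filter_upwards [self_mem_nhdsWithin] with z hz using (hreal z hz).symm
  · exact hreal z hz

/-- Convergence of distribution functions at almost all points implies weak convergence on
`[-∞, ∞]`. -/
theorem tendsto_probabilityMeasure_of_distFun {ι : Type*} {l : Filter ι}
    {κ : ι → ProbabilityMeasure EReal} {ν : ProbabilityMeasure EReal}
    (h : ∀ᵐ x : ℝ, Tendsto (fun i => distFun (κ i : Measure EReal) x) l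
      (𝓝 (distFun (ν : Measure EReal) x))) :
    Tendsto κ l (𝓝 ν) := by
  rw [tendsto_iff_ultrafilter]
  intro U hU
  -- Probability measures on the compact space `[-∞, ∞]` form a compact space, so only the limit
  -- points have to be identified.
  obtain ⟨κ', -, hκ⟩ := (isCompact_univ (X := ProbabilityMeasure EReal)).ultrafilter_le_nhds
    (U.map κ) (by simp)
  replace hκ : Tendsto κ U (𝓝 κ') := hκ
  have heq : (κ' : Measure EReal) = ν := by
    refine ProbabilityMeasure.ext_of_distFun ?_
    filter_upwards [h, ae_measure_singleton_eq_zero (κ' : Measure EReal)] with x hx hx'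
    refine tendsto_nhds_unique ?_ (hx.mono_left hU)
    have hfr : (κ' : Measure EReal) (frontier (Iic (x : EReal))) = 0 :=
      measure_mono_null (frontier_Iic_subset _) hx'
    exact (ENNReal.tendsto_toReal (measure_ne_top _ _)).comp
      (ProbabilityMeasure.tendsto_measure_of_null_frontier_of_tendsto' hκ hfr)
  rwa [Subtype.ext heq] at hκ

end distribution

/-! ### The state space -/

/-- The inclusion of the state space into `[-∞, ∞] × [-∞, ∞]`. -/
def cevInclusion (γ : ℝ) (p : CEVSpace γ) : EReal × EReal := (p.1, (p.2 : EReal))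

theorem measurableSet_EIntervalRightClosed (γ : ℝ) : MeasurableSet (EIntervalRightClosed γ) :=
  measurableSet_Ioc

theorem range_cevInclusion (γ : ℝ) : range (cevInclusion γ) = univ ×ˢ EIntervalRightClosed γ := by
  ext ⟨z, y⟩
  simp only [mem_range, cevInclusion, Prod.mk.injEq, Prod.exists, Subtype.exists, mem_prod, mem_univ,
    true_and, exists_prop]
  exact ⟨fun ⟨_, _, h, _, h'⟩ => h' ▸ h, fun h => ⟨z, y, h, rfl, rfl⟩⟩

theorem isEmbedding_cevInclusion (γ : ℝ) : IsEmbedding (cevInclusion γ) :=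
  IsEmbedding.id.prodMap IsEmbedding.subtypeVal

theorem measurableEmbedding_cevInclusion (γ : ℝ) : MeasurableEmbedding (cevInclusion γ) :=
  (isEmbedding_cevInclusion γ).measurableEmbedding (by
    rw [range_cevInclusion]
    exact MeasurableSet.univ.prod (measurableSet_EIntervalRightClosed γ))

theorem integral_comap_cevInclusion {γ : ℝ} (ν : Measure (EReal × EReal)) {h : EReal × EReal → ℝ}
    (hvan : ∀ p, p.2 ∉ EIntervalRightClosed γ → h p = 0) :
    ∫ p, h (cevInclusion γ p) ∂(ν.comap (cevInclusion γ)) = ∫ p, h p ∂ν := by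
  rw [← (measurableEmbedding_cevInclusion γ).integral_map,
    (measurableEmbedding_cevInclusion γ).map_comap, range_cevInclusion]
  exact setIntegral_eq_integral_of_forall_compl_eq_zero fun p hp => hvan p fun h => hp ⟨trivial, h⟩

theorem isCompact_upper {γ y : ℝ} (hy : y ∈ EInterval γ) :
    IsCompact {p : CEVSpace γ | (y : EReal) ≤ (p.2 : EReal)} := by
  have h : {p : CEVSpace γ | (y : EReal) ≤ (p.2 : EReal)} =
      cevInclusion γ ⁻¹' (univ ×ˢ Ici (y : EReal)) := by
    ext p; simp [cevInclusion]
  have h' : Ici (y : EReal) ∩ EIntervalRightClosed γ =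
      Icc (y : EReal) (if γ < 0 then ((-γ⁻¹ : ℝ) : EReal) else ⊤) := by
    ext z
    exact ⟨fun hz => ⟨hz.1, hz.2.2⟩, fun hz => ⟨hz.1, (mem_EInterval_iff.1 hy).1.trans_le hz.1, hz.2⟩⟩
  rw [h, (isEmbedding_cevInclusion γ).isInducing.isCompact_iff, image_preimage_eq_inter_range,
    range_cevInclusion, prod_inter_prod, h', univ_inter]
  exact isCompact_univ.prod isCompact_Icc

theorem exists_lower_bound_of_isCompact {γ : ℝ} {s : Set (CEVSpace γ)} (hs : IsCompact s) :
    ∃ y ∈ EInterval γ, ∀ p ∈ s, (y : EReal) < (p.2 : EReal) := by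
  rcases s.eq_empty_or_nonempty with rfl | hne
  · exact ⟨0, zero_mem_EInterval γ, by simp⟩
  · obtain ⟨p, hp, hmin⟩ := hs.exists_isMinOn hne
      (f := fun p : CEVSpace γ => (p.2 : EReal)) (by fun_prop)
    obtain ⟨y, hy, hlt⟩ := exists_mem_EInterval_lt p.2.2
    exact ⟨y, hy, fun q hq => hlt.trans_le (hmin hq)⟩

/-! ### Disintegration of the scaled law along quantiles -/

section disintegration

variable (F : Measure ℝ) [IsProbabilityMeasure F] (K : Kernel ℝ EReal) [IsMarkovKernel K]

theorem measurable_upperQuantile_div (t : ℝ) : Measurable fun u => upperQuantile F (u / t) :=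
  (measurable_upperQuantile F).comp (measurable_id.div_const t)

/-- With levels rescaled to `(0, t)`, the factor `t` is absorbed into Lebesgue measure and the level
`u` has a meaning independent of `t`. -/
theorem map_upperQuantile_div {t : ℝ} (ht : 0 < t) :
    (volume.restrict (Ioo 0 t)).map (fun u => upperQuantile F (u / t)) = ENNReal.ofReal t • F := by
  have hdiv : (volume.restrict (Ioo 0 t)).map (fun u => u * t⁻¹) =
      ENNReal.ofReal t • volume.restrict (Ioo (0 : ℝ) 1) := by
    have hpre : Ioo 0 t = (fun u => u * t⁻¹) ⁻¹' Ioo (0 : ℝ) 1 := by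
      ext u
      simp only [mem_Ioo, mem_preimage, ← div_eq_mul_inv]
      rw [div_lt_one ht, div_pos_iff_of_pos_right ht]
    rw [hpre, ← Measure.restrict_map (by fun_prop) measurableSet_Ioo,
      Real.map_volume_mul_right (by positivity), inv_inv, abs_of_pos ht, Measure.restrict_smul]
  have hcomp : (fun u => upperQuantile F (u / t)) = upperQuantile F ∘ fun u => u * t⁻¹ := by
    ext u; simp [div_eq_mul_inv]
  rw [hcomp, ← Measure.map_map (measurable_upperQuantile F) (by fun_prop), hdiv, Measure.map_smul,
    map_upperQuantile]

theorem compProd_comap_map {δ : Type*} [MeasurableSpace δ] (μ : Measure δ) [SFinite μ] {g : δ → ℝ}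
    (hg : Measurable g) : (μ ⊗ₘ K.comap g hg).map (Prod.map g id) = (μ.map g) ⊗ₘ K := by
  have hm : Measurable (Prod.map g (id : EReal → EReal)) := hg.prodMap measurable_id
  ext s hs
  rw [Measure.map_apply hm hs, Measure.compProd_apply (hm hs), Measure.compProd_apply hs,
    lintegral_map (Kernel.measurable_kernel_prodMk_left hs) hg]
  rfl

variable {Ω : Type*} [MeasurableSpace Ω] {P : Measure Ω} {X Y : Ω → ℝ}

/-- Integrals against the scaled law as integrals over quantile levels. -/
theorem integral_scaledLaw (hX : Measurable X) (hY : Measurable Y)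
    (hK : P.map (fun ω => (Y ω, (X ω : EReal))) = F.compProd K)
    {γ : ℝ} {α β a b : ℝ → ℝ} {t : ℝ} (ht : 0 < t) (hα : 0 < α t) {h : EReal × EReal → ℝ}
    (hm : Measurable h) {C : ℝ} (hC : ∀ p, |h p| ≤ C)
    (hvan : ∀ p, p.2 ∉ EIntervalRightClosed γ → h p = 0) :
    ∫ p, h (cevInclusion γ p) ∂(scaledLaw P X Y γ α β a b t) =
      ∫ u in Ioo 0 t, ∫ z, h (affineEReal (1 / α t) (-β t / α t) z,
        (((upperQuantile F (u / t) - b t) / a t : ℝ) : EReal)) ∂K (upperQuantile F (u / t)) := by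
  let ψ : ℝ × EReal → EReal × EReal := fun q =>
    (affineEReal (1 / α t) (-β t / α t) q.2, (((q.1 - b t) / a t : ℝ) : EReal))
  have hψ : Measurable ψ := by
    refine (Measurable.affineEReal measurable_const measurable_const measurable_snd).prodMk ?_
    exact ((measurable_fst.sub_const _).div_const _).coe_real_ereal
  have hYX : Measurable fun ω => (Y ω, (X ω : EReal)) := hY.prodMk hX.coe_real_ereal
  have hmap : P.map (fun ω => ((((X ω - β t) / α t : ℝ) : EReal), (((Y ω - b t) / a t : ℝ) : EReal)))
      = (P.map (fun ω => (Y ω, (X ω : EReal)))).map ψ := by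
    rw [Measure.map_map hψ hYX]
    congr 1
    ext ω : 1
    simp only [Function.comp_def, ψ, affineEReal_coe]
    congr 2
    field_simp; ring
  have hg := measurable_upperQuantile_div F t
  have hJ : ENNReal.ofReal t • P.map (fun ω => (Y ω, (X ω : EReal))) =
      ((volume.restrict (Ioo 0 t)) ⊗ₘ K.comap _ hg).map
        (Prod.map (fun u => upperQuantile F (u / t)) id) := by
    rw [compProd_comap_map, map_upperQuantile_div F ht, hK, Measure.compProd_smul_left]
  have hs : scaledLaw P X Y γ α β a b t = ((((volume.restrict (Ioo 0 t)) ⊗ₘ K.comap _ hg).map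
        (Prod.map (fun u => upperQuantile F (u / t)) id)).map ψ).comap (cevInclusion γ) := by
    rw [← hJ, Measure.map_smul, ← hmap, Measure.comap_smul]
    rfl
  have hm1 : Measurable (Prod.map (fun u => upperQuantile F (u / t)) (id : EReal → EReal)) :=
    hg.prodMap measurable_id
  rw [hs, integral_comap_cevInclusion _ hvan, integral_map hψ.aemeasurable hm.aestronglyMeasurable,
    integral_map (f := fun q => h (ψ q)) hm1.aemeasurable (hm.comp hψ).aestronglyMeasurable,
    Measure.integral_compProd]
  · rfl
  · refine Integrable.of_bound ((hm.comp hψ).comp hm1).aestronglyMeasurable C ?_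
    exact Eventually.of_forall fun p => hC _

end disintegration

/-! ### Dominated convergence over quantile levels -/

/-- After extension by zero beyond `t`, everything is dominated on `(0, ∞)` by a constant on levels
up to `M`. -/
theorem tendsto_setIntegral_Ioo {g : ℝ → ℝ → ℝ} {g' : ℝ → ℝ} {C M : ℝ}
    (hm : ∀ t, Measurable (g t))
    (hbd : ∀ᶠ t in atTop, ∀ u ∈ Ioo 0 t, |g t u| ≤ C ∧ (M < u → g t u = 0))
    (hlim : ∀ u, 0 < u → Tendsto (fun t => g t u) atTop (𝓝 (g' u))) :
    Tendsto (fun t => ∫ u in Ioo 0 t, g t u) atTop (𝓝 (∫ u in Ioi 0, g' u)) := by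
  have h1 : ∀ t, ∫ u in Ioo 0 t, g t u = ∫ u in Ioi (0 : ℝ), (Iio t).indicator (g t) u := by
    intro t
    rw [integral_indicator measurableSet_Iio, Measure.restrict_restrict measurableSet_Iio,
      inter_comm, Ioi_inter_Iio]
  simp only [h1]
  refine tendsto_integral_filter_of_dominated_convergence ((Iic M).indicator fun _ => |C|) ?_ ?_ ?_ ?_
  · exact Eventually.of_forall fun t => ((hm t).indicator measurableSet_Iio).aestronglyMeasurable
  · filter_upwards [hbd] with t ht
    refine (ae_restrict_iff' measurableSet_Ioi).2 (Eventually.of_forall fun u hu => ?_)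
    by_cases hut : u < t
    · obtain ⟨h2, h3⟩ := ht u ⟨hu, hut⟩
      simp only [indicator, mem_Iio, hut, if_true, mem_Iic, Real.norm_eq_abs]
      split_ifs with h4
      · exact h2.trans (le_abs_self C)
      · rw [h3 (not_le.1 h4), abs_zero]
    · simp only [indicator, mem_Iio, hut, if_false, norm_zero]
      split_ifs <;> simp
  · rw [integrable_indicator_iff measurableSet_Iic]
    refine integrableOn_const ?_
    rw [Measure.restrict_apply measurableSet_Iic, Iic_inter_Ioi]
    simp
  · refine (ae_restrict_iff' measurableSet_Ioi).2 (Eventually.of_forall fun u hu => ?_)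
    refine (hlim u hu).congr' ?_
    filter_upwards [eventually_gt_atTop u] with t ht
    simp [indicator, ht]

/-- Provides the cutoff `M` for dominated convergence: levels beyond `gevTail γ y + 1` have
normalized quantile at most `y`, below the support of the test function. -/
theorem InDomainOfAttraction.eventually_level_le {F : Measure ℝ} [IsProbabilityMeasure F] {γ : ℝ}
    {a b : ℝ → ℝ} (ha : ∀ t, 0 < t → 0 < a t) (h : InDomainOfAttraction F γ a b) {y : ℝ}
    (hy : y ∈ EInterval γ) : ∀ᶠ t in atTop, ∀ u ∈ Ioo 0 t,
      y < (upperQuantile F (u / t) - b t) / a t → u ≤ gevTail γ y + 1 := by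
  filter_upwards [(h y hy).eventually (gt_mem_nhds (lt_add_one _)), eventually_gt_atTop 0]
    with t h1 h2 u hu h3
  rw [lt_div_iff₀ (ha t h2)] at h3
  exact (((lt_upperQuantile_div_iff (F := F) (y := a t * y + b t) h2 hu).1 (by linarith)).trans
    h1).le

/-! ### The limit measure -/

theorem ervPsi_inv {ρ k u : ℝ} (hu : 0 < u) : ervPsi ρ k u⁻¹ = -(u ^ ρ)⁻¹ * ervPsi ρ k u := by
  have h := (Real.rpow_pos_of_pos hu ρ).ne'
  unfold ervPsi
  split_ifs with h0
  · simp [h0, Real.log_inv]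
  · rw [Real.inv_rpow hu.le]
    field_simp
    ring

theorem measurable_ervPsi (ρ k : ℝ) : Measurable (ervPsi ρ k) := by
  by_cases h : ρ = 0
  · have : ervPsi ρ k = fun x => k * Real.log x := by ext x; simp [ervPsi, h]
    rw [this]; fun_prop
  · have : ervPsi ρ k = fun x => k * ρ⁻¹ * (x ^ ρ - 1) := by ext x; simp [ervPsi, h]
    rw [this]; fun_prop

/-- The limiting affine normalization at level `u`, extended to `[-∞, ∞]`. -/
noncomputable def ervAffine (ρ k u : ℝ) : EReal → EReal :=
  affineEReal (u⁻¹ ^ ρ) (ervPsi ρ k u⁻¹)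

theorem ervAffine_coeff_pos {ρ u : ℝ} (hu : 0 < u) : 0 < u⁻¹ ^ ρ :=
  Real.rpow_pos_of_pos (inv_pos.2 hu) ρ

/-- The limiting affine map at `1 / u` is inverse to the one at `u`. This is where the argument `u ^
ρ * x + ψ u` of `G` in the limit formula comes from. -/
theorem ervAffine_symm_eq {ρ k u : ℝ} (hu : 0 < u) (x : ℝ) :
    (x - ervPsi ρ k u⁻¹) / u⁻¹ ^ ρ = u ^ ρ * x + ervPsi ρ k u := by
  have h := (Real.rpow_pos_of_pos hu ρ).ne'
  rw [ervPsi_inv hu, Real.inv_rpow hu.le]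
  field_simp
  ring

theorem ervAffine_le_iff {ρ k u : ℝ} (hu : 0 < u) {z : EReal} {x : ℝ} :
    ervAffine ρ k u z ≤ x ↔ z ≤ ((u ^ ρ * x + ervPsi ρ k u : ℝ) : EReal) := by
  rw [ervAffine, affineEReal_le_coe_iff (ervAffine_coeff_pos hu), ervAffine_symm_eq hu]

theorem measurable_ervAffine (ρ k : ℝ) : Measurable fun p : ℝ × EReal => ervAffine ρ k p.1 p.2 :=
  Measurable.affineEReal (by fun_prop) ((measurable_ervPsi ρ k).comp (by fun_prop)) measurable_snd

/-- The limit law on `[-∞, ∞] × [-∞, ∞]`. -/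
noncomputable def limitLaw (G : Measure EReal) (γ ρ k : ℝ) : Measure (EReal × EReal) :=
  ((volume.restrict (Ioi (0 : ℝ))).prod G).map
    fun p => (ervAffine ρ k p.1 p.2, ((gevQuantile γ p.1 : ℝ) : EReal))

/-- The limit measure of the conditional extreme value model. -/
noncomputable def limitMeasure (G : Measure EReal) (γ ρ k : ℝ) : Measure (CEVSpace γ) :=
  (limitLaw G γ ρ k).comap (cevInclusion γ)

theorem measurable_limitLaw_map (γ ρ k : ℝ) : Measurable fun p : ℝ × EReal =>
    (ervAffine ρ k p.1 p.2, ((gevQuantile γ p.1 : ℝ) : EReal)) :=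
  (measurable_ervAffine ρ k).prodMk
    ((measurable_gevQuantile γ).comp measurable_fst).coe_real_ereal

theorem measurableSet_upperRect {γ : ℝ} {A : Set EReal} (hA : MeasurableSet A) (y : ℝ) :
    MeasurableSet (upperRect γ A y) := by
  have h : Measurable fun p : CEVSpace γ => (p.2 : EReal) :=
    measurable_subtype_coe.comp measurable_snd
  exact (measurable_fst hA).inter (h measurableSet_Ioi)

section limit

variable (G : Measure EReal) [IsProbabilityMeasure G] {γ : ℝ} (ρ k : ℝ)

theorem limitMeasure_upperRect {A : Set EReal} (hA : MeasurableSet A) {y : ℝ}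
    (hy : y ∈ EInterval γ) : limitMeasure G γ ρ k (upperRect γ A y) =
      ∫⁻ u in Ioo 0 (gevTail γ y), G (ervAffine ρ k u ⁻¹' A) := by
  have himg : cevInclusion γ '' upperRect γ A y =
      A ×ˢ (Ioi (y : EReal) ∩ EIntervalRightClosed γ) := by
    have : upperRect γ A y = cevInclusion γ ⁻¹' (A ×ˢ Ioi (y : EReal)) := rfl
    rw [this, image_preimage_eq_inter_range, range_cevInclusion, prod_inter_prod, inter_univ]
  have hS : MeasurableSet (A ×ˢ (Ioi (y : EReal) ∩ EIntervalRightClosed γ)) :=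
    hA.prod (measurableSet_Ioi.inter (measurableSet_EIntervalRightClosed γ))
  rw [limitMeasure, (measurableEmbedding_cevInclusion γ).comap_apply, himg, limitLaw,
    Measure.map_apply (measurable_limitLaw_map γ ρ k) hS,
    Measure.prod_apply (measurable_limitLaw_map γ ρ k hS)]
  have hIoo : Ioo 0 (gevTail γ y) = Iio (gevTail γ y) ∩ Ioi 0 := by
    rw [inter_comm, Ioi_inter_Iio]
  rw [hIoo, ← Measure.restrict_restrict measurableSet_Iio, ← lintegral_indicator measurableSet_Iio]
  refine setLIntegral_congr_fun measurableSet_Ioi fun u hu => ?_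
  have hmem := coe_mem_EIntervalRightClosed (gevQuantile_mem (γ := γ) hu)
  by_cases h : u < gevTail γ y
  · have h' : (y : EReal) < gevQuantile γ u :=
      EReal.coe_lt_coe_iff.2 ((lt_gevQuantile_iff hu hy).2 h)
    simp only [indicator, mem_Iio, h, if_true]
    congr 1
    ext z
    simp [h', hmem]
  · have h' : ¬ (y : EReal) < gevQuantile γ u := fun h' =>
      h ((lt_gevQuantile_iff hu hy).1 (EReal.coe_lt_coe_iff.1 h'))
    simp only [indicator, mem_Iio, h, if_false]
    convert measure_empty (μ := G) using 2
    ext z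
    simp [h']

theorem limitMeasure_upperRect_Iic (x : ℝ) {y : ℝ} (hy : y ∈ EInterval γ) :
    limitMeasure G γ ρ k (upperRect γ (Iic (x : EReal)) y) = limitMass G γ ρ k x y := by
  rw [limitMeasure_upperRect G ρ k measurableSet_Iic hy, limitMass]
  refine setLIntegral_congr_fun measurableSet_Ioo fun u hu => ?_
  congr 1
  ext z
  exact ervAffine_le_iff hu.1

theorem limitMeasure_upperRect_univ {y : ℝ} (hy : y ∈ EInterval γ) :
    limitMeasure G γ ρ k (upperRect γ univ y) = ENNReal.ofReal (gevTail γ y) := by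
  simp [limitMeasure_upperRect G ρ k MeasurableSet.univ hy]

theorem limitMeasure_upperRect_top (hG : G {⊤} = 0) {y : ℝ} (hy : y ∈ EInterval γ) :
    limitMeasure G γ ρ k (upperRect γ {⊤} y) = 0 := by
  rw [limitMeasure_upperRect G ρ k (measurableSet_singleton _) hy]
  refine (setLIntegral_congr_fun measurableSet_Ioo fun u hu => ?_).trans lintegral_zero
  rw [← hG]
  congr 1
  ext z
  exact affineEReal_eq_top_iff (ervAffine_coeff_pos hu.1)

theorem isFiniteMeasureOnCompacts_limitMeasure :
    IsFiniteMeasureOnCompacts (limitMeasure G γ ρ k) := by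
  refine ⟨fun s hs => ?_⟩
  obtain ⟨y, hy, hlt⟩ := exists_lower_bound_of_isCompact hs
  have hsub : s ⊆ upperRect γ univ y := fun p hp => ⟨trivial, hlt p hp⟩
  refine (measure_mono hsub).trans_lt ?_
  rw [limitMeasure_upperRect_univ G ρ k hy]
  exact ENNReal.ofReal_lt_top

theorem limitMeasure_ne_zero : limitMeasure G γ ρ k ≠ 0 := by
  intro h
  have := limitMeasure_upperRect_univ G ρ k (zero_mem_EInterval γ)
  rw [h, gevTail_zero] at this
  simp at this

end limit

/-! ### First-coordinate laws over upper rectangles -/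

/-- The projection of a measure on the state space, restricted to a rectangle, to the first
coordinate. -/
noncomputable def sectionLaw {γ : ℝ} (μ : Measure (CEVSpace γ)) (y : ℝ) : Measure EReal :=
  (μ.restrict (upperRect γ univ y)).map Prod.fst

theorem sectionLaw_apply {γ : ℝ} (μ : Measure (CEVSpace γ)) (y : ℝ) {A : Set EReal}
    (hA : MeasurableSet A) : sectionLaw μ y A = μ (upperRect γ A y) := by
  rw [sectionLaw, Measure.map_apply measurable_fst hA, Measure.restrict_apply (measurable_fst hA)]
  congr 1
  ext p
  simp [upperRect]

theorem isFiniteMeasure_sectionLaw {γ : ℝ} (μ : Measure (CEVSpace γ)) [IsFiniteMeasureOnCompacts μ]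
    {y : ℝ} (hy : y ∈ EInterval γ) : IsFiniteMeasure (sectionLaw μ y) := by
  refine ⟨?_⟩
  rw [sectionLaw_apply μ y MeasurableSet.univ]
  exact (measure_mono fun p hp => le_of_lt hp.2).trans_lt (isCompact_upper hy).measure_lt_top

/-- If the mixture were carried by one real point and `±∞`, so would be its component at almost
every level `u`; but each component is an increasing affine image of `G`. -/
theorem nondegenerateOnReals_sectionLaw_limitMeasure {G : Measure EReal} [IsProbabilityMeasure G]
    (hG : NondegenerateOnReals G) {γ : ℝ} (ρ k : ℝ) {y : ℝ} (hy : y ∈ EInterval γ) :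
    NondegenerateOnReals (sectionLaw (limitMeasure G γ ρ k) y) := by
  rintro ⟨c, hc⟩
  have hm : MeasurableSet {z : EReal | z ≠ ⊥ ∧ z ≠ ⊤ ∧ z ≠ (c : EReal)} := by
    have : {z : EReal | z ≠ ⊥ ∧ z ≠ ⊤ ∧ z ≠ (c : EReal)} = {⊥, ⊤, (c : EReal)}ᶜ := by
      ext z; simp
    rw [this]
    exact (Set.toFinite _).measurableSet.compl
  rw [sectionLaw_apply _ _ hm, limitMeasure_upperRect G ρ k hm hy] at hc
  replace hc := (lintegral_eq_zero_iff (measurable_measure_prodMk_left (ν := G)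
    (measurable_ervAffine ρ k hm))).1 hc
  have hpos : (volume.restrict (Ioo 0 (gevTail γ y))) ≠ 0 := by
    rw [Ne, Measure.restrict_eq_zero, Real.volume_Ioo]
    simpa using gevTail_pos hy
  have : NeBot (ae (volume.restrict (Ioo 0 (gevTail γ y)))) := ae_neBot.2 hpos
  obtain ⟨u, hu, hu0⟩ := (hc.and (ae_restrict_mem measurableSet_Ioo)).exists
  refine hG ⟨(c - ervPsi ρ k u⁻¹) / u⁻¹ ^ ρ, ?_⟩
  refine Eq.trans (congrArg G ?_) hu
  ext z
  have hpos := ervAffine_coeff_pos (ρ := ρ) hu0.1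
  simp [ervAffine, affineEReal_eq_bot_iff hpos, affineEReal_eq_top_iff hpos,
    affineEReal_eq_coe_iff hpos, -EReal.coe_sub]

/-! ### Asymptotic invariance from extended regular variation -/

section kernel

variable {K : Kernel ℝ EReal} [IsMarkovKernel K] {α β bs : ℝ → ℝ} {G : Measure EReal}
  [IsProbabilityMeasure G] {ρ k : ℝ}

/-- Put `r = t / u`. The normalization at `t = r * u` is the one at `r` followed by the change of
type for the fixed factor `u`, so pointwise regular variation is enough here. -/
theorem IsERV.tendsto_kernel (hα : ∀ s, 0 < α s) (h : IsERV α β ρ k)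
    (hconv : ∀ᵐ x : ℝ, Tendsto (fun r => (K (bs r)).real (Iic ((α r * x + β r : ℝ) : EReal))) atTop
      (𝓝 (distFun G x))) {u x : ℝ} (hu : 0 < u)
    (hx : ContinuousAt (distFun G) (u ^ ρ * x + ervPsi ρ k u)) :
    Tendsto (fun t => (K (bs (t / u))).real (Iic ((α t * x + β t : ℝ) : EReal))) atTop
      (𝓝 (distFun G (u ^ ρ * x + ervPsi ρ k u))) := by
  have key := tendsto_apply_of_ae
    (f := fun r x => (K (bs r)).real (Iic ((α r * x + β r : ℝ) : EReal)))
    (fun r x y hxy => measureReal_mono (Iic_subset_Iic.2 (EReal.coe_le_coe_iff.2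
      (by have := (hα r).le; gcongr)))) hconv
    (((h.scale u hu).mul_const x).add (h.loc u hu)) hx
  have hdiv : Tendsto (fun t : ℝ => t / u) atTop atTop := tendsto_id.atTop_div_const hu
  refine (key.comp hdiv).congr fun t => ?_
  simp only [Function.comp_def, affine_comp_cocycle hα, div_mul_cancel₀ t hu.ne']

/-- Uniformity without measurability of `α, β`: at fixed levels `u` the kernels at `bs (t / u)`
converge, hence so do their mixtures over `(0, 1)`, and the scaling argument for mixtures applies.
-/
theorem asympInvariant_of_isERV (hα : ∀ s, 0 < α s) (hbs : ContinuousOn bs (Ioi 0))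
    (hG : NondegenerateOnReals G) (h : IsERV α β ρ k)
    (hconv : ∀ᵐ x : ℝ, Tendsto (fun r => (K (bs r)).real (Iic ((α r * x + β r : ℝ) : EReal))) atTop
      (𝓝 (distFun G x))) : AsympInvariant α β := by
  classical
  have hmbs : Measurable ((Ioi (0 : ℝ)).piecewise bs 0) :=
    hbs.measurable_piecewise continuousOn_const measurableSet_Ioi
  -- The choice `γ = 0`, `y = 0` is only a device: there `gevTail` is `1`, so the section law of
  -- `limitMeasure` is the wanted mixture over `(0, 1)`, already known to be nondegenerate.
  have h0 := zero_mem_EInterval 0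
  have hfin := isFiniteMeasureOnCompacts_limitMeasure G (γ := 0) ρ k
  have := isFiniteMeasure_sectionLaw (limitMeasure G 0 ρ k) h0
  refine asympInvariant_of_tendsto_integral
    (H := fun p x => (K ((Ioi (0 : ℝ)).piecewise bs 0 p⁻¹)).real (Iic (x : EReal)))
    (fun p x y hxy => measureReal_mono (Iic_subset_Iic.2 (EReal.coe_le_coe_iff.2 hxy)))
    (fun p x => measureReal_nonneg) (fun p x => measureReal_le_one) (fun x => ?_) hα one_pos
    (m := distFun (sectionLaw (limitMeasure G 0 ρ k) 0))
    (nondegenerateOnReals_sectionLaw_limitMeasure hG ρ k h0).nondegenerateFun ?_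
  · exact ((K.measurable_coe measurableSet_Iic).comp (hmbs.comp measurable_inv)).ennreal_toReal
  have hψ := measurable_ervPsi ρ k
  -- By Fubini: for each `u` only countably many `x` hit a discontinuity of `G`.
  have hae : ∀ᵐ x : ℝ, ∀ᵐ u ∂(volume.restrict (Ioo (0 : ℝ) 1)),
      ContinuousAt (distFun G) (u ^ ρ * x + ervPsi ρ k u) := by
    rw [Measure.ae_ae_comm]
    · refine (ae_restrict_iff' measurableSet_Ioo).2 (Eventually.of_forall fun u hu => ?_)
      exact (distFun G).mono.ae_continuousAt_affine (Real.rpow_pos_of_pos hu.1 ρ).ne' _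
    · have hms : MeasurableSet {x | ContinuousAt (distFun G) x} := by
        rw [← compl_compl {x | ContinuousAt (distFun G) x}]
        exact ((distFun G).mono.countable_not_continuousAt).measurableSet.compl
      exact measurableSet_preimage (t := {x | ContinuousAt (distFun G) x})
        (f := fun p : ℝ × ℝ => p.2 ^ ρ * p.1 + ervPsi ρ k p.2) (by fun_prop) hms
  filter_upwards [hae] with x hx
  have hval : distFun (sectionLaw (limitMeasure G 0 ρ k) 0) x =
      ∫ u in (0 : ℝ)..1, distFun G (u ^ ρ * x + ervPsi ρ k u) := by
    rw [distFun_apply, measureReal_def, sectionLaw_apply _ _ measurableSet_Iic,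
      limitMeasure_upperRect_Iic G ρ k x h0, limitMass, gevTail_zero,
      intervalIntegral.integral_of_le zero_le_one, integral_Ioc_eq_integral_Ioo]
    simp only [distFun_apply, measureReal_def]
    rw [integral_toReal]
    · have : Monotone fun x : ℝ => G (Iic (x : EReal)) := fun x y hxy =>
        measure_mono (Iic_subset_Iic.2 (EReal.coe_le_coe_iff.2 hxy))
      exact (this.measurable.comp (by fun_prop :
        Measurable fun u => u ^ ρ * x + ervPsi ρ k u)).aemeasurable
    · exact Eventually.of_forall fun u => measure_lt_top _ _
  rw [hval]
  refine intervalIntegral.tendsto_integral_filter_of_dominated_convergence (fun _ => 1) ?_ ?_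
    intervalIntegrable_const ?_
  · refine Eventually.of_forall fun t => Measurable.aestronglyMeasurable ?_
    exact ((K.measurable_coe measurableSet_Iic).comp
      (hmbs.comp (measurable_id.div_const t).inv)).ennreal_toReal
  · refine Eventually.of_forall fun t => Eventually.of_forall fun u _ => ?_
    rw [Real.norm_of_nonneg measureReal_nonneg]
    exact measureReal_le_one
  · rw [uIoc_of_le zero_le_one]
    have hx' := (ae_restrict_iff' measurableSet_Ioo).1 hx
    filter_upwards [hx', (measure_singleton (1 : ℝ) : volume {(1 : ℝ)} = 0) |>
      (compl_mem_ae_iff.2 ·)] with u hu hu1 hmem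
    have hu' := hu ⟨hmem.1, lt_of_le_of_ne hmem.2 hu1⟩
    refine (h.tendsto_kernel hα hconv hmem.1 hu').congr' ?_
    filter_upwards [eventually_gt_atTop 0] with t ht
    rw [inv_div, piecewise_eq_of_mem _ _ _ (mem_Ioi.2 (div_pos ht hmem.1))]

end kernel

/-! ### Vague convergence under extended regular variation -/

/-- Compactness of `[-∞, ∞]` upgrades joint continuity at the limiting parameters to closeness
uniform in `z`; weak convergence is then needed only for one fixed continuous function. -/
theorem tendsto_integral_affineEReal {ι : Type*} {l : Filter ι} {κ : ι → ProbabilityMeasure EReal}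
    {G : ProbabilityMeasure EReal} (hκ : Tendsto κ l (𝓝 G)) {A B y : ι → ℝ} {a b c : ℝ}
    (ha : 0 < a) (hA : Tendsto A l (𝓝 a)) (hB : Tendsto B l (𝓝 b)) (hy : Tendsto y l (𝓝 c))
    {f : EReal × EReal → ℝ} (hf : Measurable f) {C : ℝ} (hC : ∀ p, |f p| ≤ C)
    (hcont : ∀ z : EReal, ContinuousAt f (z, (c : EReal))) :
    Tendsto (fun i => ∫ z, f (affineEReal (A i) (B i) z, (y i : EReal)) ∂(κ i : Measure EReal)) l
      (𝓝 (∫ z, f (affineEReal a b z, (c : EReal)) ∂(G : Measure EReal))) := by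
  have hjoint : ∀ z : EReal, ContinuousAt
      (fun p : (ℝ × ℝ × ℝ) × EReal => f (affineEReal p.1.1 p.1.2.1 p.2, (p.1.2.2 : EReal)))
      ((a, b, c), z) := by
    intro z
    refine ContinuousAt.comp (g := f)
      (f := fun p : (ℝ × ℝ × ℝ) × EReal => (affineEReal p.1.1 p.1.2.1 p.2, (p.1.2.2 : EReal)))
      (hcont _) (ContinuousAt.prodMk ?_ ?_)
    · exact ContinuousAt.comp (g := fun p : (ℝ × ℝ) × EReal => affineEReal p.1.1 p.1.2 p.2)
        (f := fun p : (ℝ × ℝ × ℝ) × EReal => ((p.1.1, p.1.2.1), p.2))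
        (continuousAt_affineEReal ha b z) (by fun_prop)
    · have := continuous_coe_real_ereal
      fun_prop
  have hg : Continuous fun z : EReal => f (affineEReal a b z, (c : EReal)) :=
    continuous_iff_continuousAt.2 fun z => ContinuousAt.comp (x := z)
      (g := fun p : (ℝ × ℝ × ℝ) × EReal => f (affineEReal p.1.1 p.1.2.1 p.2, (p.1.2.2 : EReal)))
      (f := fun z : EReal => ((a, b, c), z)) (hjoint z) (by fun_prop)
  have hlim := (ProbabilityMeasure.tendsto_iff_forall_integral_tendsto.1 hκ)
    (BoundedContinuousFunction.mkOfCompact ⟨_, hg⟩)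
  simp only [BoundedContinuousFunction.mkOfCompact_apply, ContinuousMap.coe_mk] at hlim
  have hdiff : Tendsto (fun i =>
      ∫ z, f (affineEReal (A i) (B i) z, (y i : EReal)) ∂(κ i : Measure EReal) -
        ∫ z, f (affineEReal a b z, (c : EReal)) ∂(κ i : Measure EReal)) l (𝓝 0) := by
    rw [Metric.tendsto_nhds]
    intro ε hε
    have htube : ∀ᶠ p : ℝ × ℝ × ℝ in 𝓝 (a, b, c), ∀ z ∈ (univ : Set EReal),
        |f (affineEReal p.1 p.2.1 z, (p.2.2 : EReal)) - f (affineEReal a b z, (c : EReal))|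
          < ε / 2 := by
      refine isCompact_univ.eventually_forall_of_forall_eventually fun z _ => ?_
      have h2 : ContinuousAt (fun p : (ℝ × ℝ × ℝ) × EReal =>
          f (affineEReal p.1.1 p.1.2.1 p.2, (p.1.2.2 : EReal)) -
            f (affineEReal a b p.2, (c : EReal))) ((a, b, c), z) :=
        (hjoint z).sub (hg.continuousAt.comp (f := Prod.snd) continuousAt_snd)
      have h3 := h2.abs
      simp only [ContinuousAt, sub_self, abs_zero] at h3
      exact h3.eventually (gt_mem_nhds (half_pos hε))
    filter_upwards [(hA.prodMk_nhds (hB.prodMk_nhds hy)).eventually htube] with i hi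
    have hint : ∀ a b c, Integrable (fun z => f (affineEReal a b z, ((c : ℝ) : EReal)))
        (κ i : Measure EReal) := fun a b c => by
      refine Integrable.of_bound (Measurable.aestronglyMeasurable ?_) C
        (Eventually.of_forall fun z => hC _)
      exact hf.comp ((Measurable.affineEReal measurable_const measurable_const measurable_id).prodMk
        measurable_const)
    rw [dist_zero_right, ← integral_sub (hint _ _ _) (hint _ _ _)]
    refine lt_of_le_of_lt (norm_integral_le_of_norm_le_const (C := ε / 2)
      (Eventually.of_forall fun z => (hi z trivial).le)) ?_
    simp only [probReal_univ, mul_one]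
    linarith
  simpa using hdiff.add hlim

/-- The extension by zero of a function on the state space. -/
noncomputable def extendZero {γ : ℝ} (f : CEVSpace γ → ℝ) : EReal × EReal → ℝ :=
  Function.extend (cevInclusion γ) f 0

section extendZero

variable {γ : ℝ} (f : CompactlySupportedContinuousMap (CEVSpace γ) ℝ)

theorem extendZero_cevInclusion (p : CEVSpace γ) : extendZero f (cevInclusion γ p) = f p :=
  (isEmbedding_cevInclusion γ).injective.extend_apply _ _ _

theorem extendZero_of_notMem {p : EReal × EReal} (hp : p.2 ∉ EIntervalRightClosed γ) :
    extendZero f p = 0 := by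
  refine Function.extend_apply' _ _ _ ?_
  rintro ⟨q, rfl⟩
  exact hp q.2.2

theorem measurable_extendZero : Measurable (extendZero f) :=
  (measurableEmbedding_cevInclusion γ).measurable_extend f.continuous.measurable measurable_const

theorem exists_bound_extendZero : ∃ C, ∀ p, |extendZero f p| ≤ C := by
  obtain ⟨C, hC⟩ := f.hasCompactSupport.exists_bound_of_continuous f.continuous
  refine ⟨max C 0, fun p => ?_⟩
  by_cases hp : ∃ q, cevInclusion γ q = p
  · obtain ⟨q, rfl⟩ := hp
    rw [extendZero_cevInclusion]
    exact (hC q).trans (le_max_left _ _)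
  · rw [extendZero, Function.extend_apply' _ _ _ hp]
    simp

theorem exists_lower_bound_extendZero :
    ∃ y ∈ EInterval γ, ∀ p, extendZero f p ≠ 0 → (y : EReal) < p.2 := by
  obtain ⟨y, hy, hlt⟩ := exists_lower_bound_of_isCompact f.hasCompactSupport.isCompact
  refine ⟨y, hy, fun p hp => ?_⟩
  by_cases hq : ∃ q, cevInclusion γ q = p
  · obtain ⟨q, rfl⟩ := hq
    rw [extendZero_cevInclusion] at hp
    exact hlt q (subset_tsupport _ hp)
  · exact (hp (Function.extend_apply' _ _ _ hq)).elim

/-- Only heights in the open interval are claimed: for `γ < 0` the extension may jump at the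
included right endpoint. The limits `gevQuantile γ u` never reach it. -/
theorem continuousAt_extendZero (z : EReal) {y : ℝ} (hy : y ∈ EInterval γ) :
    ContinuousAt (extendZero f) (z, (y : EReal)) := by
  let p : CEVSpace γ := (z, ⟨y, coe_mem_EIntervalRightClosed hy⟩)
  have hnhds : range (cevInclusion γ) ∈ 𝓝 (cevInclusion γ p) := by
    rw [range_cevInclusion]
    refine prod_mem_nhds univ_mem ?_
    exact mem_of_superset (Ioo_mem_nhds (mem_EInterval_iff.1 hy).1 (mem_EInterval_iff.1 hy).2)
      Ioo_subset_Ioc_self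
  have hmap := (isEmbedding_cevInclusion γ).map_nhds_of_mem p hnhds
  have h : Tendsto (extendZero f) (𝓝 (cevInclusion γ p)) (𝓝 (extendZero f (cevInclusion γ p))) := by
    rw [← hmap, tendsto_map'_iff, extendZero_cevInclusion]
    exact (f.continuous.tendsto p).congr fun q => (extendZero_cevInclusion f q).symm
  exact h

theorem integral_comap_eq_extendZero (ν : Measure (EReal × EReal)) :
    ∫ p, f p ∂(ν.comap (cevInclusion γ)) = ∫ p, extendZero f p ∂ν := by
  rw [← integral_comap_cevInclusion ν fun p => extendZero_of_notMem f]
  simp only [extendZero_cevInclusion]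

theorem integral_limitMeasure (G : Measure EReal) [IsProbabilityMeasure G] (ρ k : ℝ) :
    ∫ p, f p ∂(limitMeasure G γ ρ k) =
      ∫ u in Ioi 0, ∫ z, extendZero f (ervAffine ρ k u z, ((gevQuantile γ u : ℝ) : EReal)) ∂G := by
  obtain ⟨C, hC⟩ := exists_bound_extendZero f
  obtain ⟨y, hy, hlow⟩ := exists_lower_bound_extendZero f
  have hm := (measurable_extendZero f).comp (measurable_limitLaw_map γ ρ k)
  rw [limitMeasure, integral_comap_eq_extendZero, limitLaw,
    integral_map (measurable_limitLaw_map γ ρ k).aemeasurable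
      (measurable_extendZero f).aestronglyMeasurable, integral_prod]
  set S : Set (ℝ × EReal) := Iio (gevTail γ y) ×ˢ univ
  have hS : MeasurableSet S := measurableSet_Iio.prod MeasurableSet.univ
  have hSfin : ((volume.restrict (Ioi (0 : ℝ))).prod G) S < ⊤ := by
    rw [Measure.prod_prod, Measure.restrict_apply measurableSet_Iio, inter_comm, Ioi_inter_Iio]
    simp
  have hon : IntegrableOn (fun p : ℝ × EReal =>
      extendZero f (ervAffine ρ k p.1 p.2, ((gevQuantile γ p.1 : ℝ) : EReal))) S
      ((volume.restrict (Ioi (0 : ℝ))).prod G) :=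
    Measure.integrableOn_of_bounded (M := C) hSfin.ne hm.aestronglyMeasurable
      (Eventually.of_forall fun p => hC _)
  have hae : ∀ᵐ p ∂((volume.restrict (Ioi (0 : ℝ))).prod G), p.1 ∈ Ioi (0 : ℝ) := by
    rw [Measure.ae_prod_iff_ae_ae (measurable_fst measurableSet_Ioi)]
    filter_upwards [ae_restrict_mem measurableSet_Ioi] with u hu
    exact Eventually.of_forall fun _ => hu
  refine (integrable_indicator_iff hS).2 hon |>.congr ?_
  filter_upwards [hae] with p hp
  by_cases hpS : p ∈ S
  · rw [indicator_of_mem hpS]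
  · rw [indicator_of_notMem hpS]
    by_contra hne
    have h1 := hlow _ (Ne.symm hne)
    exact hpS ⟨(lt_gevQuantile_iff hp hy).1 (EReal.coe_lt_coe_iff.1 h1), trivial⟩

end extendZero

section vague

variable {Ω : Type*} [MeasurableSpace Ω] {P : Measure Ω} {X Y : Ω → ℝ}
  {F : Measure ℝ} [IsProbabilityMeasure F] {K : Kernel ℝ EReal} [IsMarkovKernel K]
  {α β bs : ℝ → ℝ} {G : Measure EReal} [IsProbabilityMeasure G] {ρ k γ : ℝ} {a b : ℝ → ℝ}

theorem measurable_integral_kernel_upperQuantile (F : Measure ℝ) [IsProbabilityMeasure F]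
    (K : Kernel ℝ EReal) [IsMarkovKernel K] (t : ℝ) {h : ℝ × EReal → ℝ} (hh : Measurable h) :
    Measurable fun u => ∫ z, h (upperQuantile F (u / t), z) ∂K (upperQuantile F (u / t)) := by
  have h1 : StronglyMeasurable fun y => ∫ z, h (y, z) ∂K y :=
    hh.stronglyMeasurable.integral_kernel_prod_right'
  exact h1.measurable.comp (measurable_upperQuantile_div F t)

/-- Along the quantile at a fixed level, the normalized kernel converges weakly. -/
theorem tendsto_integral_kernel_upperQuantile (hα : ∀ s, 0 < α s)
    (ha : ∀ t, 0 < t → 0 < a t) (hdoa : InDomainOfAttraction F γ a b)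
    (hbs : ContinuousOn bs (Ioi 0)) (hinj : InjOn bs (Ioi 0))
    (htail : Tendsto (fun t => t * F.real (Ioi (bs t))) atTop (𝓝 1))
    (hconv : ∀ᵐ x : ℝ, Tendsto (fun r => (K (bs r)).real (Iic ((α r * x + β r : ℝ) : EReal))) atTop
      (𝓝 (distFun G x)))
    (h : IsERV α β ρ k) (hinv : AsympInvariant α β)
    (f : CompactlySupportedContinuousMap (CEVSpace γ) ℝ) {u : ℝ} (hu : 0 < u) :
    Tendsto (fun t => ∫ z, extendZero f (affineEReal (1 / α t) (-β t / α t) z,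
        (((upperQuantile F (u / t) - b t) / a t : ℝ) : EReal)) ∂K (upperQuantile F (u / t))) atTop
      (𝓝 (∫ z, extendZero f (ervAffine ρ k u z, ((gevQuantile γ u : ℝ) : EReal)) ∂G)) := by
  obtain ⟨w, hw, hwq⟩ := exists_upperQuantile_eq hbs hinj htail hu
  have hu' : 0 < u⁻¹ := inv_pos.2 hu
  have htw : Tendsto (fun t => t * w t) atTop atTop := tendsto_id.atTop_mul_pos hu' hw
  obtain ⟨hA, hB⟩ := h.tendsto_prod hα hinv hu'
  have hpair : Tendsto (fun t => (t, w t)) atTop (atTop ×ˢ 𝓝 u⁻¹) := tendsto_id.prodMk hw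
  have hmeas : ∀ t, Measurable (affineEReal (1 / α (t * w t)) (-β (t * w t) / α (t * w t))) :=
    fun t => Measurable.affineEReal measurable_const measurable_const measurable_id
  -- The kernel at the quantile, normalized at its own time `t * w t`, tends weakly to `G`. The
  -- remaining change from `t * w t` to `t` converges by locally uniform regular variation.
  let κ : ℝ → ProbabilityMeasure EReal := fun t =>
    ⟨(K (bs (t * w t))).map (affineEReal (1 / α (t * w t)) (-β (t * w t) / α (t * w t))),
      Measure.isProbabilityMeasure_map (hmeas t).aemeasurable⟩
  have hκ : Tendsto κ atTop (𝓝 ⟨G, inferInstance⟩) := by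
    refine tendsto_probabilityMeasure_of_distFun ?_
    filter_upwards [hconv] with x hx
    refine (hx.comp htw).congr fun t => ?_
    have hpos := hα (t * w t)
    simp only [Function.comp_def, κ, distFun_apply, ProbabilityMeasure.coe_mk]
    rw [map_measureReal_apply (hmeas t) measurableSet_Iic]
    congr 1
    ext z
    rw [mem_preimage, mem_Iic, mem_Iic, affineEReal_le_coe_iff (by positivity)]
    have : (x - -β (t * w t) / α (t * w t)) / (1 / α (t * w t)) =
        α (t * w t) * x + β (t * w t) := by
      field_simp; ring
    rw [this]
  obtain ⟨C, hC⟩ := exists_bound_extendZero f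
  have key := tendsto_integral_affineEReal hκ (ervAffine_coeff_pos hu) (hA.comp hpair)
    (hB.comp hpair) (hdoa.tendsto_upperQuantile ha hu) (measurable_extendZero f) hC
    fun z => continuousAt_extendZero f z (gevQuantile_mem hu)
  refine key.congr' ?_
  filter_upwards [hwq] with t ht
  simp only [κ, ProbabilityMeasure.coe_mk, Function.comp_def]
  rw [integral_map (hmeas t).aemeasurable, ht]
  · congr 1
    ext z
    have h1 := hα (t * w t)
    have h2 := hα t
    rw [affineEReal_comp (by positivity) (by positivity)]
    congr 3
    · field_simp
    · field_simp; ring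
  · refine Measurable.aestronglyMeasurable ((measurable_extendZero f).comp ?_)
    exact (Measurable.affineEReal measurable_const measurable_const measurable_id).prodMk
      measurable_const

/-- Dominated convergence over levels: a test function is bounded and vanishes at heights up to some
`y` in the interval, which bounds the relevant levels. -/
theorem vagueTendsto_scaledLaw (hX : Measurable X) (hY : Measurable Y)
    (hK : P.map (fun ω => (Y ω, (X ω : EReal))) = F.compProd K)
    (hα : ∀ s, 0 < α s) (ha : ∀ t, 0 < t → 0 < a t) (hdoa : InDomainOfAttraction F γ a b)
    (hbs : ContinuousOn bs (Ioi 0)) (hinj : InjOn bs (Ioi 0))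
    (htail : Tendsto (fun t => t * F.real (Ioi (bs t))) atTop (𝓝 1))
    (hG : NondegenerateOnReals G)
    (hconv : ∀ᵐ x : ℝ, Tendsto (fun r => (K (bs r)).real (Iic ((α r * x + β r : ℝ) : EReal))) atTop
      (𝓝 (distFun G x)))
    (h : IsERV α β ρ k) :
    VagueTendsto (scaledLaw P X Y γ α β a b) atTop (limitMeasure G γ ρ k) := by
  intro f
  have hinv := asympInvariant_of_isERV hα hbs hG h hconv
  obtain ⟨C, hC⟩ := exists_bound_extendZero f
  obtain ⟨y, hy, hlow⟩ := exists_lower_bound_extendZero f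
  rw [integral_limitMeasure]
  have key := tendsto_setIntegral_Ioo (C := C) (M := gevTail γ y + 1)
    (g := fun t u => ∫ z, extendZero f (affineEReal (1 / α t) (-β t / α t) z,
        (((upperQuantile F (u / t) - b t) / a t : ℝ) : EReal)) ∂K (upperQuantile F (u / t)))
    (fun t => measurable_integral_kernel_upperQuantile F K t
      (h := fun q => extendZero f (affineEReal (1 / α t) (-β t / α t) q.2,
        (((q.1 - b t) / a t : ℝ) : EReal)))
      ((measurable_extendZero f).comp ((Measurable.affineEReal measurable_const measurable_const
        measurable_snd).prodMk ((measurable_fst.sub_const _).div_const _).coe_real_ereal)))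
    ?_ fun u hu => tendsto_integral_kernel_upperQuantile hα ha hdoa hbs hinj htail hconv h hinv f hu
  · refine key.congr' ?_
    filter_upwards [eventually_gt_atTop 0] with t ht
    rw [← integral_scaledLaw F K hX hY hK ht (hα t) (measurable_extendZero f) hC
      fun p => extendZero_of_notMem f]
    simp only [extendZero_cevInclusion]
  · filter_upwards [hdoa.eventually_level_le ha hy] with t ht u hu
    refine ⟨?_, fun hM => ?_⟩
    · rw [← Real.norm_eq_abs]
      refine (norm_integral_le_of_norm_le_const (C := C) ?_).trans (by simp)
      exact Eventually.of_forall fun z => hC _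
    · refine integral_eq_zero_of_ae (Eventually.of_forall fun z => ?_)
      by_contra hne
      exact absurd (ht u hu (EReal.coe_lt_coe_iff.1 (hlow _ hne))) (not_le.2 hM)

end vague

theorem VagueTendsto.unique {E : Type*} [TopologicalSpace E] [MeasurableSpace E] [BorelSpace E]
    [T2Space E] [LocallyCompactSpace E] [SigmaCompactSpace E]
    [TopologicalSpace.PseudoMetrizableSpace E] {ν : ℝ → Measure E}
    {l : Filter ℝ} [NeBot l] {μ μ' : Measure E} [IsFiniteMeasureOnCompacts μ]
    [IsFiniteMeasureOnCompacts μ'] (h : VagueTendsto ν l μ) (h' : VagueTendsto ν l μ') : μ = μ' :=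
  Measure.ext_of_integral_eq_on_compactlySupported fun f => tendsto_nhds_unique (h f) (h' f)

/-! ### Continuity of the limit -/

theorem continuousAt_limitMass {G : Measure EReal} [IsProbabilityMeasure G] {γ ρ k : ℝ}
    (hρk : (ρ, k) ≠ (0, 0)) {x y : ℝ} (hy : y ∈ EInterval γ)
    (hx : ¬ (ρ ≠ 0 ∧ x = -k / ρ ∧ G {(x : EReal)} ≠ 0)) :
    ContinuousAt (fun p : ℝ × ℝ => limitMass G γ ρ k p.1 p.2) (x, y) := by
  have hatom : ∀ᵐ u ∂(volume.restrict (Ioi (0 : ℝ))),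
      G {((u ^ ρ * x + ervPsi ρ k u : ℝ) : EReal)} = 0 := by
    -- The point `-k / ρ` is fixed by all the limiting affine maps, so an atom of `G` there would be
    -- met at every level. Any other `x` has an injective orbit in `u`, which meets the countably
    -- many atoms at only countably many levels.
    by_cases hfix : ρ ≠ 0 ∧ x = -k / ρ
    · have hx0 : G {(x : EReal)} = 0 := by
        by_contra h0
        exact hx ⟨hfix.1, hfix.2, h0⟩
      refine (ae_restrict_iff' measurableSet_Ioi).2 (Eventually.of_forall fun u hu => ?_)
      have : u ^ ρ * x + ervPsi ρ k u = x := by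
        have := hfix.1
        simp only [ervPsi, this, if_false]
        rw [hfix.2]
        field_simp
        ring
      rwa [this]
    · have hinj : InjOn (fun u : ℝ => u ^ ρ * x + ervPsi ρ k u) (Ioi 0) := by
        intro u hu v hv huv
        by_cases h0 : ρ = 0
        · have hk : k ≠ 0 := fun hk => hρk (by rw [h0, hk])
          simp only [ervPsi, h0, if_true, Real.rpow_zero, one_mul, add_right_inj] at huv
          exact Real.log_injOn_pos hu hv (mul_left_cancel₀ hk huv)
        · have hne : x + k / ρ ≠ 0 := fun h => hfix ⟨h0, by rw [neg_div]; linarith⟩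
          simp only [ervPsi, h0, if_false] at huv
          have : u ^ ρ * (x + k / ρ) = v ^ ρ * (x + k / ρ) := by
            rw [div_eq_mul_inv]; linarith
          exact (Real.rpow_left_inj (le_of_lt hu) (le_of_lt hv) h0).1 (mul_right_cancel₀ hne this)
      rw [ae_restrict_iff' measurableSet_Ioi]
      have hcount : ({u | u ∈ Ioi (0 : ℝ) ∧ G {((u ^ ρ * x + ervPsi ρ k u : ℝ) : EReal)} ≠ 0}).Countable :=
        MapsTo.countable_of_injOn (f := fun u : ℝ => u ^ ρ * x + ervPsi ρ k u)
          (t := {x : ℝ | G {(x : EReal)} ≠ 0}) (fun u hu => hu.2)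
          (hinj.mono fun u hu => hu.1) (countable_atoms G)
      refine measure_mono_null (fun u hu => ?_) (hcount.measure_zero volume)
      simpa [and_comm] using hu
  have heq : ∀ x' y' : ℝ, limitMass G γ ρ k x' y' = ∫⁻ u in Ioi (0 : ℝ),
      (Iio (gevTail γ y')).indicator
        (fun u => G (Iic ((u ^ ρ * x' + ervPsi ρ k u : ℝ) : EReal))) u := by
    intro x' y'
    rw [lintegral_indicator measurableSet_Iio, Measure.restrict_restrict measurableSet_Iio,
      inter_comm, Ioi_inter_Iio, limitMass]
  have hmono : Monotone fun x : ℝ => G (Iic (x : EReal)) := fun x y hxy =>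
    measure_mono (Iic_subset_Iic.2 (EReal.coe_le_coe_iff.2 hxy))
  have hψ := measurable_ervPsi ρ k
  have hgev : Tendsto (fun p : ℝ × ℝ => gevTail γ p.2) (𝓝 (x, y)) (𝓝 (gevTail γ y)) :=
    (continuousAt_gevTail hy).tendsto.comp continuousAt_snd
  simp only [ContinuousAt, heq]
  refine tendsto_lintegral_filter_of_dominated_convergence
    ((Iio (gevTail γ y + 1)).indicator fun _ => 1) ?_ ?_ ?_ ?_
  · refine Eventually.of_forall fun p => Measurable.indicator ?_ measurableSet_Iio
    exact hmono.measurable.comp (by fun_prop : Measurable fun u => u ^ ρ * p.1 + ervPsi ρ k u)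
  · filter_upwards [hgev.eventually (gt_mem_nhds (lt_add_one _))] with p hp
    refine Eventually.of_forall fun u => ?_
    by_cases hu : u < gevTail γ p.2
    · simp only [indicator, mem_Iio, hu, hu.trans hp, if_true]
      exact prob_le_one
    · simp [indicator, hu]
  · rw [lintegral_indicator measurableSet_Iio, Measure.restrict_restrict measurableSet_Iio,
      inter_comm, Ioi_inter_Iio]
    simp
  · filter_upwards [hatom, compl_mem_ae_iff.2 (measure_singleton (gevTail γ y))] with u hu hne
    rcases lt_or_gt_of_ne (show u ≠ gevTail γ y from hne) with hlt | hgt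
    · have h1 : ∀ᶠ p : ℝ × ℝ in 𝓝 (x, y), u < gevTail γ p.2 := hgev.eventually (lt_mem_nhds hlt)
      have hc : Tendsto (fun p : ℝ × ℝ => G (Iic ((u ^ ρ * p.1 + ervPsi ρ k u : ℝ) : EReal)))
          (𝓝 (x, y)) (𝓝 (G (Iic ((u ^ ρ * x + ervPsi ρ k u : ℝ) : EReal)))) := by
        rw [← ENNReal.tendsto_toReal_iff (fun _ => measure_ne_top _ _) (measure_ne_top _ _)]
        refine Tendsto.comp (g := distFun G) (f := fun p : ℝ × ℝ => u ^ ρ * p.1 + ervPsi ρ k u)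
          (continuousAt_distFun G hu) ?_
        exact Continuous.tendsto (by fun_prop :
          Continuous fun p : ℝ × ℝ => u ^ ρ * p.1 + ervPsi ρ k u) (x, y)
      simp only [indicator, mem_Iio, hlt, if_true]
      refine hc.congr' ?_
      filter_upwards [h1] with p hp
      simp [hp]
    · have h1 : ∀ᶠ p : ℝ × ℝ in 𝓝 (x, y), gevTail γ p.2 < u := hgev.eventually (gt_mem_nhds hgt)
      simp only [indicator, mem_Iio, hgt.not_gt, if_false]
      refine tendsto_const_nhds.congr' ?_
      filter_upwards [h1] with p hp
      simp [hp.not_gt]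

/-! ### Extended regular variation from vague convergence -/

/-- The piecewise linear function on `[-∞, ∞]` that is `0` below `a` and `1` above `b`. -/
noncomputable def ramp (a b : ℝ) (z : EReal) : ℝ :=
  ((max (a : EReal) (min b z)).toReal - a) / (b - a)

section ramp

variable {a b : ℝ}

theorem ramp_aux (hab : a ≤ b) (z : EReal) : max (a : EReal) (min b z) ≠ ⊥ ∧
    max (a : EReal) (min b z) ≠ ⊤ := by
  constructor
  · exact ((EReal.bot_lt_coe a).trans_le (le_max_left _ _)).ne'
  · exact ((max_le (EReal.coe_le_coe_iff.2 hab) (min_le_left _ _)).trans_lt (EReal.coe_lt_top b)).ne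

theorem continuous_ramp (hab : a ≤ b) : Continuous (ramp a b) := by
  have h : Continuous fun z : EReal => (max (a : EReal) (min b z)).toReal :=
    EReal.continuousOn_toReal.comp_continuous (by fun_prop) fun z => by
      simp [ramp_aux hab z]
  exact (h.sub continuous_const).div_const _

theorem ramp_nonneg (hab : a ≤ b) (z : EReal) : 0 ≤ ramp a b z := by
  refine div_nonneg (sub_nonneg.2 ?_) (sub_nonneg.2 hab)
  rw [← EReal.coe_le_coe_iff, EReal.coe_toReal (ramp_aux hab z).2 (ramp_aux hab z).1]
  exact le_max_left _ _

theorem ramp_le_one (hab : a ≤ b) (z : EReal) : ramp a b z ≤ 1 := by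
  refine div_le_one_of_le₀ (sub_le_sub_right ?_ _) (sub_nonneg.2 hab)
  rw [← EReal.coe_le_coe_iff, EReal.coe_toReal (ramp_aux hab z).2 (ramp_aux hab z).1]
  exact max_le (EReal.coe_le_coe_iff.2 hab) (min_le_left _ _)

theorem ramp_of_le {z : EReal} (hz : z ≤ a) : ramp a b z = 0 := by
  rw [ramp, max_eq_left ((min_le_right _ _).trans hz)]
  simp

theorem ramp_of_ge (hab : a < b) {z : EReal} (hz : (b : EReal) ≤ z) : ramp a b z = 1 := by
  rw [ramp, min_eq_left hz, max_eq_right (EReal.coe_le_coe_iff.2 hab.le), EReal.toReal_coe,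
    div_self (sub_pos.2 hab).ne']

theorem tendsto_ramp (a : ℝ) (z : EReal) :
    Tendsto (fun n : ℕ => ramp a (a + 1 / ((n : ℝ) + 1)) z) atTop
      (𝓝 ((Ioi (a : EReal)).indicator (fun _ => 1) z)) := by
  rcases le_or_gt z (a : EReal) with h | h
  · simp [ramp_of_le h, h.not_gt]
  · obtain ⟨c, hc, hcz⟩ := EReal.lt_iff_exists_real_btwn.1 h
    rw [EReal.coe_lt_coe_iff] at hc
    have hlim : Tendsto (fun n : ℕ => a + 1 / ((n : ℝ) + 1)) atTop (𝓝 a) := by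
      simpa using (tendsto_one_div_add_atTop_nhds_zero_nat (𝕜 := ℝ)).const_add a
    simp only [indicator, mem_Ioi, h, if_true]
    refine tendsto_const_nhds.congr' ?_
    filter_upwards [hlim.eventually (gt_mem_nhds hc)] with n hn
    rw [ramp_of_ge (lt_add_of_pos_right _ (by positivity))]
    exact (EReal.coe_le_coe_iff.2 hn.le).trans hcz.le

end ramp

section forward

variable {Ω : Type*} [MeasurableSpace Ω] {P : Measure Ω} {X Y : Ω → ℝ}
  {F : Measure ℝ} [IsProbabilityMeasure F] {K : Kernel ℝ EReal} [IsMarkovKernel K]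
  {α β : ℝ → ℝ} {γ : ℝ} {a b : ℝ → ℝ} {μ : Measure (CEVSpace γ)}

/-- The product of a continuous function of the first coordinate and a ramp in the second. -/
noncomputable def rampTest {γ y : ℝ} (hy : y ∈ EInterval γ) {y' : ℝ} (hyy : y ≤ y')
    {h : EReal → ℝ} (hh : Continuous h) : CompactlySupportedContinuousMap (CEVSpace γ) ℝ where
  toFun p := h p.1 * ramp y y' p.2
  continuous_toFun := by
    have := continuous_ramp hyy
    fun_prop
  hasCompactSupport' := by
    refine HasCompactSupport.of_support_subset_isCompact (isCompact_upper hy) fun p hp => ?_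
    by_contra hlt
    exact hp (by simp only [ramp_of_le (le_of_lt (not_le.1 hlt)), mul_zero])

/-- Under vague convergence, the normalized mixtures of the kernel over quantile levels converge
when integrated against a continuous function. -/
theorem tendsto_integral_mixture (hX : Measurable X) (hY : Measurable Y)
    (hK : P.map (fun ω => (Y ω, (X ω : EReal))) = F.compProd K)
    (hα : ∀ s, 0 < α s) (ha : ∀ t, 0 < t → 0 < a t) (hdoa : InDomainOfAttraction F γ a b)
    [IsFiniteMeasureOnCompacts μ]
    (hμ : VagueTendsto (scaledLaw P X Y γ α β a b) atTop μ) {U : ℝ} (hU : 0 < U)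
    {h : EReal → ℝ} (hh : Continuous h) (h0 : ∀ z, 0 ≤ h z) (h1 : ∀ z, h z ≤ 1) :
    Tendsto (fun t => ∫ u in Ioo 0 U, ∫ z, h (affineEReal (1 / α t) (-β t / α t) z)
      ∂K (upperQuantile F (u / t))) atTop (𝓝 (∫ z, h z ∂sectionLaw μ (gevQuantile γ U))) := by
  set y := gevQuantile γ U with hy_def
  have hy : y ∈ EInterval γ := gevQuantile_mem hU
  have hyU : gevTail γ y = U := gevTail_gevQuantile hU
  have hfin := isFiniteMeasure_sectionLaw μ hy
  -- As `y' n` decreases to `y`, the ramps vanish up to `y` and increase to the indicator of heights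
  -- strictly above `y`.
  let y' : ℕ → ℝ := fun n => y + 1 / ((n : ℝ) + 1)
  have hy' : ∀ n, y < y' n := fun n => lt_add_of_pos_right _ (by positivity)
  -- the inner integral
  let g : ℝ → ℝ → ℝ := fun t u => ∫ z, h (affineEReal (1 / α t) (-β t / α t) z)
    ∂K (upperQuantile F (u / t))
  have hhaff : ∀ t, Measurable fun z => h (affineEReal (1 / α t) (-β t / α t) z) := fun t =>
    hh.measurable.comp (Measurable.affineEReal measurable_const measurable_const measurable_id)
  have hgm : ∀ t, Measurable (g t) := fun t =>
    measurable_integral_kernel_upperQuantile F K t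
      (h := fun q => h (affineEReal (1 / α t) (-β t / α t) q.2)) ((hhaff t).comp measurable_snd)
  have hg0 : ∀ t u, 0 ≤ g t u := fun t u => integral_nonneg fun z => h0 _
  have hg1 : ∀ t u, g t u ≤ 1 := fun t u => by
    have hint : Integrable (fun z => h (affineEReal (1 / α t) (-β t / α t) z))
        (K (upperQuantile F (u / t))) := by
      refine Integrable.of_bound (hhaff t).aestronglyMeasurable 1 (Eventually.of_forall fun z => ?_)
      rw [Real.norm_of_nonneg (h0 _)]
      exact h1 _
    have := integral_mono hint (integrable_const (1 : ℝ)) fun z => h1 _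
    simp only [integral_const, probReal_univ, one_smul] at this
    exact this
  let Q : ℝ → ℝ → ℝ := fun t u => (upperQuantile F (u / t) - b t) / a t
  have hQm : ∀ t, Measurable (Q t) := fun t =>
    ((measurable_upperQuantile_div F t).sub_const _).div_const _
  -- the cutoff at quantile levels
  let χ : ℕ → EReal → ℝ := fun n =>
    (EIntervalRightClosed γ).indicator (ramp y (y' n))
  have hχm : ∀ n, Measurable (χ n) := fun n =>
    (continuous_ramp (hy' n).le).measurable.indicator (measurableSet_EIntervalRightClosed γ)
  have hχ0 : ∀ n z, 0 ≤ χ n z := fun n z =>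
    indicator_nonneg (fun z _ => ramp_nonneg (hy' n).le z) z
  have hχ1 : ∀ n z, χ n z ≤ 1 := fun n z =>
    indicator_apply_le' (fun _ => ramp_le_one (hy' n).le z) fun _ => zero_le_one
  have hχle : ∀ n (z : EReal), z ≤ y → χ n z = 0 := fun n z hz => by
    simp only [χ, indicator, ramp_of_le hz, ite_self]
  have hrep : ∀ n t, 0 < t → ∫ p, rampTest hy (hy' n).le hh p ∂(scaledLaw P X Y γ α β a b t) =
      ∫ u in Ioo 0 t, g t u * χ n (Q t u) := by
    intro n t ht
    have h2 := integral_scaledLaw F K (γ := γ) (α := α) (β := β) (a := a) (b := b) hX hY hK ht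
      (hα t) (h := fun p => h p.1 * χ n p.2) (C := 1)
      ((hh.measurable.comp measurable_fst).mul ((hχm n).comp measurable_snd))
      (fun p => by
        rw [abs_of_nonneg (mul_nonneg (h0 _) (hχ0 _ _))]
        exact mul_le_one₀ (h1 _) (hχ0 _ _) (hχ1 _ _))
      (fun p hp => by simp only [χ, indicator, hp, if_false, mul_zero])
    have h3 : ∀ p : CEVSpace γ, rampTest hy (hy' n).le hh p =
        h (cevInclusion γ p).1 * χ n (cevInclusion γ p).2 := fun p => by
      simp only [χ, indicator, cevInclusion, p.2.2, if_true]
      rfl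
    simp only [h3, h2, integral_mul_const]
    rfl
  -- the cutoff error
  let e : ℕ → ℝ := fun n => ∫ u in Ioi 0, |(Iio U).indicator (fun _ => (1 : ℝ)) u -
    χ n (gevQuantile γ u)|
  have he_t : ∀ n, Tendsto (fun t => ∫ u in Ioo 0 t,
      |(Iio U).indicator (fun _ => (1 : ℝ)) u - χ n (Q t u)|) atTop (𝓝 (e n)) := by
    intro n
    refine tendsto_setIntegral_Ioo (C := 1) (M := U + 1) ?_ ?_ ?_
    · intro t
      have : Measurable fun u => (Iio U).indicator (fun _ => (1 : ℝ)) u - χ n (Q t u) :=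
        (measurable_const.indicator measurableSet_Iio).sub
          ((hχm n).comp (hQm t).coe_real_ereal)
      exact this.abs
    · filter_upwards [hdoa.eventually_level_le ha hy] with t ht u hu
      have hi0 : 0 ≤ (Iio U).indicator (fun _ => (1 : ℝ)) u :=
        indicator_nonneg (fun _ _ => zero_le_one) u
      have hi1 : (Iio U).indicator (fun _ => (1 : ℝ)) u ≤ 1 :=
        indicator_apply_le' (fun _ => le_rfl) fun _ => zero_le_one
      refine ⟨?_, fun hM => ?_⟩
      · rw [abs_abs, abs_le]
        constructor <;> linarith [hχ0 n (Q t u), hχ1 n (Q t u)]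
      · rw [hyU] at ht
        have h4 : Q t u ≤ y := le_of_not_gt fun h5 => absurd (ht u hu h5) (not_le.2 hM)
        rw [hχle n _ (EReal.coe_le_coe_iff.2 h4)]
        simp only [indicator, mem_Iio, (by linarith : ¬ u < U), if_false, sub_zero, abs_zero]
    · intro u hu
      have hmem := gevQuantile_mem (γ := γ) hu
      have hQ : Tendsto (fun t => ((Q t u : ℝ) : EReal)) atTop
          (𝓝 ((gevQuantile γ u : ℝ) : EReal)) :=
        (continuous_coe_real_ereal.tendsto _).comp (hdoa.tendsto_upperQuantile ha hu)
      -- The limiting quantile is interior to the state space, so cutting `χ n` off outside it does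
      -- no harm.
      have hχc : ContinuousAt (χ n) ((gevQuantile γ u : ℝ) : EReal) := by
        refine (continuous_ramp (hy' n).le).continuousAt.congr ?_
        filter_upwards [Ioo_mem_nhds (mem_EInterval_iff.1 hmem).1 (mem_EInterval_iff.1 hmem).2]
          with z hz
        rw [show χ n z = _ from indicator_of_mem (Ioo_subset_Ioc_self hz) _]
      exact (tendsto_const_nhds.sub (hχc.tendsto.comp hQ)).abs
  have he : Tendsto e atTop (𝓝 0) := by
    have h5 : ∀ u ∈ Ioi (0 : ℝ), Tendsto (fun n => |(Iio U).indicator (fun _ => (1 : ℝ)) u -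
        χ n (gevQuantile γ u)|) atTop (𝓝 0) := by
      intro u hu
      have h6 : (Ioi (y : EReal)).indicator (fun _ => (1 : ℝ)) ((gevQuantile γ u : ℝ) : EReal) =
          (Iio U).indicator (fun _ => (1 : ℝ)) u := by
        have : (y : EReal) < gevQuantile γ u ↔ u < U := by
          rw [EReal.coe_lt_coe_iff, lt_gevQuantile_iff hu hy, hyU]
        simp only [indicator, mem_Ioi, mem_Iio, this]
      have h7 := (tendsto_const_nhds (x := (Iio U).indicator (fun _ => (1 : ℝ)) u)).sub
        (tendsto_ramp y ((gevQuantile γ u : ℝ) : EReal))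
      rw [h6, sub_self] at h7
      have h8 := h7.abs
      rw [abs_zero] at h8
      refine h8.congr fun n => ?_
      rw [show χ n _ = _ from
        indicator_of_mem (coe_mem_EIntervalRightClosed (gevQuantile_mem (γ := γ) hu)) _]
    have h9 := tendsto_integral_of_dominated_convergence
      (μ := volume.restrict (Ioi (0 : ℝ)))
      (F := fun n u => |(Iio U).indicator (fun _ => (1 : ℝ)) u - χ n (gevQuantile γ u)|)
      (f := fun _ => 0) ((Iio U).indicator fun _ => 1) ?_ ?_ ?_
      ((ae_restrict_iff' measurableSet_Ioi).2 (Eventually.of_forall h5))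
    · simpa using h9
    · intro n
      have : Measurable fun u => (Iio U).indicator (fun _ => (1 : ℝ)) u - χ n (gevQuantile γ u) :=
        (measurable_const.indicator measurableSet_Iio).sub
          ((hχm n).comp (measurable_gevQuantile γ).coe_real_ereal)
      exact this.abs.aestronglyMeasurable
    · rw [integrable_indicator_iff measurableSet_Iio]
      refine integrableOn_const ?_
      rw [Measure.restrict_apply measurableSet_Iio, inter_comm, Ioi_inter_Iio]
      simp
    · intro n
      refine (ae_restrict_iff' measurableSet_Ioi).2 (Eventually.of_forall fun u hu => ?_)
      rw [Real.norm_eq_abs, abs_abs]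
      by_cases hlt : u < U
      · simp only [indicator, mem_Iio, hlt, if_true]
        rw [abs_le]
        constructor <;> linarith [hχ0 n (gevQuantile γ u), hχ1 n (gevQuantile γ u)]
      · have : ((gevQuantile γ u : ℝ) : EReal) ≤ y := EReal.coe_le_coe_iff.2 <|
          le_of_not_gt fun h5 => hlt (hyU ▸ (lt_gevQuantile_iff hu hy).1 h5)
        rw [hχle n _ this]
        simp [indicator, hlt]
  -- the limits
  have hlim_n : Tendsto (fun n => ∫ p, rampTest hy (hy' n).le hh p ∂μ) atTop
      (𝓝 (∫ z, h z ∂sectionLaw μ y)) := by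
    have hS := measurableSet_upperRect (γ := γ) MeasurableSet.univ y
    have h10 : ∫ z, h z ∂sectionLaw μ y =
        ∫ p, (upperRect γ univ y).indicator (fun p => h p.1) p ∂μ := by
      rw [integral_indicator hS, sectionLaw,
        integral_map measurable_fst.aemeasurable hh.aestronglyMeasurable]
    rw [h10]
    refine tendsto_integral_of_dominated_convergence ((upperRect γ univ y).indicator fun _ => 1)
      (fun n => (rampTest hy (hy' n).le hh).continuous.aestronglyMeasurable) ?_ ?_ ?_
    · rw [integrable_indicator_iff hS]
      refine integrableOn_const ?_
      rw [← sectionLaw_apply μ y MeasurableSet.univ]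
      exact measure_ne_top _ _
    · intro n
      refine Eventually.of_forall fun p => ?_
      change ‖h p.1 * ramp y (y' n) p.2‖ ≤ _
      rw [Real.norm_of_nonneg (mul_nonneg (h0 _) (ramp_nonneg (hy' n).le _))]
      by_cases hp : p ∈ upperRect γ univ y
      · rw [indicator_of_mem hp]
        exact mul_le_one₀ (h1 _) (ramp_nonneg (hy' n).le _) (ramp_le_one (hy' n).le _)
      · rw [indicator_of_notMem hp, ramp_of_le (not_lt.1 fun h11 => hp ⟨trivial, h11⟩), mul_zero]
    · refine Eventually.of_forall fun p => ?_
      have h11 := (tendsto_ramp y (p.2 : EReal)).const_mul (h p.1)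
      have h12 : h p.1 * (Ioi (y : EReal)).indicator (fun _ => 1) (p.2 : EReal) =
          (upperRect γ univ y).indicator (fun p => h p.1) p := by
        by_cases hp : (y : EReal) < p.2
        · rw [indicator_of_mem (show (p.2 : EReal) ∈ Ioi (y : EReal) from hp),
            indicator_of_mem (show p ∈ upperRect γ univ y from ⟨trivial, hp⟩), mul_one]
        · rw [indicator_of_notMem (show (p.2 : EReal) ∉ Ioi (y : EReal) from hp),
            indicator_of_notMem (show p ∉ upperRect γ univ y from fun h => hp h.2), mul_zero]
      rw [h12] at h11
      exact h11
  -- comparison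
  have hcmp : ∀ n, ∀ᶠ t in atTop, |(∫ u in Ioo 0 U, g t u) -
      ∫ p, rampTest hy (hy' n).le hh p ∂(scaledLaw P X Y γ α β a b t)| ≤
        ∫ u in Ioo 0 t, |(Iio U).indicator (fun _ => (1 : ℝ)) u - χ n (Q t u)| := by
    intro n
    filter_upwards [eventually_gt_atTop 0, eventually_ge_atTop U] with t ht htU
    have hI : ∫ u in Ioo 0 U, g t u =
        ∫ u in Ioo 0 t, g t u * (Iio U).indicator (fun _ => (1 : ℝ)) u := by
      have : ∀ u, g t u * (Iio U).indicator (fun _ => (1 : ℝ)) u = (Iio U).indicator (g t) u := by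
        intro u
        by_cases hu : u < U <;> simp [indicator, hu]
      simp only [this]
      rw [integral_indicator measurableSet_Iio, Measure.restrict_restrict measurableSet_Iio]
      congr 2
      ext u
      simp only [mem_Ioo, mem_inter_iff, mem_Iio]
      exact ⟨fun hu => ⟨hu.2, hu.1, hu.2.trans_le htU⟩, fun hu => ⟨hu.2.1, hu.1⟩⟩
    have hi : Measurable ((Iio U).indicator fun _ => (1 : ℝ)) :=
      measurable_const.indicator measurableSet_Iio
    have hi0 : ∀ u, 0 ≤ (Iio U).indicator (fun _ => (1 : ℝ)) u :=
      fun u => indicator_nonneg (fun _ _ => zero_le_one) u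
    have hi1 : ∀ u, (Iio U).indicator (fun _ => (1 : ℝ)) u ≤ 1 :=
      fun u => indicator_apply_le' (fun _ => le_rfl) fun _ => zero_le_one
    have hχQ : Measurable fun u => χ n (Q t u) := (hχm n).comp (hQm t).coe_real_ereal
    have hint1 : Integrable (fun u => g t u * (Iio U).indicator (fun _ => (1 : ℝ)) u)
        (volume.restrict (Ioo 0 t)) := by
      refine Integrable.of_bound ((hgm t).mul hi).aestronglyMeasurable 1
        (Eventually.of_forall fun u => ?_)
      rw [Real.norm_of_nonneg (mul_nonneg (hg0 _ _) (hi0 _))]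
      exact mul_le_one₀ (hg1 _ _) (hi0 _) (hi1 _)
    have hint2 : Integrable (fun u => g t u * χ n (Q t u)) (volume.restrict (Ioo 0 t)) := by
      refine Integrable.of_bound ((hgm t).mul hχQ).aestronglyMeasurable 1
        (Eventually.of_forall fun u => ?_)
      rw [Real.norm_of_nonneg (mul_nonneg (hg0 _ _) (hχ0 _ _))]
      exact mul_le_one₀ (hg1 _ _) (hχ0 _ _) (hχ1 _ _)
    have hint3 : Integrable (fun u => |(Iio U).indicator (fun _ => (1 : ℝ)) u - χ n (Q t u)|)
        (volume.restrict (Ioo 0 t)) := by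
      refine Integrable.of_bound (hi.sub hχQ).abs.aestronglyMeasurable 1
        (Eventually.of_forall fun u => ?_)
      rw [Real.norm_eq_abs, abs_abs, abs_le]
      constructor <;> linarith [hχ0 n (Q t u), hχ1 n (Q t u), hi0 u, hi1 u]
    rw [hrep n t ht, hI, ← integral_sub hint1 hint2, ← Real.norm_eq_abs]
    refine (norm_integral_le_integral_norm _).trans (integral_mono (hint1.sub hint2).norm hint3
      fun u => ?_)
    rw [← mul_sub, norm_mul, Real.norm_of_nonneg (hg0 t u), Real.norm_eq_abs]
    exact mul_le_of_le_one_left (abs_nonneg _) (hg1 t u)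
  rw [Metric.tendsto_nhds]
  intro ε hε
  -- First `n` makes the limiting cutoff error and the ramp error under `μ` small; then `t` is taken
  -- large for this `n`.
  obtain ⟨n, hn1, hn2⟩ := ((he.eventually (gt_mem_nhds (show 0 < ε / 3 by positivity))).and
    (Metric.tendsto_nhds.1 hlim_n (ε / 3) (by positivity))).exists
  filter_upwards [hcmp n, (he_t n).eventually (gt_mem_nhds hn1),
    Metric.tendsto_nhds.1 (hμ (rampTest hy (hy' n).le hh)) (ε / 3) (by positivity)]
    with t ht1 ht2 ht3
  rw [Real.dist_eq] at hn2 ht3 ⊢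
  have h13 := abs_sub_le (∫ u in Ioo 0 U, g t u)
    (∫ p, rampTest hy (hy' n).le hh p ∂(scaledLaw P X Y γ α β a b t))
    (∫ z, h z ∂sectionLaw μ y)
  have h14 := abs_sub_le (∫ p, rampTest hy (hy' n).le hh p ∂(scaledLaw P X Y γ α β a b t))
    (∫ p, rampTest hy (hy' n).le hh p ∂μ) (∫ z, h z ∂sectionLaw μ y)
  change |(∫ u in Ioo 0 U, g t u) - _| < ε
  linarith

end forward

section forward

variable {Ω : Type*} [MeasurableSpace Ω] {P : Measure Ω} {X Y : Ω → ℝ}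
  {F : Measure ℝ} [IsProbabilityMeasure F] {K : Kernel ℝ EReal} [IsMarkovKernel K]
  {α β : ℝ → ℝ} {γ : ℝ} {a b : ℝ → ℝ} {μ : Measure (CEVSpace γ)}

theorem integral_indicator_affineEReal (κ : Measure EReal) [IsProbabilityMeasure κ] {s : ℝ}
    (hs : 0 < s) (m x : ℝ) :
    ∫ z, (Iic (x : EReal)).indicator (fun _ => (1 : ℝ)) (affineEReal (1 / s) (-m / s) z) ∂κ =
      κ.real (Iic ((s * x + m : ℝ) : EReal)) := by
  rw [← integral_indicator_one measurableSet_Iic]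
  congr 1
  ext z
  have h1 : affineEReal (1 / s) (-m / s) z ≤ x ↔ z ≤ ((s * x + m : ℝ) : EReal) := by
    rw [affineEReal_le_coe_iff (by positivity)]
    have : (x - -m / s) / (1 / s) = s * x + m := by field_simp; ring
    rw [this]
  simp only [indicator, mem_Iic, h1, Pi.one_apply]

theorem integrable_of_mem_Icc {δ : Type*} [MeasurableSpace δ] (κ : Measure δ) [IsFiniteMeasure κ]
    {f : δ → ℝ} (hf : Measurable f) (h : ∀ d, f d ∈ Icc (0 : ℝ) 1) : Integrable f κ := by
  refine Integrable.of_bound hf.aestronglyMeasurable 1 (Eventually.of_forall fun d => ?_)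
  rw [Real.norm_of_nonneg (h d).1]
  exact (h d).2

theorem integral_mem_Icc {δ : Type*} [MeasurableSpace δ] (κ : Measure δ) [IsProbabilityMeasure κ]
    {f : δ → ℝ} (hf : Measurable f) (h : ∀ d, f d ∈ Icc (0 : ℝ) 1) :
    ∫ d, f d ∂κ ∈ Icc (0 : ℝ) 1 := by
  refine ⟨integral_nonneg fun d => (h d).1, ?_⟩
  have := integral_mono (integrable_of_mem_Icc κ hf h) (integrable_const (1 : ℝ)) fun d => (h d).2
  simp only [integral_const, probReal_univ, one_smul] at this
  exact this

/-- Monotonicity of the mixtures in the test function. -/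
theorem integral_mixture_mono (F : Measure ℝ) [IsProbabilityMeasure F] (K : Kernel ℝ EReal)
    [IsMarkovKernel K] (U t s m : ℝ) {h h' : EReal → ℝ} (hm : Measurable h) (hm' : Measurable h')
    (hI : ∀ z, h z ∈ Icc (0 : ℝ) 1) (hI' : ∀ z, h' z ∈ Icc (0 : ℝ) 1) (hle : ∀ z, h z ≤ h' z) :
    ∫ u in Ioo 0 U, ∫ z, h (affineEReal s m z) ∂K (upperQuantile F (u / t)) ≤
      ∫ u in Ioo 0 U, ∫ z, h' (affineEReal s m z) ∂K (upperQuantile F (u / t)) := by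
  have haff : Measurable fun z => affineEReal s m z :=
    Measurable.affineEReal measurable_const measurable_const measurable_id
  refine integral_mono (integrable_of_mem_Icc _ ?_ fun u => ?_)
    (integrable_of_mem_Icc _ ?_ fun u => ?_) fun u => ?_
  · exact measurable_integral_kernel_upperQuantile F K t (h := fun q => h (affineEReal s m q.2))
      ((hm.comp haff).comp measurable_snd)
  · exact integral_mem_Icc _ (hm.comp haff) fun z => hI _
  · exact measurable_integral_kernel_upperQuantile F K t (h := fun q => h' (affineEReal s m q.2))
      ((hm'.comp haff).comp measurable_snd)
  · exact integral_mem_Icc _ (hm'.comp haff) fun z => hI' _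
  · exact integral_mono (integrable_of_mem_Icc _ (hm.comp haff) fun z => hI _)
      (integrable_of_mem_Icc _ (hm'.comp haff) fun z => hI' _) fun z => hle _

/-- Indicators of half-lines are squeezed between continuous functions, and the gap closes at
continuity points of the limiting section law. The possible masses at `±∞` cause no loss, as the
test functions are continuous on all of `[-∞, ∞]`. -/
theorem tendsto_distFun_mixture (hX : Measurable X) (hY : Measurable Y)
    (hK : P.map (fun ω => (Y ω, (X ω : EReal))) = F.compProd K)
    (hα : ∀ s, 0 < α s) (ha : ∀ t, 0 < t → 0 < a t) (hdoa : InDomainOfAttraction F γ a b)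
    [IsFiniteMeasureOnCompacts μ]
    (hμ : VagueTendsto (scaledLaw P X Y γ α β a b) atTop μ) {U : ℝ} (hU : 0 < U) :
    ∀ᵐ x : ℝ, Tendsto (fun t => ∫ u in (0 : ℝ)..U,
      (K (upperQuantile F (u / t))).real (Iic ((α t * x + β t : ℝ) : EReal))) atTop
        (𝓝 ((sectionLaw μ (gevQuantile γ U)).real (Iic (x : EReal)))) := by
  have hfin := isFiniteMeasure_sectionLaw μ (gevQuantile_mem (γ := γ) hU)
  set ν := sectionLaw μ (gevQuantile γ U)
  have hcont : ∀ᵐ x : ℝ, ContinuousAt (distFun ν) x := by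
    simpa using (distFun ν).mono.ae_continuousAt_affine one_ne_zero 0
  filter_upwards [hcont] with x hx
  have hD : ∀ t, ∫ u in (0 : ℝ)..U,
      (K (upperQuantile F (u / t))).real (Iic ((α t * x + β t : ℝ) : EReal)) =
      ∫ u in Ioo 0 U, ∫ z, (Iic (x : EReal)).indicator (fun _ => (1 : ℝ))
        (affineEReal (1 / α t) (-β t / α t) z) ∂K (upperQuantile F (u / t)) := by
    intro t
    simp only [integral_indicator_affineEReal _ (hα t)]
    rw [intervalIntegral.integral_of_le hU.le, integral_Ioc_eq_integral_Ioo]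
  simp only [hD]
  have hind : ∀ x : ℝ, ∫ z, (Iic (x : EReal)).indicator (fun _ => (1 : ℝ)) z ∂ν = distFun ν x :=
    fun x => integral_indicator_one measurableSet_Iic
  have hindm : ∀ x : ℝ, Measurable ((Iic (x : EReal)).indicator fun _ => (1 : ℝ)) :=
    fun x => measurable_const.indicator measurableSet_Iic
  have hindI : ∀ (x : ℝ) z, (Iic (x : EReal)).indicator (fun _ => (1 : ℝ)) z ∈ Icc (0 : ℝ) 1 :=
    fun x z => ⟨indicator_nonneg (fun _ _ => zero_le_one) z,
      indicator_apply_le' (fun _ => le_rfl) fun _ => zero_le_one⟩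
  -- a continuous function between the indicators of two half-lines
  have hsep : ∀ x₁ x₂ : ℝ, x₁ < x₂ → ∃ h : EReal → ℝ, Continuous h ∧
      (∀ z, h z ∈ Icc (0 : ℝ) 1) ∧ (∀ z, (Iic (x₁ : EReal)).indicator (fun _ => (1 : ℝ)) z ≤ h z) ∧
        ∀ z, h z ≤ (Iic (x₂ : EReal)).indicator (fun _ => (1 : ℝ)) z := by
    intro x₁ x₂ hlt
    have hI : ∀ z, 1 - ramp x₁ x₂ z ∈ Icc (0 : ℝ) 1 := fun z =>
      ⟨by linarith [ramp_le_one hlt.le z], by linarith [ramp_nonneg hlt.le z]⟩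
    refine ⟨fun z => 1 - ramp x₁ x₂ z, continuous_const.sub (continuous_ramp hlt.le), hI,
      fun z => ?_, fun z => ?_⟩
    · refine indicator_apply_le' (fun hz => ?_) fun _ => (hI z).1
      change (1 : ℝ) ≤ 1 - ramp x₁ x₂ z
      rw [ramp_of_le hz, sub_zero]
    · by_cases hz : z ≤ x₂
      · rw [indicator_of_mem (show z ∈ Iic (x₂ : EReal) from hz)]
        exact (hI z).2
      · change 1 - ramp x₁ x₂ z ≤ _
        rw [ramp_of_ge hlt (not_le.1 hz).le, sub_self]
        exact (hindI x₂ z).1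
  have hlim : ∀ {h : EReal → ℝ}, Continuous h → (∀ z, h z ∈ Icc (0 : ℝ) 1) → _ :=
    fun {h} hc hI => tendsto_integral_mixture hX hY hK hα ha hdoa hμ hU hc (fun z => (hI z).1)
      fun z => (hI z).2
  refine tendsto_order.2 ⟨fun r hr => ?_, fun r hr => ?_⟩
  · have hev : ∀ᶠ y in 𝓝[<] x, r < distFun ν y :=
      mem_nhdsWithin_of_mem_nhds (hx.eventually (lt_mem_nhds hr))
    obtain ⟨x', hx', hlt⟩ := (hev.and self_mem_nhdsWithin).exists
    obtain ⟨h, hc, hI, h1, h2⟩ := hsep x' x hlt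
    have hge : r < ∫ z, h z ∂ν := by
      refine hx'.trans_le ?_
      rw [← hind]
      exact integral_mono (integrable_of_mem_Icc _ (hindm _) (hindI _))
        (integrable_of_mem_Icc _ hc.measurable hI) h1
    filter_upwards [(hlim hc hI).eventually (lt_mem_nhds hge)] with t ht
    exact ht.trans_le (integral_mixture_mono F K U t _ _ hc.measurable (hindm _) hI (hindI _) h2)
  · have hev : ∀ᶠ y in 𝓝[>] x, distFun ν y < r :=
      mem_nhdsWithin_of_mem_nhds (hx.eventually (gt_mem_nhds hr))
    obtain ⟨x', hx', hlt⟩ := (hev.and self_mem_nhdsWithin).exists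
    obtain ⟨h, hc, hI, h1, h2⟩ := hsep x x' hlt
    have hle : ∫ z, h z ∂ν < r := by
      refine lt_of_le_of_lt ?_ hx'
      rw [← hind]
      exact integral_mono (integrable_of_mem_Icc _ hc.measurable hI)
        (integrable_of_mem_Icc _ (hindm _) (hindI _)) h2
    filter_upwards [(hlim hc hI).eventually (gt_mem_nhds hle)] with t ht
    exact (integral_mixture_mono F K U t _ _ (hindm _) hc.measurable (hindI _) hI h1).trans_lt ht

/-- Level `U` corresponds to height `gevQuantile γ U`, so nondegeneracy above every height gives
nondegenerate limits of the mixtures over every `(0, U)`. -/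
theorem IsCEVMLimit.exists_isERV (hX : Measurable X) (hY : Measurable Y)
    (hK : P.map (fun ω => (Y ω, (X ω : EReal))) = F.compProd K)
    (hα : ∀ s, 0 < α s) (ha : ∀ t, 0 < t → 0 < a t) (hdoa : InDomainOfAttraction F γ a b)
    (hμ : IsCEVMLimit P X Y γ α β a b μ) : ∃ ρ k : ℝ, IsERV α β ρ k := by
  classical
  have := hμ.radon
  have hfin : ∀ U, 0 < U → IsFiniteMeasure (sectionLaw μ (gevQuantile γ U)) := fun U hU =>
    isFiniteMeasure_sectionLaw μ (gevQuantile_mem hU)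
  -- Finiteness of the section law is known only for `U > 0`; the default value elsewhere plays no
  -- role.
  let m : ℝ → StieltjesFunction ℝ := fun U =>
    if hU : 0 < U then
      haveI := hfin U hU
      distFun (sectionLaw μ (gevQuantile γ U))
    else default
  have hm : ∀ U (hU : 0 < U), haveI := hfin U hU
      m U = distFun (sectionLaw μ (gevQuantile γ U)) := fun U hU => dif_pos hU
  refine exists_isERV_of_tendsto_integral
    (H := fun p x => (K (upperQuantile F p)).real (Iic (x : EReal)))
    (fun p x y hxy => measureReal_mono (Iic_subset_Iic.2 (EReal.coe_le_coe_iff.2 hxy)))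
    (fun p x => measureReal_nonneg) (fun p x => measureReal_le_one) (fun x => ?_) hα (m := m)
    (fun U hU => ?_) fun U hU => ?_
  · exact ((K.measurable_coe measurableSet_Iic).comp (measurable_upperQuantile F)).ennreal_toReal
  · have := hfin U hU
    rw [hm U hU]
    have hnd : NondegenerateOnReals (sectionLaw μ (gevQuantile γ U)) :=
      hμ.nondegenerate _ (gevQuantile_mem hU)
    exact hnd.nondegenerateFun
  · have := hfin U hU
    rw [hm U hU]
    exact tendsto_distFun_mixture hX hY hK hα ha hdoa hμ.vague hU

end forward

/-! ### The main theorem -/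

theorem KernelConverges.tendsto_distFun {K : Kernel ℝ EReal} [IsMarkovKernel K] {αt βt : ℝ → ℝ}
    {G : Measure EReal} [IsProbabilityMeasure G] {l : Filter ℝ} (h : KernelConverges K αt βt G l)
    {bs : ℝ → ℝ} (hbs : Tendsto bs atTop l) :
    ∀ᵐ x : ℝ, Tendsto (fun r => (K (bs r)).real
      (Iic (((αt ∘ bs) r * x + (βt ∘ bs) r : ℝ) : EReal))) atTop (𝓝 (distFun G x)) := by
  filter_upwards [ae_measure_singleton_eq_zero G] with x hx
  exact (ENNReal.tendsto_toReal (measure_ne_top _ _)).comp ((h x hx).comp hbs)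

theorem theorem5p3 {Ω : Type*} [MeasurableSpace Ω] (P : Measure Ω) [IsProbabilityMeasure P]
    (X Y : Ω → ℝ) (hX : Measurable X) (hY : Measurable Y)
    -- the law of `Y` is in `D(G_γ)` with normalizations `a > 0` and `b`
    (γ : ℝ) (a b : ℝ → ℝ) (ha : ∀ t : ℝ, 0 < t → 0 < a t)
    (hdoa : InDomainOfAttraction (P.map Y) γ a b)
    -- `K` is a version of the conditional distribution of `X` given `Y`
    (K : Kernel ℝ EReal) [IsMarkovKernel K]
    (hK : P.map (fun ω => (Y ω, (X ω : EReal))) = (P.map Y).compProd K)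
    -- kernel convergence at the upper endpoint to a non-degenerate `G` on `[-∞, ∞)`
    (αt βt : ℝ → ℝ) (hαt : ∀ s : ℝ, 0 < αt s)
    (G : Measure EReal) [IsProbabilityMeasure G] (hGtop : G {⊤} = 0)
    (hG : NondegenerateOnReals G)
    (hconv : KernelConverges K αt βt G (toUpperEndpoint (P.map Y)))
    -- `bs` is a continuous, strictly monotone version of `b` on `(0, ∞)`
    (bs : ℝ → ℝ) (hbs_cont : ContinuousOn bs (Ioi 0))
    (hbs_mono : StrictMonoOn bs (Ioi 0) ∨ StrictAntiOn bs (Ioi 0))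
    (hbs : Tendsto (fun t : ℝ => (bs t - b t) / a t) atTop (𝓝 0)) :
    ((∃ μ : Measure (CEVSpace γ), IsCEVMLimit P X Y γ (αt ∘ bs) (βt ∘ bs) a b μ) ↔
      ∃ ρ k : ℝ, IsERV (αt ∘ bs) (βt ∘ bs) ρ k) ∧
    ∀ ρ k : ℝ, IsERV (αt ∘ bs) (βt ∘ bs) ρ k →
      (∀ μ : Measure (CEVSpace γ), IsCEVMLimit P X Y γ (αt ∘ bs) (βt ∘ bs) a b μ →
        ∀ x : ℝ, ∀ y ∈ EInterval γ,
          μ (upperRect γ (Iic (x : EReal)) y) = limitMass G γ ρ k x y) ∧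
      ((ρ, k) ≠ (0, 0) → ∀ x : ℝ, ∀ y ∈ EInterval γ,
        ¬ (ρ ≠ 0 ∧ x = -k / ρ ∧ G {(x : EReal)} ≠ 0) →
        ContinuousAt (fun p : ℝ × ℝ => limitMass G γ ρ k p.1 p.2) (x, y)) := by
  have hF : IsProbabilityMeasure (P.map Y) := Measure.isProbabilityMeasure_map hY.aemeasurable
  have htail := hdoa.tendsto_of_asymp ha hbs
  have hKG := hconv.tendsto_distFun (tendsto_toUpperEndpoint_of_tail htail)
  have hα : ∀ s, 0 < (αt ∘ bs) s := fun s => hαt _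
  have hinj : InjOn bs (Ioi 0) := hbs_mono.elim StrictMonoOn.injOn StrictAntiOn.injOn
  have hlim : ∀ ρ k : ℝ, IsERV (αt ∘ bs) (βt ∘ bs) ρ k →
      IsCEVMLimit P X Y γ (αt ∘ bs) (βt ∘ bs) a b (limitMeasure G γ ρ k) := fun ρ k h =>
    { radon := isFiniteMeasureOnCompacts_limitMeasure G ρ k
      ne_zero := limitMeasure_ne_zero G ρ k
      vague := vagueTendsto_scaledLaw hX hY hK hα ha hdoa hbs_cont hinj htail hG hKG h
      nondegenerate := fun y hy => nondegenerateOnReals_sectionLaw_limitMeasure hG ρ k hy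
      no_mass_top := fun y hy => limitMeasure_upperRect_top G ρ k hGtop hy }
  refine ⟨⟨fun ⟨μ, hμ⟩ => hμ.exists_isERV hX hY hK hα ha hdoa,
    fun ⟨ρ, k, h⟩ => ⟨_, hlim ρ k h⟩⟩, fun ρ k h => ⟨fun μ hμ x y hy => ?_,
    fun hρk x y hy hx => continuousAt_limitMass hρk hy hx⟩⟩
  have h1 := hμ.radon
  have h2 := (hlim ρ k h).radon
  -- Local compactness is what lets compactly supported functions determine a Radon measure, so any
  -- limit `μ` coincides with `limitMeasure`.
  have : LocallyCompactSpace (EIntervalRightClosed γ) := by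
    refine IsLocallyClosed.locallyCompactSpace ?_
    rw [EIntervalRightClosed, ← Ioi_inter_Iic]
    exact isOpen_Ioi.isLocallyClosed.inter isClosed_Iic.isLocallyClosed
  rw [hμ.vague.unique (hlim ρ k h).vague, limitMeasure_upperRect_Iic G ρ k x hy]
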